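/- Let $k_0$ be a perfect field of characteristic $p>0$, let $V$ be an integral scheme, smooth, separated and of finite type over $k_0$ (for example smooth and quasi-projective), and let $K$ be its function field. Let $\mathcal A,\mathcal B,\mathcal B_1$ be commutative group schemes, smooth, separated and of finite type over $V$, whose generic fibres $A,B,B_1$ are abelian varieties over $K$ (for example semiabelian schemes which are abelian over a non-empty open subset of $V$). A homomorphism of such group schemes is called an isogeny of height one if it is surjective and its kernel is finite and flat over $V$ with zero relative Frobenius. Let $\iota:\mathcal A\to\mathcal B$ and $\beta:\mathcal B\to\mathcal B_1$ be isogenies of height one such that $\beta\circ\iota$ is also an isogeny of height one. Notation. For a finite commutative group scheme $G$ over $K$, $H^1(K,G)$ is the set of isomorphism classes of $G$-torsors over $\operatorname{Spec}K$ (for the fppf topology), with the commutative group structure given by the contracted product of torsors; $\omega_G=\epsilon^*\Omega_{G/K}$ is the pull-back of the differentials along the zero section $\epsilon$; $F_K$ is the absolute Frobenius endomorphism of $\operatorname{Spec}K$ and $\Omega_{F_K}$ is the module of differentials of the morphism $F_K$. For a homomorphism $f:A\to B$ over $K$, the Selmer group $\operatorname{Sel}(K,f)\subseteq H^1(K,\ker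 f)$ consists of the classes of the torsors $P$ such that, for every point $v$ of codimension one of $V$, with $K_v$ the completion of $K$ along the discrete valuation defined by $v$, the torsor $P_{K_v}$ is isomorphic to the torsor $f^{-1}(x)$ for some $x\in B(K_v)$. If $G$ is the kernel of one of $\iota_K$, $\beta_K\circ\iota_K$, $\beta_K$ and $\lambda:P\to\operatorname{Spec}K$ is a $G$-torsor, there is a unique morphism $\sigma:\operatorname{Spec}K\to P$ with $\lambda\circ\sigma=F_K$; the map $$\Phi_G:H^1(K,G)\to\operatorname{Hom}_K(F_K^*\omega_G,\Omega_{F_K})$$ sends the class of $P$ to the map $F_K^*\omega_G\simeq\sigma^*\Omega_{P/K}\to\Omega_{F_K}$ induced by $\sigma$, the isomorphism being the one given by the trivialisation $g\mapsto g\cdot\sigma$ of $F_K^*P$. Statement. The $H^1$'s are commutative groups, the Selmer groups are subgroups, the maps $\Phi$ are well-defined group homomorphisms, and the homomorphisms $\ker\iota_K\hookrightarrow\ker(\beta_K\circ\iota_K)$ and $\iota_K:\ker(\beta_K\circ\iota_K)\to\ker\beta_K$ induce homomorphisms in the commutative diagram $$\begin{array}{ccccccccc} &&0&&0&&0&&\\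 &&\downarrow&&\downarrow&&\downarrow&&\\ 0&\to&\operatorname{Sel}(K,\iota_K)&\to&\operatorname{Sel}(K,\beta_K\circ\iota_K)&\to&\operatorname{Sel}(K,\beta_K)&&\\ &&\downarrow\Phi&&\downarrow\Phi&&\downarrow\Phi&&\\ 0&\to&\operatorname{Hom}_K(F_K^*\omega_{\ker\iota_K},\Omega_{F_K})&\to&\operatorname{Hom}_K(F_K^*\omega_{\ker(\beta_K\circ\iota_K)},\Omega_{F_K})&\to&\operatorname{Hom}_K(F_K^*\omega_{\ker\beta_K},\Omega_{F_K})&\to&0 \end{array}$$ where the first row consists of the maps induced on torsors and the second row of the compositions with the pull-back maps of differential forms. The rows and the columns of this diagram are exact. -/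

import Mathlib

open CategoryTheory Limits AlgebraicGeometry

universe u

noncomputable section

namespace HeightOneSelmer

open MonoidalCategory CartesianMonoidalCategory MonObj
open scoped TensorProduct

/-! ### Torsors and their isomorphism classes -/

section Torsors

variable {S : Scheme.{u}}

/-- A torsor under a group scheme `G` over `S`, for the fppf topology: an `S`-scheme `X`, faithfully
flat and locally of finite presentation over `S`, with an action of `G` such that
`G × X ⟶ X × X`, `(g, x) ↦ (g x, x)`, is an isomorphism. The axioms of an action are written on
`T`-valued points. -/
structure Torsor (G : Grp (Over S)) where
  X : Over S
  act : G.X ⊗ X ⟶ X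
  one_act : ∀ {T : Over S} (x : T ⟶ X), lift (1 : T ⟶ G.X) x ≫ act = x
  mul_act : ∀ {T : Over S} (g h : T ⟶ G.X) (x : T ⟶ X),
    lift (g * h) x ≫ act = lift g (lift h x ≫ act) ≫ act
  isIso_shear : IsIso (lift act (snd G.X X))
  flat : Flat X.hom
  surjective : Surjective X.hom
  locallyOfFinitePresentation : LocallyOfFinitePresentation X.hom

namespace Torsor

variable {G G' : Grp (Over S)}

/-- The action of a `T`-valued point of `G` on a `T`-valued point of the torsor. -/
def smul (P : Torsor G) {T : Over S} (g : T ⟶ G.X) (x : T ⟶ P.X) : T ⟶ P.X :=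
  lift g x ≫ P.act

/-- An isomorphism of `G`-torsors: an isomorphism of `S`-schemes that commutes with the actions. -/
structure Iso (P Q : Torsor G) where
  iso : P.X ≅ Q.X
  comm : ∀ {T : Over S} (g : T ⟶ G.X) (x : T ⟶ P.X),
    P.smul g x ≫ iso.hom = Q.smul g (x ≫ iso.hom)

lemma lift_comp_smul (P : Torsor G) {T T' : Over S} (t : T' ⟶ T) (g : T ⟶ G.X) (x : T ⟶ P.X) :
    t ≫ P.smul g x = P.smul (t ≫ g) (t ≫ x) := by
  simp [smul, ← Category.assoc]

/-- Being isomorphic, as an equivalence relation on `G`-torsors. -/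
instance setoid (G : Grp (Over S)) : Setoid (Torsor G) where
  r P Q := Nonempty (Iso P Q)
  iseqv :=
    { refl := fun P ↦ ⟨⟨Iso.refl _, by simp⟩⟩
      symm := by
        rintro P Q ⟨e⟩
        refine ⟨⟨e.iso.symm, fun g x ↦ ?_⟩⟩
        rw [← cancel_mono e.iso.hom]
        simp [e.comm]
      trans := by
        rintro P Q R ⟨e⟩ ⟨f⟩
        refine ⟨⟨e.iso ≪≫ f.iso, fun g x ↦ ?_⟩⟩
        simp [← Category.assoc, e.comm, f.comm] }

/-- The torsor `Q` under `G'` is the torsor deduced from the `G`-torsor `P` by the homomorphism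
`a : G ⟶ G'` (the quotient of `P × G'` by `G`): there is an `S`-morphism
`q : P ⟶ Q` with `q (g x) = a(g) q(x)`. -/
def IsPushforward (a : G ⟶ G') (P : Torsor G) (Q : Torsor G') : Prop :=
  ∃ q : P.X ⟶ Q.X, ∀ {T : Over S} (g : T ⟶ G.X) (x : T ⟶ P.X),
    P.smul g x ≫ q = Q.smul (g ≫ a.hom.hom) (x ≫ q)

/-- The torsor `Q` is the sum (contracted product) of the torsors `P` and `P'` under the commutative
group scheme `G`, that is, the quotient of `P × P'` by the action `g (x, x') = (g x, g⁻¹ x')`: there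
is an `S`-morphism `q : P × P' ⟶ Q` with `q (g x, g' x') = g g' q(x, x')`. -/
def IsSum (P P' Q : Torsor G) : Prop :=
  ∃ q : P.X ⊗ P'.X ⟶ Q.X, ∀ {T : Over S} (g g' : T ⟶ G.X) (x : T ⟶ P.X) (x' : T ⟶ P'.X),
    lift (P.smul g x) (P'.smul g' x') ≫ q = Q.smul (g * g') (lift x x' ≫ q)

end Torsor

/-- `H¹(S, G)`: the set of isomorphism classes of `G`-torsors over `S`. -/
def H1 (G : Grp (Over S)) : Type (u + 1) := Quotient (Torsor.setoid G)

/-- The class of a torsor. -/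
def H1.mk {G : Grp (Over S)} (P : Torsor G) : H1 G := Quotient.mk _ P

/-- The given group structure on `H¹(S, G)` is the standard one, whose addition is the contracted
product of torsors. (The equivalence determines the addition, hence the whole structure.) -/
def H1.IsStandardGroup (G : Grp (Over S)) [AddCommGroup (H1 G)] : Prop :=
  ∀ P P' Q : Torsor G, H1.mk P + H1.mk P' = H1.mk Q ↔ Torsor.IsSum P P' Q

/-- The map `H¹(S, G) → H¹(S, G')` is the one induced by the homomorphism `a : G ⟶ G'`. -/
def H1.IsInducedBy {G G' : Grp (Over S)} (a : G ⟶ G') (f : H1 G → H1 G') : Prop :=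
  ∀ (P : Torsor G) (Q : Torsor G'), f (H1.mk P) = H1.mk Q ↔ Torsor.IsPushforward a P Q

end Torsors

/-! ### Kernels and isogenies of height one, abelian varieties -/

/-- A group scheme `G` over a scheme `S` of characteristic `p` has height one if it is finite and
flat over `S` and its relative Frobenius `G ⟶ G^(p)` is zero. As the absolute Frobenius commutes
with all morphisms, the composition of a point `g : Spec R ⟶ G` with the absolute Frobenius of `G`
is `g ∘ F_R`; the last condition says that it equals the neutral
element above `Spec R ⟶ S` composed with `F_R`. -/
structure IsHeightOne (p : ℕ) [Fact p.Prime] {S : Scheme.{u}} (G : Grp (Over S)) : Prop where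
  finite : IsFinite G.X.hom
  flat : Flat G.X.hom
  frobenius_eq_zero : ∀ (R : Type u) [CommRing R] [CharP R p] (g : Spec (.of R) ⟶ G.X.left),
    Spec.map (CommRingCat.ofHom (frobenius R p)) ≫ g =
      Spec.map (CommRingCat.ofHom (frobenius R p)) ≫ g ≫ G.X.hom ≫ η[G.X].left

/-- An isogeny of height one: a surjective homomorphism whose kernel has height one. -/
structure IsHeightOneIsogeny (p : ℕ) [Fact p.Prime] {S : Scheme.{u}} {G H : Grp (Over S)}
    (f : G ⟶ H) : Prop where
  surjective : Surjective f.hom.hom.left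
  kernel_isHeightOne : IsHeightOne p (kernel f)

/-- The generic fibre, as a functor from group schemes over the integral scheme `V` to group schemes
over its function field. -/
abbrev genericFibre (V : Scheme.{u}) [IsIntegral V] :
    Grp (Over V) ⥤ Grp (Over (Spec V.functionField)) :=
  (Over.pullback (V.fromSpecStalk (genericPoint V))).mapGrp

/-- A commutative group scheme, smooth, separated and of finite type over the integral scheme `V`,
whose generic fibre is an abelian variety, i.e. proper and geometrically integral. -/
structure IsGenericallyAbelian {V : Scheme.{u}} [IsIntegral V] (𝒜 : Grp (Over V)) : Prop where
  comm : IsCommMonObj 𝒜.X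
  smooth : Smooth 𝒜.X.hom
  separated : IsSeparated 𝒜.X.hom
  quasiCompact : QuasiCompact 𝒜.X.hom
  generic_isProper : IsProper ((genericFibre V).obj 𝒜).X.hom
  generic_geometricallyIntegral : GeometricallyIntegral ((genericFibre V).obj 𝒜).X.hom

/-- The function field of an integral scheme over a field of characteristic `p` has
characteristic `p`. -/
lemma charP_functionField {k₀ : Type u} [Field k₀] (p : ℕ) [CharP k₀ p] {V : Scheme.{u}}
    [IsIntegral V] (s : V ⟶ Spec (.of k₀)) : CharP V.functionField p :=
  let φ : k₀ →+* V.functionField :=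
    ((Scheme.ΓSpecIso (.of k₀)).inv ≫ s.appTop ≫ V.presheaf.germ ⊤ (genericPoint V) trivial).hom
  charP_of_injective_ringHom φ.injective p

section Kernels

variable {S : Scheme.{u}} {G H J : Grp (Over S)}

/-- The inclusion `ker f ⟶ ker (h ∘ f)`. -/
def kerIncl (f : G ⟶ H) (h : H ⟶ J) : kernel f ⟶ kernel (f ≫ h) :=
  kernel.lift (f ≫ h) (kernel.ι f) (by simp)

/-- The homomorphism `ker (h ∘ f) ⟶ ker h` induced by `f`. -/
def kerMap (f : G ⟶ H) (h : H ⟶ J) : kernel (f ≫ h) ⟶ kernel h :=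
  kernel.lift h (kernel.ι (f ≫ h) ≫ f) (by simp)

/-- For a homomorphism `f : G ⟶ H` of group schemes over `S`, a torsor `P` under `ker f` and an
`S`-scheme `T`: the torsor `P_T` lies in the image of the connecting map `δ : H(T) ⟶ H¹(T, ker f)`.
Here `δ(b)`, for `b : T ⟶ H`, is the fibre product of `f : G ⟶ H` and `b`, on which `ker f` acts
by translations; the condition is that it is isomorphic to `P × T` over `T`, compatibly with the
actions. -/
def Torsor.IsInImageDelta {f : G ⟶ H} (P : Torsor (kernel f)) (T : Over S) : Prop :=
  ∃ (b : T ⟶ H.X) (v : P.X ⊗ T ⟶ G.X), IsPullback v (snd P.X T) f.hom.hom b ∧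
    ∀ {T' : Over S} (g : T' ⟶ (kernel f).X) (x : T' ⟶ P.X) (t : T' ⟶ T),
      lift (P.smul g x) t ≫ v = (g ≫ (kernel.ι f).hom.hom) * (lift x t ≫ v)

end Kernels

/-! ### The Selmer group -/

section Selmer

variable (V : Scheme.{u}) [IsIntegral V]

/-- The spectrum of the completion `K_v` of the function field `K` of `V` along the discrete
valuation defined by a point `v` whose local ring is a discrete valuation ring, as a
`K`-scheme. -/
def specCompletion (v : V) [IsDiscreteValuationRing (V.presheaf.stalk v)] :
    Over (Spec V.functionField) :=
  Over.mk (Spec.map (CommRingCat.ofHom (algebraMap V.functionField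
    ((IsDiscreteValuationRing.maximalIdeal (V.presheaf.stalk v)).adicCompletion V.functionField))))

/-- The Selmer group `Sel_V(K, f) ⊆ H¹(K, ker f)` of a homomorphism `f` of group schemes over the
function field `K` of `V`, as a subset: the classes of the torsors `P` such that `P_{K_v}` lies in
the image of the connecting map for every point `v` of codimension one (the local rings at those
points are discrete valuation rings when `V` is regular, in particular when `V` is smooth over a
field). -/
def selmerSet {A B : Grp (Over (Spec V.functionField))} (f : A ⟶ B) : Set (H1 (kernel f)) :=
  {c | ∃ P : Torsor (kernel f), H1.mk P = c ∧
    ∀ v : V, Order.coheight v = 1 → ∀ [IsDiscreteValuationRing (V.presheaf.stalk v)],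
      P.IsInImageDelta (specCompletion V v)}

end Selmer

/-! ### Functions, points and differentials -/

section Functions

variable {K : CommRingCat.{u}}

/-- The ring of global functions of a scheme over `Spec K`. -/
def Fn (X : Over (Spec K)) : Type u := Γ(X.left, ⊤)

instance (X : Over (Spec K)) : CommRing (Fn X) := inferInstanceAs (CommRing Γ(X.left, ⊤))

instance (X : Over (Spec K)) : Algebra K (Fn X) :=
  ((Scheme.ΓSpecIso K).inv ≫ X.hom.appTop).hom.toAlgebra

/-- Pull-back of functions along a morphism over `Spec K`. -/
def Fn.pull {X Y : Over (Spec K)} (f : X ⟶ Y) : Fn Y →ₐ[K] Fn X where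
  toRingHom := f.left.appTop.hom
  commutes' r := by
    change (((Scheme.ΓSpecIso K).inv ≫ Y.hom.appTop) ≫ f.left.appTop).hom r =
      ((Scheme.ΓSpecIso K).inv ≫ X.hom.appTop).hom r
    rw [← Over.w f, Scheme.Hom.comp_appTop, Category.assoc]

/-- The spectrum of a `K`-algebra, as a scheme over `Spec K`. -/
def specAlg (K : CommRingCat.{u}) (L : Type u) [CommRing L] [Algebra K L] : Over (Spec K) :=
  Over.mk (Spec.map (CommRingCat.ofHom (algebraMap K L)))

/-- The functions on the spectrum of a `K`-algebra `L` are the elements of `L`. -/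
def Fn.specAlgEquiv (L : Type u) [CommRing L] [Algebra K L] : Fn (specAlg K L) ≃ₐ[K] L :=
  AlgEquiv.ofRingEquiv (f := (Scheme.ΓSpecIso (.of L)).commRingCatIsoToRingEquiv) fun r ↦ by
    change (((Scheme.ΓSpecIso K).inv ≫ (Spec.map (CommRingCat.ofHom (algebraMap K L))).appTop) ≫
      (Scheme.ΓSpecIso (.of L)).hom).hom r = algebraMap K L r
    rw [← Scheme.ΓSpecIso_inv_naturality]
    simp

/-- The value of functions at an `L`-valued point. -/
def Fn.eval {X : Over (Spec K)} {L : Type u} [CommRing L] [Algebra K L] (x : specAlg K L ⟶ X) :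
    Fn X →ₐ[K] L :=
  (Fn.specAlgEquiv L).toAlgHom.comp (Fn.pull x)

/-- The value of functions at the neutral section of a group scheme over `Spec K`. -/
def Fn.counit (G : Grp (Over (Spec K))) : Fn G.X →ₐ[K] K :=
  Fn.eval (1 : specAlg K K ⟶ G.X)

lemma Fn.eval_comp {X Y : Over (Spec K)} {L : Type u} [CommRing L] [Algebra K L]
    (x : specAlg K L ⟶ X) (f : X ⟶ Y) : (Fn.eval x).comp (Fn.pull f) = Fn.eval (x ≫ f) := by
  ext r
  simp [Fn.eval, Fn.pull]
  rfl

lemma Fn.counit_comp {G G' : Grp (Over (Spec K))} (a : G ⟶ G') :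
    (Fn.counit G).comp (Fn.pull a.hom.hom) = Fn.counit G' := by
  rw [Fn.counit, Fn.eval_comp, one_comp, Fn.counit]

end Functions

section PointDifferentials

variable {K A B : Type u} [CommRing K] [CommRing A] [CommRing B] [Algebra K A] [Algebra K B]

/-- For a `K`-algebra `A` with a `K`-valued point `ε`, the pull-back `ε^* Ω_{A/K} = K ⊗_A Ω_{A/K}` of
the module of differentials along `ε`. -/
def DiffAt (ε : A →ₐ[K] K) : Type u :=
  letI := ε.toRingHom.toAlgebra
  K ⊗[A] Ω[A⁄K]

instance (ε : A →ₐ[K] K) : AddCommGroup (DiffAt ε) := by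
  unfold DiffAt; infer_instance

instance (ε : A →ₐ[K] K) : Module K (DiffAt ε) := by
  unfold DiffAt; infer_instance

/-- The `K`-linear map `f ↦ 1 ⊗ df` from `A` to `ε^* Ω_{A/K}`. -/
def DiffAt.d (ε : A →ₐ[K] K) : A →ₗ[K] DiffAt ε :=
  letI := ε.toRingHom.toAlgebra
  haveI : IsScalarTower K A K := .of_algebraMap_eq fun r ↦ (ε.commutes r).symm
  show A →ₗ[K] K ⊗[A] Ω[A⁄K] from
  ((TensorProduct.mk A K Ω[A⁄K] 1).restrictScalars K).comp (KaehlerDifferential.D K A).toLinearMap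

/-- The `K`-linear map `ε^* Ω_{A/K} → ε'^* Ω_{B/K}`, `1 ⊗ df ↦ 1 ⊗ d(φ f)`, induced by a morphism
`φ : A → B` of `K`-algebras with points. -/
def DiffAt.map (φ : A →ₐ[K] B) {ε : A →ₐ[K] K} {ε' : B →ₐ[K] K} (h : ε'.comp φ = ε) :
    DiffAt ε →ₗ[K] DiffAt ε' :=
  letI := ε.toRingHom.toAlgebra
  letI := ε'.toRingHom.toAlgebra
  letI := φ.toRingHom.toAlgebra
  haveI : IsScalarTower K A B := .of_algebraMap_eq fun r ↦ (φ.commutes r).symm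
  haveI : IsScalarTower A B K := .of_algebraMap_eq fun f ↦ (DFunLike.congr_fun h f).symm
  show K ⊗[A] Ω[A⁄K] →ₗ[K] K ⊗[B] Ω[B⁄K] from
  LinearMap.liftBaseChange K
    (((TensorProduct.mk B K Ω[B⁄K] 1).restrictScalars A).comp (KaehlerDifferential.map K K A B))

lemma DiffAt.map_d (φ : A →ₐ[K] B) {ε : A →ₐ[K] K} {ε' : B →ₐ[K] K} (h : ε'.comp φ = ε) (f : A) :
    DiffAt.map φ h (DiffAt.d ε f) = DiffAt.d ε' (φ f) := by
  let := ε.toRingHom.toAlgebra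
  let := ε'.toRingHom.toAlgebra
  let := φ.toRingHom.toAlgebra
  have : IsScalarTower K A B := .of_algebraMap_eq fun r ↦ (φ.commutes r).symm
  have : IsScalarTower A B K := .of_algebraMap_eq fun f ↦ (DFunLike.congr_fun h f).symm
  change LinearMap.liftBaseChange K
    (((TensorProduct.mk B K Ω[B⁄K] 1).restrictScalars A).comp (KaehlerDifferential.map K K A B))
      ((1 : K) ⊗ₜ[A] KaehlerDifferential.D K A f) = (1 : K) ⊗ₜ[B] KaehlerDifferential.D K B (φ f)
  rw [LinearMap.liftBaseChange_tmul, one_smul, LinearMap.comp_apply, KaehlerDifferential.map_D]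
  rfl

end PointDifferentials

/-! ### The Frobenius twist and the map `Φ` -/

section Phi

/-- The ring `K` regarded as a `K`-algebra through the Frobenius endomorphism; its spectrum over
`Spec K` is the absolute Frobenius `F_K : Spec K ⟶ Spec K`. -/
def FrobTwist (K : Type u) (_p : ℕ) : Type u := K

variable (K : Type u) [CommRing K] (p : ℕ) [Fact p.Prime] [CharP K p]

instance : CommRing (FrobTwist K p) := inferInstanceAs (CommRing K)

instance : Algebra K (FrobTwist K p) := (frobenius K p).toAlgebra

end Phi

section Phi

variable {K : CommRingCat.{u}} (p : ℕ) [Fact p.Prime] [CharP K p]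

/-- The co-Lie algebra `ω_G = ε^* Ω_{G/K}` of an affine group scheme over `Spec K`. -/
abbrev CoLie (G : Grp (Over (Spec K))) : Type u := DiffAt (Fn.counit G)

/-- The pull-back of differential forms `a^* : ω_{G'} → ω_G` along a homomorphism `a : G ⟶ G'`. -/
def CoLie.pull {G G' : Grp (Over (Spec K))} (a : G ⟶ G') : CoLie G' →ₗ[K] CoLie G :=
  DiffAt.map (Fn.pull a.hom.hom) (Fn.counit_comp a)

/-- The group `Hom_K (F_K^* ω_G, Ω_{F_K})`. The source is the base change of `ω_G` along the
Frobenius endomorphism and the target is the module of differentials of `F_K`. -/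
abbrev FrobHom (G : Grp (Over (Spec K))) : Type u :=
  (FrobTwist K p ⊗[K] CoLie G) →ₗ[FrobTwist K p] Ω[FrobTwist K p⁄K]

/-- The map `Hom_K (F_K^* ω_G, Ω_{F_K}) → Hom_K (F_K^* ω_{G'}, Ω_{F_K})` given by composition with
`F_K^*(a^*)`, for a homomorphism `a : G ⟶ G'`. -/
def FrobHom.push {G G' : Grp (Over (Spec K))} (a : G ⟶ G') :
    FrobHom p G →+ FrobHom p G' where
  toFun φ := φ.comp ((CoLie.pull a).baseChange (FrobTwist K p))
  map_zero' := LinearMap.zero_comp _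
  map_add' _ _ := LinearMap.add_comp _ _ _

/-- The `K`-scheme `F_K : Spec K ⟶ Spec K`. -/
abbrev frobPt : Over (Spec K) := specAlg K (FrobTwist K p)

/-- For an affine `K`-scheme `X`, the canonical isomorphism from `K^{[1]} ⊗_K Γ(X)` to the ring of
functions of the base change `F_K^* X = X ×_K (Spec K, F_K)`, `c ⊗ h ↦ c h`. -/
def Fn.twist (X : Over (Spec K)) : FrobTwist K p ⊗[K] Fn X →ₐ[K] Fn (X ⊗ frobPt p) :=
  Algebra.TensorProduct.lift
    ((Fn.pull (snd X (frobPt p))).comp (Fn.specAlgEquiv (FrobTwist K p)).symm.toAlgHom)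
    (Fn.pull (fst X (frobPt p))) fun _ _ ↦ Commute.all _ _

/-- The orbit map `F_K^* G ⟶ P`, `(g, t) ↦ g · σ(t)`, of a point `σ` of the `G`-torsor `P` above
`F_K`. It is the composition of the trivialisation `F_K^* G ≅ F_K^* P` given by `σ` with the
projection to `P`. -/
def Torsor.orbit {G : Grp (Over (Spec K))} (P : Torsor G) (σ : frobPt (K := K) p ⟶ P.X) :
    G.X ⊗ frobPt p ⟶ P.X :=
  P.smul (fst _ _) (snd _ _ ≫ σ)

/-- The linear map `φ : F_K^* ω_G → Ω_{F_K}` is `Φ_G(P)`: for a `K`-morphism `σ` from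
`F_K : Spec K ⟶ Spec K` to `P`, it is the map `σ^* Ω_{P/K} → Ω_{F_K}`, `df ↦ d(σ^* f)`, induced by
`σ`, where `σ^* Ω_{P/K}` is identified with `F_K^* ω_G` by means of the trivialisation of `F_K^* P`
given by `σ`: that identification sends `df` to the image in `F_K^* ω_G` of the differential along
`F_K^* G` of the function `(g, t) ↦ f (g · σ(t))` on `F_K^* G`. -/
def Torsor.IsPhi {G : Grp (Over (Spec K))} (P : Torsor G) (φ : FrobHom p G) : Prop :=
  ∃ σ : frobPt p ⟶ P.X, ∀ (f : Fn P.X) (z : FrobTwist K p ⊗[K] Fn G.X),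
    Fn.twist p G.X z = Fn.pull (P.orbit p σ) f →
      φ ((DiffAt.d (Fn.counit G)).baseChange (FrobTwist K p) z) =
        KaehlerDifferential.D K (FrobTwist K p) (Fn.eval σ f)

/-- The map `H¹(K, G) → Hom_K (F_K^* ω_G, Ω_{F_K})` is the map `Φ_G`. -/
def H1.IsPhi {G : Grp (Over (Spec K))} (Φ : H1 G → FrobHom p G) : Prop :=
  ∀ (P : Torsor G) (φ : FrobHom p G), Φ (H1.mk P) = φ ↔ P.IsPhi p φ

end Phi

end HeightOneSelmer
end

open HeightOneSelmer

/-!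
Let `K` be the function field of `V`, and let `F : Spec K ⟶ Spec K` be its absolute Frobenius
`F_K`, regarded as a faithfully flat cover of `Spec K`. Its functions form the `K`-algebra
`K^{[1]}`, a purely inseparable extension of exponent one.

*Torsors are cocycles.* Let `G` be a group scheme of height one over `K` and `P` a `G`-torsor. Take
a point of `P` with values in an extension `R` of `K`. The two points of `P` with values in `R ⊗ R`
that it gives differ by a point of `G`, which Frobenius kills; so the point composed with Frobenius
descends to a section of `P` over `F` (`nonempty_section_of_point`). The section is unique, because
`G` has no non-trivial points over `F`. Conversely, flat descent along `F` produces a torsor from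
each Čech cocycle `F × F ⟶ G` (`exists_torsor_of_cocycle`). Hence `H¹(K, G)` is the group of all
cocycles: the trivial torsor has no other section, so that there are no coboundaries to divide by
(`HasUniqueSections`). This makes `H¹` a left exact functor on such groups. The Selmer condition
says that the cocycle becomes a coboundary with values in the abelian variety over each completion
(`Torsor.isInImageDelta_iff`); it is stable under products, and it is the same for a cocycle of
`ker ι` and for its image in `ker (β ∘ ι)`, so that the first row is exact.

*The map `Φ`.* A cocycle is trivial on the diagonal of `F × F`. Its restriction to the first
infinitesimal neighbourhood of the diagonal, whose ring of functions is `K^{[1]} ⊕ Ω_{F_K}`, is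
therefore a tangent vector of `G` at the neutral section, that is, a linear map `ω_G → Ω_{F_K}`.
The linear extension of this map to `F_K^* ω_G` is `Φ` (`isPhi_phi`). It is additive because the
product of tangent vectors is their sum (`IsTangent.mul`). If it vanishes, then the functions on `P`
take values with zero differential at the section `σ`. Such values lie in `K`, because `K^{[1]}` has
exponent one over `K` (`mem_range_of_kaehlerDifferential_eq_zero`); so `σ` comes from a `K`-point of
`P`, and `P` is trivial (`cocycle_eq_one_of_phi_eq_zero`).

*The second row.* A linear map `ω_G → Ω_{F_K}` is a point of `G` with values in
`K^{[1]} ⊕ Ω_{F_K}` that reduces to the neutral section, and kernels are left exact on points; this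
gives exactness except at the right end. There it has to be shown that the pull-back of forms
`ω_{ker β} → ω_{ker (β ∘ ι)}` is injective, that is, that tangent vectors of `ker β` with values in
some extension of `K` lift to `ker (β ∘ ι)`. Let `k ⊆ E ⊆ L` be the function fields of `B₁`, `B`
and `A`. Translating the generic point of `B` by a tangent vector of `ker β` with values in `L`
amounts to a derivation of `E` over `k` into `L`. As `β ∘ ι` has height one, `L ^ p ⊆ k`
(`exists_algebraMap_eq_pow_of_isHeightOne`), so the derivation extends to `L`
(`exists_section_trivSqZeroExt`). The extension moves the generic point of `A` infinitesimally, and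
the quotient of the two points is the tangent vector of `ker (β ∘ ι)` that is wanted
(`exists_lift_tangent`).
-/

noncomputable section

namespace HeightOneSelmer

open MonoidalCategory CartesianMonoidalCategory MonObj
open scoped TensorProduct

/-! ### Descent of morphisms along a cover of the base -/

section Descent

variable {S : Scheme.{u}} (F : Over S) [Flat F.hom] [Surjective F.hom] [QuasiCompact F.hom]

lemma flat_surjective_quasiCompact_snd (T : Over S) :
    Flat (snd F T).left ∧ Surjective (snd F T).left ∧ QuasiCompact (snd F T).left := by
  rw [Over.snd_left]
  exact ⟨inferInstance, inferInstance, inferInstance⟩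

lemma epi_snd (T : Over S) : Epi (snd F T) := by
  obtain ⟨_, _, _⟩ := flat_surjective_quasiCompact_snd F T
  have : Epi (snd F T).left := inferInstance
  exact Over.epi_of_epi_left _

/-- A morphism on `F × T` that does not depend on the coordinate in the cover `F` of the base comes
from a morphism on `T`. -/
lemma exists_comp_eq_of_forall_lift {T Y : Over S} (f : F ⊗ T ⟶ Y)
    (h : ∀ {Z : Over S} (u v : Z ⟶ F) (t : Z ⟶ T), lift u t ≫ f = lift v t ≫ f) :
    ∃ g : T ⟶ Y, ∀ {Z : Over S} (u : Z ⟶ F) (t : Z ⟶ T), t ≫ g = lift u t ≫ f := by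
  obtain ⟨_, _, _⟩ := flat_surjective_quasiCompact_snd F T
  have := epi_snd F T
  have he : EffectiveEpi (snd F T).left := inferInstance
  let g := EffectiveEpi.desc (snd F T).left f.left (fun {Z} a b hab ↦ by
    let Z' : Over S := Over.mk (a ≫ (F ⊗ T).hom)
    let a' : Z' ⟶ F ⊗ T := Over.homMk a rfl
    let b' : Z' ⟶ F ⊗ T := Over.homMk b (by
      simp only [Z', Over.mk_hom]
      rw [← Over.w (snd F T), reassoc_of% hab])
    have hab' : a' ≫ snd F T = b' ≫ snd F T := by ext1; exact hab
    have h1 := h (a' ≫ fst F T) (b' ≫ fst F T) (a' ≫ snd F T)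
    have ha : lift (a' ≫ fst F T) (a' ≫ snd F T) = a' := by ext1 <;> simp
    have hb : lift (b' ≫ fst F T) (a' ≫ snd F T) = b' := by
      rw [hab']; ext1 <;> simp
    rw [ha, hb] at h1
    exact congr($(h1).left))
  have hg : (snd F T).left ≫ g = f.left := EffectiveEpi.fac _ _ _
  have hw : g ≫ Y.hom = T.hom := by
    have : Epi (snd F T).left := inferInstance
    rw [← cancel_epi (snd F T).left, reassoc_of% hg, Over.w, Over.w]
  have hg' : snd F T ≫ (Over.homMk g hw : T ⟶ Y) = f := by ext1; exact hg
  exact ⟨Over.homMk g hw, fun u t ↦ by rw [← hg', ← Category.assoc, lift_snd]⟩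

lemma hom_ext_of_cover {T Y : Over S} {f g : T ⟶ Y} (h : snd F T ≫ f = snd F T ≫ g) : f = g := by
  have := epi_snd F T
  rwa [cancel_epi] at h

end Descent

/-! ### Torsors with a section over a cover, and their cocycles -/

namespace Torsor

section

variable {S : Scheme.{u}} {G : Grp (Over S)} (P : Torsor G)

lemma one_smul' {T : Over S} (x : T ⟶ P.X) : P.smul 1 x = x := P.one_act x

lemma mul_smul' {T : Over S} (g h : T ⟶ G.X) (x : T ⟶ P.X) :
    P.smul (g * h) x = P.smul g (P.smul h x) := P.mul_act g h x

/-- The quotient of two points of a torsor, a point of the group. -/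
def diff {T : Over S} (x y : T ⟶ P.X) : T ⟶ G.X :=
  haveI := P.isIso_shear
  lift x y ≫ inv (lift P.act (snd G.X P.X)) ≫ fst _ _

lemma diff_smul {T : Over S} (x y : T ⟶ P.X) : P.smul (P.diff x y) y = x := by
  have := P.isIso_shear
  let w := lift x y ≫ inv (lift P.act (snd G.X P.X))
  have hw : w ≫ lift P.act (snd G.X P.X) = lift x y := by
    simp only [w, Category.assoc, IsIso.inv_hom_id, Category.comp_id]
  have h1 : w ≫ P.act = x := by simpa using congr($hw ≫ fst _ _)
  have h2 : w ≫ snd _ _ = y := by simpa using congr($hw ≫ snd _ _)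
  have h3 : w = lift (P.diff x y) y := by
    ext1
    · simp [diff, w]
    · simpa using h2
  rw [smul, ← h3, h1]

lemma smul_right_cancel {T : Over S} {g h : T ⟶ G.X} {x : T ⟶ P.X}
    (e : P.smul g x = P.smul h x) : g = h := by
  have := P.isIso_shear
  have h1 : lift g x ≫ lift P.act (snd G.X P.X) = lift h x ≫ lift P.act (snd G.X P.X) := by
    ext1
    · simpa [smul] using e
    · simp
  rw [cancel_mono] at h1
  simpa using congr($h1 ≫ fst _ _)

lemma diff_eq {T : Over S} {g : T ⟶ G.X} {x y : T ⟶ P.X} (e : P.smul g y = x) :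
    P.diff x y = g :=
  P.smul_right_cancel ((P.diff_smul x y).trans e.symm)

lemma diff_smul_left {T : Over S} (g : T ⟶ G.X) (x y : T ⟶ P.X) :
    P.diff (P.smul g x) y = g * P.diff x y :=
  P.diff_eq (by rw [mul_smul', diff_smul])

lemma diff_mul_diff {T : Over S} (x y z : T ⟶ P.X) : P.diff x y * P.diff y z = P.diff x z :=
  (P.diff_eq (by rw [mul_smul', diff_smul, diff_smul])).symm

lemma comp_diff {T T' : Over S} (t : T' ⟶ T) (x y : T ⟶ P.X) :
    t ≫ P.diff x y = P.diff (t ≫ x) (t ≫ y) :=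
  (P.diff_eq (by rw [← lift_comp_smul, diff_smul])).symm

end

section

variable {S : Scheme.{u}} {F : Over S} {G G' : Grp (Over S)}

/-- The Čech cocycle of a torsor, for a section over `F`. -/
def cocycle (P : Torsor G) (σ : F ⟶ P.X) : F ⊗ F ⟶ G.X :=
  P.diff (fst F F ≫ σ) (snd F F ≫ σ)

lemma lift_cocycle (P : Torsor G) (σ : F ⟶ P.X) {T : Over S} (u v : T ⟶ F) :
    lift u v ≫ P.cocycle σ = P.diff (u ≫ σ) (v ≫ σ) := by
  simp [cocycle, comp_diff, ← Category.assoc]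

lemma cocycle_smul (P : Torsor G) (σ : F ⟶ P.X) {T : Over S} (u v : T ⟶ F) :
    P.smul (lift u v ≫ P.cocycle σ) (v ≫ σ) = u ≫ σ := by
  rw [lift_cocycle, diff_smul]

variable [Flat F.hom] [Surjective F.hom] [QuasiCompact F.hom]

/-- A `G'`-torsor is deduced from a `G`-torsor by a homomorphism if their cocycles correspond. -/
lemma isPushforward_of_cocycle (a : G ⟶ G') (P : Torsor G) (Q : Torsor G') (σ : F ⟶ P.X)
    (τ : F ⟶ Q.X) (h : P.cocycle σ ≫ a.hom.hom = Q.cocycle τ) : IsPushforward a P Q := by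
  -- a point `g σ(u)` of `P` goes to `a(g) τ(u)`
  obtain ⟨q, hq⟩ := exists_comp_eq_of_forall_lift F (T := P.X) (Y := Q.X)
    (Q.smul (P.diff (snd _ _) (fst _ _ ≫ σ) ≫ a.hom.hom) (fst _ _ ≫ τ)) (fun {Z} u v t ↦ by
      have e : P.diff t (v ≫ σ) = P.diff t (u ≫ σ) * P.diff (u ≫ σ) (v ≫ σ) :=
        (P.diff_mul_diff _ _ _).symm
      have e' : P.diff (u ≫ σ) (v ≫ σ) ≫ a.hom.hom = lift u v ≫ Q.cocycle τ := by
        rw [← h, ← lift_cocycle, Category.assoc]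
      simp only [lift_comp_smul, ← Category.assoc, comp_diff, lift_fst, lift_snd]
      rw [e, mul_comp, mul_smul', e', cocycle_smul])
  refine ⟨q, fun {T} g x ↦ hom_ext_of_cover F ?_⟩
  rw [lift_comp_smul, ← Category.assoc, lift_comp_smul, hq (fst _ _), ← Category.assoc (snd F T) x,
    hq (fst _ _)]
  simp only [lift_comp_smul, ← Category.assoc, comp_diff, lift_fst, lift_snd, diff_smul_left]
  rw [mul_comp, mul_smul']

/-- A torsor is the sum of two others if its cocycle is the product of their cocycles. -/
lemma isSum_of_cocycle [IsCommMonObj G.X] (P P' Q : Torsor G) (σ : F ⟶ P.X) (σ' : F ⟶ P'.X)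
    (τ : F ⟶ Q.X) (h : P.cocycle σ * P'.cocycle σ' = Q.cocycle τ) : IsSum P P' Q := by
  obtain ⟨q, hq⟩ := exists_comp_eq_of_forall_lift F (T := P.X ⊗ P'.X) (Y := Q.X)
    (Q.smul (P.diff (snd _ _ ≫ fst _ _) (fst _ _ ≫ σ) * P'.diff (snd _ _ ≫ snd _ _) (fst _ _ ≫ σ'))
      (fst _ _ ≫ τ)) (fun {Z} u v t ↦ by
      have e : P.diff (t ≫ fst _ _) (v ≫ σ) =
          P.diff (t ≫ fst _ _) (u ≫ σ) * lift u v ≫ P.cocycle σ := by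
        rw [lift_cocycle, diff_mul_diff]
      have e' : P'.diff (t ≫ snd _ _) (v ≫ σ') =
          P'.diff (t ≫ snd _ _) (u ≫ σ') * lift u v ≫ P'.cocycle σ' := by
        rw [lift_cocycle, diff_mul_diff]
      simp only [lift_comp_smul, ← Category.assoc, comp_mul, comp_diff, lift_fst, lift_snd]
      rw [e, e', _root_.mul_mul_mul_comm, ← comp_mul, h, mul_smul' Q (_ * _) (lift u v ≫ _),
        cocycle_smul])
  refine ⟨q, fun {T} g g' x x' ↦ hom_ext_of_cover F ?_⟩
  rw [lift_comp_smul, comp_mul, ← Category.assoc, comp_lift, lift_comp_smul, lift_comp_smul,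
    ← Category.assoc, comp_lift, hq (fst _ _), hq (fst _ _)]
  simp only [lift_comp_smul, ← Category.assoc, comp_mul, comp_diff, lift_fst, lift_snd,
    diff_smul_left]
  rw [← mul_smul', _root_.mul_mul_mul_comm]

end

section

variable {S : Scheme.{u}} {F : Over S} {G G' : Grp (Over S)}

lemma cocycle_of_isPushforward {a : G ⟶ G'} {P : Torsor G} {Q : Torsor G'}
    (h : IsPushforward a P Q) (σ : F ⟶ P.X) (τ : F ⟶ Q.X) (hτ : ∀ τ' : F ⟶ Q.X, τ' = τ) :
    P.cocycle σ ≫ a.hom.hom = Q.cocycle τ := by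
  obtain ⟨q, hq⟩ := h
  refine (Q.diff_eq ?_).symm
  rw [← hτ (σ ≫ q), ← Category.assoc, ← hq, cocycle, diff_smul, Category.assoc]

lemma cocycle_of_isSum {P P' Q : Torsor G}
    (h : IsSum P P' Q) (σ : F ⟶ P.X) (σ' : F ⟶ P'.X) (τ : F ⟶ Q.X) (hτ : ∀ τ' : F ⟶ Q.X, τ' = τ) :
    P.cocycle σ * P'.cocycle σ' = Q.cocycle τ := by
  obtain ⟨q, hq⟩ := h
  refine (Q.diff_eq ?_).symm
  have e : snd F F ≫ lift σ σ' ≫ q = lift (snd F F ≫ σ) (snd F F ≫ σ') ≫ q := by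
    rw [← Category.assoc, comp_lift]
  rw [← hτ (lift σ σ' ≫ q), e, ← hq, cocycle, diff_smul, cocycle, diff_smul, ← Category.assoc,
    comp_lift]

/-- Torsors with the same cocycle are isomorphic. -/
lemma nonempty_iso_of_cocycle [Flat F.hom] [Surjective F.hom] [QuasiCompact F.hom]
    {P Q : Torsor G} (σ : F ⟶ P.X) (τ : F ⟶ Q.X) (hσ : ∀ σ' : F ⟶ P.X, σ' = σ)
    (hτ : ∀ τ' : F ⟶ Q.X, τ' = τ) (h : P.cocycle σ = Q.cocycle τ) : Nonempty (Iso P Q) := by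
  obtain ⟨q, hq⟩ := isPushforward_of_cocycle (𝟙 G) P Q σ τ (by simpa using h)
  obtain ⟨r, hr⟩ := isPushforward_of_cocycle (𝟙 G) Q P τ σ (by simpa using h.symm)
  have key : ∀ {P : Torsor G} (σ : F ⟶ P.X) (hσ : ∀ σ' : F ⟶ P.X, σ' = σ) (f : P.X ⟶ P.X)
      (_ : ∀ {T : Over S} (g : T ⟶ G.X) (x : T ⟶ P.X), P.smul g x ≫ f = P.smul g (x ≫ f)),
      f = 𝟙 _ := by
    intro P σ hσ f hf
    refine hom_ext_of_cover F ?_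
    have e : snd F P.X = P.smul (P.diff (snd F P.X) (fst F P.X ≫ σ)) (fst F P.X ≫ σ) := by
      rw [diff_smul]
    rw [e, hf, Category.assoc, hσ (σ ≫ f), Category.comp_id]
  refine ⟨⟨⟨q, r, key σ hσ _ ?_, key τ hτ _ ?_⟩, fun g x ↦ by simpa using hq g x⟩⟩
  · intro T g x
    rw [← Category.assoc, hq, hr, Category.assoc]; simp
  · intro T g x
    rw [← Category.assoc, hr, hq, Category.assoc]; simp

end

end Torsor

/-! ### Points of kernels -/

section KernelPoints

variable {S : Scheme.{u}} {G H J : Grp (Over S)}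

lemma zero_hom_hom : (0 : G ⟶ H).hom.hom = 1 := rfl

lemma kernel_ι_comp (f : G ⟶ H) {T : Over S} (k : T ⟶ (kernel f).X) :
    (k ≫ (kernel.ι f).hom.hom) ≫ f.hom.hom = 1 := by
  have h : (kernel.ι f ≫ f).hom.hom = (0 : kernel f ⟶ H).hom.hom := by rw [kernel.condition]
  rw [zero_hom_hom] at h
  have h' : (kernel.ι f).hom.hom ≫ f.hom.hom = 1 := h
  rw [Category.assoc, h', comp_one]

/-- The underlying morphism of the kernel of a homomorphism of group schemes is an equalizer. -/
def isLimitForkKernel (f : G ⟶ H) :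
    IsLimit (Fork.ofι (f := f.hom.hom) (g := (0 : G ⟶ H).hom.hom) (kernel.ι f).hom.hom
      (by rw [zero_hom_hom, comp_one]; simpa using kernel_ι_comp f (𝟙 _))) :=
  isLimitForkMapOfIsLimit (Grp.forget (Over S)) (by simp) (kernelIsKernel f)

lemma exists_comp_kernel_ι (f : G ⟶ H) {T : Over S} (x : T ⟶ G.X) (hx : x ≫ f.hom.hom = 1) :
    ∃ k : T ⟶ (kernel f).X, k ≫ (kernel.ι f).hom.hom = x :=
  ⟨Fork.IsLimit.lift (isLimitForkKernel f) x (by rw [hx, zero_hom_hom, comp_one]),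
    Fork.IsLimit.lift_ι' (isLimitForkKernel f) _ _⟩

lemma mono_kernel_ι (f : G ⟶ H) : Mono (kernel.ι f).hom.hom :=
  ⟨fun _ _ h ↦ Fork.IsLimit.hom_ext (isLimitForkKernel f) h⟩

lemma isCommMonObj_kernel (f : G ⟶ H) [IsCommMonObj G.X] : IsCommMonObj (kernel f).X := by
  rw [isCommMonObj_iff_isMulCommutative]
  refine fun T ↦ ⟨⟨fun a b ↦ ?_⟩⟩
  have := mono_kernel_ι f
  rw [← cancel_mono (kernel.ι f).hom.hom, mul_comp, mul_comp, _root_.mul_comm]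

lemma kerIncl_comp (f : G ⟶ H) (h : H ⟶ J) :
    (kerIncl f h).hom.hom ≫ (kernel.ι (f ≫ h)).hom.hom = (kernel.ι f).hom.hom := by
  have : kerIncl f h ≫ kernel.ι (f ≫ h) = kernel.ι f := kernel.lift_ι _ _ _
  exact congr($(this).hom.hom)

lemma kerMap_comp (f : G ⟶ H) (h : H ⟶ J) :
    (kerMap f h).hom.hom ≫ (kernel.ι h).hom.hom = (kernel.ι (f ≫ h)).hom.hom ≫ f.hom.hom := by
  have : kerMap f h ≫ kernel.ι h = kernel.ι (f ≫ h) ≫ f := kernel.lift_ι _ _ _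
  exact congr($(this).hom.hom)

lemma mono_kerIncl (f : G ⟶ H) (h : H ⟶ J) : Mono (kerIncl f h).hom.hom := by
  have := mono_kernel_ι f
  exact mono_of_mono_fac (kerIncl_comp f h)

lemma kerIncl_comp_kerMap (f : G ⟶ H) (h : H ⟶ J) {T : Over S} (k : T ⟶ (kernel f).X) :
    (k ≫ (kerIncl f h).hom.hom) ≫ (kerMap f h).hom.hom = 1 := by
  have := mono_kernel_ι h
  rw [← cancel_mono (kernel.ι h).hom.hom, Category.assoc, Category.assoc, kerMap_comp,
    reassoc_of% (kerIncl_comp f h), ← Category.assoc, kernel_ι_comp, one_comp]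

/-- `ker f ⟶ ker (h ∘ f) ⟶ ker h` is left exact on points. -/
lemma exists_comp_kerIncl (f : G ⟶ H) (h : H ⟶ J) {T : Over S} (k : T ⟶ (kernel (f ≫ h)).X)
    (hk : k ≫ (kerMap f h).hom.hom = 1) : ∃ l, l ≫ (kerIncl f h).hom.hom = k := by
  obtain ⟨l, hl⟩ := exists_comp_kernel_ι f (k ≫ (kernel.ι (f ≫ h)).hom.hom) (by
    rw [Category.assoc, ← kerMap_comp, ← Category.assoc, hk, one_comp])
  have := mono_kernel_ι (f ≫ h)
  exact ⟨l, by rw [← cancel_mono (kernel.ι (f ≫ h)).hom.hom, Category.assoc, kerIncl_comp, hl]⟩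

/-- The condition defining the image of the connecting map, in terms of cocycles: the cocycle
becomes a coboundary in `G`. -/
lemma Torsor.isInImageDelta_iff {F : Over S} [Flat F.hom] [Surjective F.hom] [QuasiCompact F.hom]
    {f : G ⟶ H} (P : Torsor (kernel f)) (σ : F ⟶ P.X) (T : Over S) :
    P.IsInImageDelta T ↔ ∃ y : F ⊗ T ⟶ G.X, ∀ {Z : Over S} (u v : Z ⟶ F) (t : Z ⟶ T),
      lift u t ≫ y = (lift u v ≫ P.cocycle σ ≫ (kernel.ι f).hom.hom) * (lift v t ≫ y) := by
  constructor
  · -- `w` maps `P × T` to `G`; the cochain is its value `w(σ(u), t)` at the section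
    rintro ⟨-, w, -, hw⟩
    refine ⟨lift (fst _ _ ≫ σ) (snd _ _) ≫ w, fun u v t ↦ ?_⟩
    simp only [← Category.assoc, comp_lift, lift_fst, lift_snd]
    rw [← hw, cocycle_smul]
  · rintro ⟨y, hy⟩
    -- `f(y(u, t))` does not depend on `u`
    obtain ⟨b, hb⟩ := exists_comp_eq_of_forall_lift F (T := T) (Y := H.X) (y ≫ f.hom.hom)
      (fun {Z} u v t ↦ by
        rw [← Category.assoc, hy u v t, mul_comp, ← Category.assoc (lift u v), kernel_ι_comp,
          _root_.one_mul, Category.assoc])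
    -- `(g σ(u), t)` goes to `g y(u, t)`
    obtain ⟨w, hw⟩ := exists_comp_eq_of_forall_lift F (T := P.X ⊗ T) (Y := G.X)
      ((P.diff (snd _ _ ≫ fst _ _) (fst _ _ ≫ σ) ≫ (kernel.ι f).hom.hom) *
        lift (fst _ _) (snd _ _ ≫ snd _ _) ≫ y) (fun {Z} u v t ↦ by
          simp only [← Category.assoc, comp_mul, comp_diff, comp_lift, lift_fst, lift_snd]
          rw [hy u v, ← _root_.mul_assoc, ← Category.assoc, lift_cocycle, ← mul_comp,
            diff_mul_diff])
    have hw' : ∀ {Z : Over S} (u : Z ⟶ F) (x : Z ⟶ P.X) (t : Z ⟶ T),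
        lift x t ≫ w = P.diff x (u ≫ σ) ≫ (kernel.ι f).hom.hom * lift u t ≫ y := by
      intro Z u x t
      rw [hw u]
      simp only [← Category.assoc, comp_mul, comp_diff, comp_lift, lift_fst, lift_snd]
    have hact : ∀ {T' : Over S} (g : T' ⟶ (kernel f).X) (x : T' ⟶ P.X) (t : T' ⟶ T),
        lift (P.smul g x) t ≫ w = (g ≫ (kernel.ι f).hom.hom) * (lift x t ≫ w) := by
      intro T' g x t
      refine hom_ext_of_cover F ?_
      simp only [← Category.assoc, comp_mul, comp_lift, lift_comp_smul]
      rw [hw' (fst _ _), hw' (fst _ _), diff_smul_left, mul_comp, _root_.mul_assoc]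
    have hwb : w ≫ f.hom.hom = snd _ _ ≫ b := by
      refine hom_ext_of_cover F ?_
      have e : snd F (P.X ⊗ T) = lift (snd _ _ ≫ fst _ _) (snd _ _ ≫ snd _ _) := by ext1 <;> simp
      rw [← Category.assoc, ← Category.assoc, hb (fst _ _)]
      nth_rw 1 [e]
      rw [hw' (fst _ _), mul_comp, kernel_ι_comp, _root_.one_mul, Category.assoc]
    have hinj : ∀ {Z : Over S} (x x' : Z ⟶ P.X) (t : Z ⟶ T), lift x t ≫ w = lift x' t ≫ w →
        x = x' := by
      intro Z x x' t h
      have := mono_kernel_ι f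
      rw [← P.diff_smul x x', hact, mul_eq_right, ← one_comp (kernel.ι f).hom.hom, cancel_mono] at h
      rw [← P.diff_smul x x', h, one_smul']
    have hex : ∀ {Z : Over S} (a : Z ⟶ G.X) (t : Z ⟶ T), a ≫ f.hom.hom = t ≫ b →
        ∃ x : Z ⟶ P.X, lift x t ≫ w = a := by
      intro Z a t hat
      obtain ⟨k, hk⟩ := exists_comp_kernel_ι f (T := F ⊗ Z)
        ((snd _ _ ≫ a) * (lift (fst _ _) (snd _ _ ≫ t) ≫ y)⁻¹) (by
          rw [mul_comp, Category.assoc, hat, GrpObj.inv_comp, ← Category.assoc, hb (fst _ _),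
            Category.assoc, mul_inv_cancel])
      have hk' : ∀ {Z' : Over S} (u : Z' ⟶ F) (s : Z' ⟶ Z), (lift u s ≫ k) ≫ (kernel.ι f).hom.hom =
          (s ≫ a) * (lift u (s ≫ t) ≫ y)⁻¹ := by
        intro Z' u s
        rw [Category.assoc, hk]
        simp only [← Category.assoc, comp_mul, GrpObj.comp_inv, comp_lift, lift_fst, lift_snd]
      obtain ⟨x, hx⟩ := exists_comp_eq_of_forall_lift F (T := Z) (Y := P.X)
        (P.smul k (fst _ _ ≫ σ)) (fun {Z'} u v s ↦ by
          simp only [lift_comp_smul, ← Category.assoc, lift_fst]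
          refine hinj _ _ (s ≫ t) ?_
          rw [hw' u, hw' v, diff_smul_left, diff_smul_left]
          have h1 : ∀ u : Z' ⟶ F, P.diff (u ≫ σ) (u ≫ σ) = 1 := fun u ↦ P.diff_eq (P.one_smul' _)
          rw [h1, h1, _root_.mul_one, _root_.mul_one, hk', hk', inv_mul_cancel_right,
            inv_mul_cancel_right])
      refine ⟨x, hom_ext_of_cover F ?_⟩
      rw [← Category.assoc, comp_lift, hw' (fst _ _), hx (fst _ _), lift_fst_snd, Category.id_comp,
        diff_smul_left, P.diff_eq (P.one_smul' _), _root_.mul_one, hk, inv_mul_cancel_right]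
    refine ⟨b, w, ⟨⟨hwb⟩, ⟨PullbackCone.isLimitAux' _ fun s ↦ ?_⟩⟩, hact⟩
    have hs := hex s.fst s.snd s.condition
    refine ⟨lift hs.choose s.snd, hs.choose_spec, lift_snd _ _, fun {m} h1 h2 ↦ ?_⟩
    have h2' : m ≫ snd _ _ = s.snd := h2
    have e : m = lift (m ≫ fst _ _) s.snd :=
      CartesianMonoidalCategory.hom_ext _ _ (lift_fst _ _).symm (h2'.trans (lift_snd _ _).symm)
    rw [e]
    congr 1
    refine hinj _ _ s.snd ?_
    rw [← e, hs.choose_spec]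
    exact h1

end KernelPoints

/-! ### First cohomology as a group of cocycles -/

section Cohomology

variable {S : Scheme.{u}} (F : Over S)

/-- The group of Čech 1-cocycles of a commutative group scheme, for the cover `F` of the base. The
cocycle condition is written on points. -/
def cocycleGroup (G : Grp (Over S)) [IsCommMonObj G.X] : Subgroup (F ⊗ F ⟶ G.X) where
  carrier := {c | ∀ {Z : Over S} (u v w : Z ⟶ F),
    lift u v ≫ c * lift v w ≫ c = lift u w ≫ c}
  mul_mem' {a b} ha hb Z u v w := by
    simp only [comp_mul]
    rw [_root_.mul_mul_mul_comm, ha, hb]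
  one_mem' := by intro Z u v w; simp
  inv_mem' {a} ha Z u v w := by
    simp only [GrpObj.comp_inv]
    rw [← mul_inv, ha]

/-- Over the cover `F`, each `G`-torsor has exactly one section, and each Čech cocycle of `G`
comes from a torsor. -/
structure HasUniqueSections (G : Grp (Over S)) : Prop where
  exists_section : ∀ P : Torsor G, ∃ σ : F ⟶ P.X, ∀ τ : F ⟶ P.X, τ = σ
  effective : ∀ c : F ⊗ F ⟶ G.X,
    (∀ {Z : Over S} (u v w : Z ⟶ F), lift u v ≫ c * lift v w ≫ c = lift u w ≫ c) →
      ∃ (P : Torsor G) (σ : F ⟶ P.X), P.cocycle σ = c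

namespace HasUniqueSections

variable {F} {G G' : Grp (Over S)} (hG : HasUniqueSections F G) (hG' : HasUniqueSections F G')

/-- The section of a torsor over the cover. -/
def sec (P : Torsor G) : F ⟶ P.X := (hG.exists_section P).choose

lemma eq_sec {P : Torsor G} (τ : F ⟶ P.X) : τ = hG.sec P := (hG.exists_section P).choose_spec τ

/-- The cocycle of a class of torsors. -/
def cocycle (c : H1 G) : F ⊗ F ⟶ G.X :=
  Quotient.lift (s := Torsor.setoid G) (fun P ↦ P.cocycle (hG.sec P)) (by
    rintro P Q ⟨e⟩
    have := Torsor.cocycle_of_isPushforward (a := 𝟙 G) (P := P) (Q := Q)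
      ⟨e.iso.hom, fun g x ↦ by simpa using e.comm g x⟩ (hG.sec P) (hG.sec Q) hG.eq_sec
    simpa using this) c

lemma cocycle_mk (P : Torsor G) : hG.cocycle (H1.mk P) = P.cocycle (hG.sec P) := rfl

lemma cocycle_mul (c : H1 G) {Z : Over S} (u v w : Z ⟶ F) :
    lift u v ≫ hG.cocycle c * lift v w ≫ hG.cocycle c = lift u w ≫ hG.cocycle c := by
  obtain ⟨P, rfl⟩ := Quotient.exists_rep c
  change lift u v ≫ P.cocycle _ * lift v w ≫ P.cocycle _ = lift u w ≫ P.cocycle _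
  rw [Torsor.lift_cocycle, Torsor.lift_cocycle, Torsor.lift_cocycle, Torsor.diff_mul_diff]

lemma exists_cocycle_eq (c : F ⊗ F ⟶ G.X)
    (hc : ∀ {Z : Over S} (u v w : Z ⟶ F), lift u v ≫ c * lift v w ≫ c = lift u w ≫ c) :
    ∃ d : H1 G, hG.cocycle d = c := by
  obtain ⟨P, σ, hσ⟩ := hG.effective c hc
  exact ⟨H1.mk P, by rw [cocycle_mk, ← hG.eq_sec σ, hσ]⟩

lemma exists_cocycle_eq_comp (a : G ⟶ G') (c : H1 G) :
    ∃ d : H1 G', hG'.cocycle d = hG.cocycle c ≫ a.hom.hom :=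
  hG'.exists_cocycle_eq _ (fun u v w ↦ by
    simp only [← Category.assoc]
    rw [← mul_comp, hG.cocycle_mul])

variable [Flat F.hom] [Surjective F.hom] [QuasiCompact F.hom]

lemma mk_eq_mk_iff (P Q : Torsor G) :
    H1.mk P = H1.mk Q ↔ hG.cocycle (H1.mk P) = hG.cocycle (H1.mk Q) :=
  ⟨fun h ↦ by rw [h], fun h ↦ Quotient.sound (Torsor.nonempty_iso_of_cocycle _ _
    hG.eq_sec hG.eq_sec h)⟩

lemma cocycle_injective : Function.Injective hG.cocycle := by
  intro c d h
  obtain ⟨P, rfl⟩ := Quotient.exists_rep c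
  obtain ⟨Q, rfl⟩ := Quotient.exists_rep d
  exact (hG.mk_eq_mk_iff P Q).2 h

/-- A class of torsors is the same thing as a cocycle. -/
def equiv [IsCommMonObj G.X] : H1 G ≃ Additive (cocycleGroup F G) :=
  Equiv.ofBijective (fun c ↦ Additive.ofMul ⟨hG.cocycle c, hG.cocycle_mul c⟩) (by
    refine ⟨fun c d h ↦ hG.cocycle_injective congr(($h).toMul.1), fun c ↦ ?_⟩
    obtain ⟨d, hd⟩ := hG.exists_cocycle_eq c.toMul.1 c.toMul.2
    exact ⟨d, Additive.toMul.injective (Subtype.ext hd)⟩)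

/-- The group structure on the set of classes of torsors given by the product of cocycles. -/
@[reducible] def addCommGroup [IsCommMonObj G.X] : AddCommGroup (H1 G) := hG.equiv.addCommGroup

section

variable [IsCommMonObj G.X] [IsCommMonObj G'.X]

lemma cocycle_add (c d : H1 G) :
    hG.cocycle (hG.addCommGroup.add c d) = hG.cocycle c * hG.cocycle d := by
  have h : hG.equiv (hG.addCommGroup.add c d) = hG.equiv c + hG.equiv d :=
    hG.equiv.apply_symm_apply _
  exact congr(($h).toMul.1)

lemma cocycle_zero : hG.cocycle hG.addCommGroup.zero = 1 := by
  have h : hG.equiv hG.addCommGroup.zero = 0 := hG.equiv.apply_symm_apply _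
  exact congr(($h).toMul.1)

lemma cocycle_neg (c : H1 G) : hG.cocycle (hG.addCommGroup.neg c) = (hG.cocycle c)⁻¹ := by
  have h : hG.equiv (hG.addCommGroup.neg c) = - hG.equiv c := hG.equiv.apply_symm_apply _
  exact congr(($h).toMul.1)

lemma isStandardGroup : letI := hG.addCommGroup; H1.IsStandardGroup G := by
  let := hG.addCommGroup
  intro P P' Q
  constructor
  · intro h
    refine Torsor.isSum_of_cocycle P P' Q (hG.sec P) (hG.sec P') (hG.sec Q) ?_
    rw [← cocycle_mk, ← cocycle_mk, ← cocycle_mk, ← h]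
    exact (hG.cocycle_add _ _).symm
  · intro h
    refine hG.cocycle_injective ((hG.cocycle_add _ _).trans ?_)
    exact Torsor.cocycle_of_isSum h _ _ _ hG.eq_sec

/-- The homomorphism between the groups of classes of torsors induced by a homomorphism of group
schemes. -/
def map (a : G ⟶ G') :
    letI := hG.addCommGroup
    letI := hG'.addCommGroup
    H1 G →+ H1 G' :=
  letI := hG.addCommGroup
  letI := hG'.addCommGroup
  have h := hG.exists_cocycle_eq_comp hG' a
  AddMonoidHom.mk' (fun c ↦ (h c).choose) (fun c d ↦ by
    refine hG'.cocycle_injective ((h _).choose_spec.trans ?_)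
    refine Eq.trans ?_ (hG'.cocycle_add _ _).symm
    rw [(h c).choose_spec, (h d).choose_spec, ← mul_comp]
    exact congr($(hG.cocycle_add c d) ≫ _))

lemma cocycle_map (a : G ⟶ G') (c : H1 G) :
    hG'.cocycle (letI := hG.addCommGroup; letI := hG'.addCommGroup; hG.map hG' a c) =
      hG.cocycle c ≫ a.hom.hom :=
  (hG.exists_cocycle_eq_comp hG' a c).choose_spec

lemma isInducedBy_map (a : G ⟶ G') :
    H1.IsInducedBy a (letI := hG.addCommGroup; letI := hG'.addCommGroup; hG.map hG' a) := by
  intro P Q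
  constructor
  · intro h
    refine Torsor.isPushforward_of_cocycle a P Q (hG.sec P) (hG'.sec Q) ?_
    rw [← cocycle_mk, ← cocycle_mk, ← h, cocycle_map]
  · intro h
    refine hG'.cocycle_injective ((hG.cocycle_map hG' a _).trans ?_)
    exact Torsor.cocycle_of_isPushforward h _ _ hG'.eq_sec

lemma map_injective (a : G ⟶ G') [Mono a.hom.hom] : Function.Injective
    (letI := hG.addCommGroup; letI := hG'.addCommGroup; hG.map hG' a) := by
  intro c d h
  refine hG.cocycle_injective ?_
  rw [← cancel_mono a.hom.hom, ← hG.cocycle_map hG', ← hG.cocycle_map hG', h]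

end

end HasUniqueSections

variable {F} {G H J : Grp (Over S)}

/-- Over `T`, the cocycle `c` of the kernel of `f : G ⟶ H` becomes a coboundary in `G`. -/
def IsCoboundaryAt (f : G ⟶ H) (T : Over S) (c : F ⊗ F ⟶ (kernel f).X) : Prop :=
  ∃ y : F ⊗ T ⟶ G.X, ∀ {Z : Over S} (u v : Z ⟶ F) (t : Z ⟶ T),
    lift u t ≫ y = (lift u v ≫ c ≫ (kernel.ι f).hom.hom) * (lift v t ≫ y)

namespace IsCoboundaryAt

variable {f : G ⟶ H} {T : Over S} {c d : F ⊗ F ⟶ (kernel f).X}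

lemma one : IsCoboundaryAt f T (1 : F ⊗ F ⟶ (kernel f).X) := ⟨1, by simp⟩

lemma mul [IsCommMonObj G.X] (hc : IsCoboundaryAt f T c) (hd : IsCoboundaryAt f T d) :
    IsCoboundaryAt f T (c * d) := by
  obtain ⟨y, hy⟩ := hc
  obtain ⟨z, hz⟩ := hd
  refine ⟨y * z, fun u v t ↦ ?_⟩
  rw [comp_mul, comp_mul, mul_comp, comp_mul, _root_.mul_mul_mul_comm, ← hy, ← hz]

lemma inv [IsCommMonObj G.X] (hc : IsCoboundaryAt f T c) : IsCoboundaryAt f T c⁻¹ := by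
  obtain ⟨y, hy⟩ := hc
  refine ⟨y⁻¹, fun u v t ↦ ?_⟩
  rw [GrpObj.comp_inv, GrpObj.comp_inv, GrpObj.inv_comp, GrpObj.comp_inv, hy u v t, mul_inv]

lemma kerIncl_iff (h : H ⟶ J) :
    IsCoboundaryAt (f ≫ h) T (c ≫ (kerIncl f h).hom.hom) ↔ IsCoboundaryAt f T c := by
  simp only [IsCoboundaryAt, Category.assoc, kerIncl_comp]

lemma kerMap (h : H ⟶ J) {c : F ⊗ F ⟶ (kernel (f ≫ h)).X} (hc : IsCoboundaryAt (f ≫ h) T c) :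
    IsCoboundaryAt h T (c ≫ (HeightOneSelmer.kerMap f h).hom.hom) := by
  obtain ⟨y, hy⟩ := hc
  refine ⟨y ≫ f.hom.hom, fun u v t ↦ ?_⟩
  rw [← Category.assoc, hy u v t, mul_comp, Category.assoc c, kerMap_comp]
  simp only [Category.assoc]

end IsCoboundaryAt

end Cohomology

/-! ### Selmer groups -/

section Selmer

variable (V : Scheme.{u}) [IsIntegral V] {A B C : Grp (Over (Spec V.functionField))}
  {F : Over (Spec V.functionField)} [Flat F.hom] [Surjective F.hom] [QuasiCompact F.hom]

lemma mem_selmerSet_iff {f : A ⟶ B} (h : HasUniqueSections F (kernel f)) (c : H1 (kernel f)) :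
    c ∈ selmerSet V f ↔ ∀ v : V, Order.coheight v = 1 →
      ∀ [IsDiscreteValuationRing (V.presheaf.stalk v)],
        IsCoboundaryAt f (specCompletion V v) (h.cocycle c) := by
  obtain ⟨P, rfl⟩ := Quotient.exists_rep c
  constructor
  · rintro ⟨Q, hQ, hv⟩ v hv1 _
    have := ((Q.isInImageDelta_iff (h.sec Q) _).1 (hv v hv1))
    change IsCoboundaryAt f (specCompletion V v) (h.cocycle (H1.mk P))
    rw [show H1.mk P = H1.mk Q from hQ.symm]
    exact this
  · intro hv
    exact ⟨P, rfl, fun v hv1 _ ↦ (P.isInImageDelta_iff (h.sec P) _).2 (hv v hv1)⟩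

/-- The Selmer group, as a subgroup. -/
def selmerGroup {f : A ⟶ B} (h : HasUniqueSections F (kernel f)) [IsCommMonObj A.X]
    [IsCommMonObj (kernel f).X] :
    letI := h.addCommGroup
    AddSubgroup (H1 (kernel f)) :=
  letI := h.addCommGroup
  { carrier := selmerSet V f
    add_mem' := fun {c d} hc hd ↦ by
      rw [mem_selmerSet_iff V h] at *
      intro v hv _
      exact (h.cocycle_add c d) ▸ (hc v hv).mul (hd v hv)
    zero_mem' := by
      rw [mem_selmerSet_iff V h]
      intro v hv _
      exact h.cocycle_zero ▸ IsCoboundaryAt.one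
    neg_mem' := fun {c} hc ↦ by
      rw [mem_selmerSet_iff V h] at *
      intro v hv _
      exact (h.cocycle_neg c) ▸ (hc v hv).inv }

lemma map_kerIncl_mem_selmerSet_iff {f : A ⟶ B} {g : B ⟶ C} (h₁ : HasUniqueSections F (kernel f))
    (h₂ : HasUniqueSections F (kernel (f ≫ g))) [IsCommMonObj (kernel f).X]
    [IsCommMonObj (kernel (f ≫ g)).X] (c : H1 (kernel f)) :
    (letI := h₁.addCommGroup; letI := h₂.addCommGroup; h₁.map h₂ (kerIncl f g) c) ∈
      selmerSet V (f ≫ g) ↔ c ∈ selmerSet V f := by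
  rw [mem_selmerSet_iff V h₁, mem_selmerSet_iff V h₂, HasUniqueSections.cocycle_map]
  simp only [IsCoboundaryAt.kerIncl_iff]

lemma map_kerMap_mem_selmerSet {f : A ⟶ B} {g : B ⟶ C} (h₂ : HasUniqueSections F (kernel (f ≫ g)))
    (h₃ : HasUniqueSections F (kernel g)) [IsCommMonObj (kernel (f ≫ g)).X]
    [IsCommMonObj (kernel g).X] {c : H1 (kernel (f ≫ g))} (hc : c ∈ selmerSet V (f ≫ g)) :
    (letI := h₂.addCommGroup; letI := h₃.addCommGroup; h₂.map h₃ (kerMap f g) c) ∈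
      selmerSet V g := by
  rw [mem_selmerSet_iff V h₂] at hc
  rw [mem_selmerSet_iff V h₃, HasUniqueSections.cocycle_map]
  exact fun v hv _ ↦ (hc v hv).kerMap g

end Selmer

/-! ### Left exactness of first cohomology -/

section Exactness

variable {S : Scheme.{u}} {F : Over S} [Flat F.hom] [Surjective F.hom] [QuasiCompact F.hom]
  {A B C : Grp (Over S)}

/-- As torsors have only one section over the cover, first cohomology is left exact. -/
lemma exact_map_kerIncl_map_kerMap {f : A ⟶ B} {g : B ⟶ C} (h₁ : HasUniqueSections F (kernel f))
    (h₂ : HasUniqueSections F (kernel (f ≫ g))) (h₃ : HasUniqueSections F (kernel g))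
    [IsCommMonObj (kernel f).X] [IsCommMonObj (kernel (f ≫ g)).X] [IsCommMonObj (kernel g).X] :
    letI := h₁.addCommGroup
    letI := h₂.addCommGroup
    letI := h₃.addCommGroup
    Function.Exact (h₁.map h₂ (kerIncl f g)) (h₂.map h₃ (kerMap f g)) := by
  let := h₁.addCommGroup
  let := h₂.addCommGroup
  let := h₃.addCommGroup
  intro c
  constructor
  · intro hc
    have h0 : h₂.cocycle c ≫ (kerMap f g).hom.hom = 1 := by
      rw [← h₂.cocycle_map h₃, hc]
      exact h₃.cocycle_zero
    obtain ⟨l, hl⟩ := exists_comp_kerIncl f g _ h0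
    have := mono_kerIncl f g
    obtain ⟨d, hd⟩ := h₁.exists_cocycle_eq l (fun u v w ↦ by
      rw [← cancel_mono (kerIncl f g).hom.hom, mul_comp, Category.assoc, Category.assoc,
        Category.assoc, hl, h₂.cocycle_mul])
    exact ⟨d, h₂.cocycle_injective (by rw [h₁.cocycle_map h₂, hd, hl])⟩
  · rintro ⟨d, rfl⟩
    refine h₃.cocycle_injective ?_
    rw [h₂.cocycle_map h₃, h₁.cocycle_map h₂, kerIncl_comp_kerMap]
    exact h₃.cocycle_zero.symm

end Exactness

/-! ### Points of affine schemes over an affine base -/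

section AffinePoints

variable {K : CommRingCat.{u}}

lemma Fn.pull_comp {X Y Z : Over (Spec K)} (f : X ⟶ Y) (g : Y ⟶ Z) :
    Fn.pull (f ≫ g) = (Fn.pull f).comp (Fn.pull g) := by
  ext r
  exact congr(($(Scheme.Hom.comp_appTop f.left g.left)).hom r)

lemma Fn.pull_id (X : Over (Spec K)) : Fn.pull (𝟙 X) = AlgHom.id K (Fn X) := by
  ext r
  rfl

lemma Fn.pull_injective {X Y : Over (Spec K)} [IsAffine Y.left] :
    Function.Injective (Fn.pull : (X ⟶ Y) → (Fn Y →ₐ[K] Fn X)) := by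
  intro f g h
  ext1
  refine ext_of_isAffine ?_
  ext r
  exact DFunLike.congr_fun h r

lemma Fn.pull_surjective {X Y : Over (Spec K)} [IsAffine Y.left] :
    Function.Surjective (Fn.pull : (X ⟶ Y) → (Fn Y →ₐ[K] Fn X)) := by
  intro φ
  let ψ : Γ(Y.left, ⊤) ⟶ Γ(X.left, ⊤) := CommRingCat.ofHom φ.toRingHom
  obtain ⟨f, h1⟩ : ∃ f : X.left ⟶ Y.left, f ≫ Y.left.toSpecΓ = X.left.toSpecΓ ≫ Spec.map ψ :=
    ⟨X.left.toSpecΓ ≫ Spec.map ψ ≫ inv Y.left.toSpecΓ, by simp⟩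
  have hf : f.appTop = ψ := by
    have h2 : X.left.toSpecΓ ≫ Spec.map f.appTop = X.left.toSpecΓ ≫ Spec.map ψ :=
      (Scheme.toSpecΓ_naturality f).symm.trans h1
    have h3 := congr(($h2).appTop)
    rwa [Scheme.Hom.comp_appTop, Scheme.Hom.comp_appTop, Scheme.toSpecΓ_appTop,
      Scheme.ΓSpecIso_naturality, Scheme.ΓSpecIso_naturality, cancel_epi] at h3
  refine ⟨Over.homMk f (ext_of_isAffine ?_), ?_⟩
  · rw [Scheme.Hom.comp_appTop, hf]
    rw [← cancel_epi (Scheme.ΓSpecIso K).inv]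
    ext r
    exact φ.commutes r
  · ext r
    exact congr(($hf).hom r)

variable {L L' : Type u} [CommRing L] [Algebra K L] [CommRing L'] [Algebra K L']

/-- The morphism of spectra given by a homomorphism of `K`-algebras. -/
def specMap (l : L →ₐ[K] L') : specAlg K L' ⟶ specAlg K L :=
  Over.homMk (Spec.map (CommRingCat.ofHom l.toRingHom)) (by
    simp only [specAlg, Over.mk_hom, Over.mk_left]
    rw [← Spec.map_comp, ← CommRingCat.ofHom_comp, AlgHom.toRingHom_eq_coe, AlgHom.comp_algebraMap])

lemma Fn.pull_specMap (l : L →ₐ[K] L') (f : Fn (specAlg K L)) :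
    Fn.specAlgEquiv L' (Fn.pull (specMap l) f) = l (Fn.specAlgEquiv L f) := by
  have := Scheme.ΓSpecIso_naturality (CommRingCat.ofHom l.toRingHom)
  exact congr(($this).hom f)

lemma Fn.eval_specMap {X : Over (Spec K)} (l : L →ₐ[K] L') (x : specAlg K L ⟶ X) :
    Fn.eval (specMap l ≫ x) = l.comp (Fn.eval x) := by
  ext f
  simp only [Fn.eval, Fn.pull_comp]
  exact Fn.pull_specMap l (Fn.pull x f)

lemma specMap_comp {L'' : Type u} [CommRing L''] [Algebra K L''] (l : L →ₐ[K] L')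
    (l' : L' →ₐ[K] L'') : specMap (l'.comp l) = specMap l' ≫ specMap l := by
  ext1
  exact Spec.map_comp (CommRingCat.ofHom l.toRingHom) (CommRingCat.ofHom l'.toRingHom)

lemma specMap_id : specMap (AlgHom.id K L) = 𝟙 _ := by
  ext1
  exact Spec.map_id (.of L)

instance : IsAffine (specAlg K L).left := inferInstanceAs (IsAffine (Spec _))

lemma Fn.eval_injective {X : Over (Spec K)} [IsAffine X.left] :
    Function.Injective (Fn.eval : (specAlg K L ⟶ X) → (Fn X →ₐ[K] L)) := by
  intro x y h
  refine Fn.pull_injective (AlgHom.ext fun f ↦ (Fn.specAlgEquiv L).injective ?_)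
  exact DFunLike.congr_fun h f

lemma Fn.eval_surjective {X : Over (Spec K)} [IsAffine X.left] :
    Function.Surjective (Fn.eval : (specAlg K L ⟶ X) → (Fn X →ₐ[K] L)) := by
  intro φ
  obtain ⟨x, hx⟩ := Fn.pull_surjective ((Fn.specAlgEquiv L).symm.toAlgHom.comp φ)
  refine ⟨x, AlgHom.ext fun f ↦ ?_⟩
  simp [Fn.eval, hx]

lemma Fn.eval_specMap_self (l : L →ₐ[K] L') :
    Fn.eval (specMap l) = l.comp (Fn.specAlgEquiv L).toAlgHom :=
  AlgHom.ext fun f ↦ Fn.pull_specMap l f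

instance {X Y : Over (Spec K)} [IsAffine X.left] [IsAffine Y.left] : IsAffine (X ⊗ Y).left := by
  rw [Over.tensorObj_left]; infer_instance

end AffinePoints

/-! ### Functions on Frobenius base changes and effective descent along Frobenius -/

section TwistFunctions

variable {K : CommRingCat.{u}} (p : ℕ) [Fact p.Prime] [CharP K p]

lemma Fn.twist_tmul_one (X : Over (Spec K)) (c : FrobTwist K p) : Fn.twist p X (c ⊗ₜ 1) =
    Fn.pull (snd X (frobPt p)) ((Fn.specAlgEquiv _).symm c) := by
  simp [Fn.twist]

lemma Fn.twist_one_tmul (X : Over (Spec K)) (f : Fn X) :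
    Fn.twist p X (1 ⊗ₜ f) = Fn.pull (fst X (frobPt p)) f := by
  simp [Fn.twist]

lemma Fn.twist_bijective (X : Over (Spec K)) [IsAffine X.left] :
    Function.Bijective (Fn.twist p X) := by
  let E := FrobTwist K p ⊗[K] Fn X
  obtain ⟨x₁, hx₁⟩ := Fn.eval_surjective (X := X) (L := E) Algebra.TensorProduct.includeRight
  let x₂ : specAlg K E ⟶ frobPt p := specMap
    (Algebra.TensorProduct.includeLeft : FrobTwist K p →ₐ[K] E)
  have hx₂ : Fn.eval x₂ = _ := Fn.eval_specMap_self _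
  obtain ⟨n, hn⟩ := Fn.pull_surjective (X := X ⊗ frobPt p)
    ((Fn.twist p X).comp (Fn.specAlgEquiv E).toAlgHom)
  have hnm : n ≫ lift x₁ x₂ = 𝟙 _ := by
    refine CartesianMonoidalCategory.hom_ext _ _ (Fn.pull_injective ?_) (Fn.pull_injective ?_)
    · ext f
      rw [Category.assoc, lift_fst, Category.id_comp, Fn.pull_comp, hn, ← Fn.twist_one_tmul]
      exact congr(Fn.twist p X ($hx₁ f))
    · ext f
      rw [Category.assoc, lift_snd, Category.id_comp, Fn.pull_comp, hn,
        ← (Fn.specAlgEquiv _).symm_apply_apply f, ← Fn.twist_tmul_one]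
      refine congr(Fn.twist p X $(DFunLike.congr_fun hx₂ _)).trans ?_
      rw [AlgEquiv.symm_apply_apply]
      rfl
  constructor
  · have h : (Fn.eval (lift x₁ x₂)).comp (Fn.twist p X) = AlgHom.id K E := by
      ext c
      · change Fn.eval (lift x₁ x₂) (Fn.twist p X (c ⊗ₜ 1)) = c ⊗ₜ 1
        rw [Fn.twist_tmul_one, ← AlgHom.comp_apply, Fn.eval_comp, lift_snd, hx₂]
        exact congr($((Fn.specAlgEquiv (FrobTwist K p)).apply_symm_apply c) ⊗ₜ[K] (1 : Fn X))
      · change Fn.eval (lift x₁ x₂) (Fn.twist p X (1 ⊗ₜ c)) = 1 ⊗ₜ c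
        rw [Fn.twist_one_tmul, ← AlgHom.comp_apply, Fn.eval_comp, lift_fst, hx₁]
        rfl
    exact Function.LeftInverse.injective (g := Fn.eval (lift x₁ x₂)) (DFunLike.congr_fun h)
  · intro g
    refine ⟨Fn.specAlgEquiv E (Fn.pull (lift x₁ x₂) g), ?_⟩
    have := DFunLike.congr_fun (Fn.pull_comp n (lift x₁ x₂)) g
    rw [hnm, Fn.pull_id, AlgHom.comp_apply, hn] at this
    exact this.symm

lemma Fn.pull_whiskerRight_twist {X Y : Over (Spec K)} (f : X ⟶ Y)
    (z : FrobTwist K p ⊗[K] Fn Y) :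
    Fn.pull (f ▷ frobPt p) (Fn.twist p Y z) =
      Fn.twist p X (Algebra.TensorProduct.map (AlgHom.id K _) (Fn.pull f) z) := by
  rw [← AlgHom.comp_apply, ← AlgHom.comp_apply]
  congr 1
  ext c
  · change Fn.pull _ (Fn.twist p Y (c ⊗ₜ 1)) = Fn.twist p X (c ⊗ₜ Fn.pull f 1)
    rw [map_one, Fn.twist_tmul_one, Fn.twist_tmul_one, ← AlgHom.comp_apply, ← Fn.pull_comp,
      whiskerRight_snd]
  · change Fn.pull _ (Fn.twist p Y (1 ⊗ₜ c)) = Fn.twist p X (1 ⊗ₜ Fn.pull f c)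
    rw [Fn.twist_one_tmul, Fn.twist_one_tmul, ← AlgHom.comp_apply, ← AlgHom.comp_apply,
      ← Fn.pull_comp, ← Fn.pull_comp, whiskerRight_fst]

lemma Module.Flat.of_isField {k : Type*} [CommRing k] (hk : IsField k) (M : Type*) [AddCommGroup M]
    [Module k M] : Module.Flat k M := by
  let := hk.toField
  infer_instance

lemma isIso_of_pull_bijective {X Y : Over (Spec K)} [IsAffine X.left] [IsAffine Y.left]
    (f : X ⟶ Y) (h : Function.Bijective (Fn.pull f)) : IsIso f := by
  let e := AlgEquiv.ofBijective _ h
  obtain ⟨g, hg⟩ := Fn.pull_surjective (X := Y) (Y := X) e.symm.toAlgHom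
  refine ⟨g, Fn.pull_injective ?_, Fn.pull_injective ?_⟩
  · ext a
    rw [Fn.pull_comp, Fn.pull_id, hg]
    exact e.apply_symm_apply a
  · ext a
    rw [Fn.pull_comp, Fn.pull_id, hg]
    exact e.symm_apply_apply a

/-- Let `r₁, r₂ : Y ⟶ X` be morphisms of affine schemes over a field whose base changes along
Frobenius have a split coequalizer `Z`. Then their coequalizer `Spec C` in affine schemes has base
change `Z`. -/
lemma exists_isIso_of_isSplitCoequalizer (hK : IsField K) {X Y Z : Over (Spec K)} [IsAffine X.left]
    [IsAffine Y.left] [IsAffine Z.left] (r₁ r₂ : Y ⟶ X) (e : X ⊗ frobPt p ⟶ Z)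
    (s : Z ⟶ X ⊗ frobPt p) (t : X ⊗ frobPt p ⟶ Y ⊗ frobPt p) (hse : s ≫ e = 𝟙 _)
    (ht₁ : t ≫ r₁ ▷ frobPt p = 𝟙 _) (ht₂ : t ≫ r₂ ▷ frobPt p = e ≫ s)
    (he : r₁ ▷ frobPt p ≫ e = r₂ ▷ frobPt p ≫ e) :
    ∃ (C : Type u) (_ : CommRing C) (_ : Algebra K C) (π : X ⟶ specAlg K C),
      r₁ ≫ π = r₂ ≫ π ∧ IsIso (s ≫ π ▷ frobPt p) := by
  have hflat := Module.Flat.of_isField hK (FrobTwist K p)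
  -- the formation of the equalizer of the rings of functions commutes with flat base change
  let C := AlgHom.equalizer (Fn.pull r₁) (Fn.pull r₂)
  obtain ⟨π, hπ⟩ := Fn.pull_surjective (X := X) (Y := specAlg K C)
    (C.val.comp (Fn.specAlgEquiv C).toAlgHom)
  have hrπ : r₁ ≫ π = r₂ ≫ π := by
    refine Fn.pull_injective ?_
    rw [Fn.pull_comp, Fn.pull_comp, hπ]
    ext a
    exact (Fn.specAlgEquiv C a).2
  refine ⟨C, inferInstance, inferInstance, π, hrπ, isIso_of_pull_bijective _ ?_⟩
  have hem : e ≫ s ≫ π ▷ frobPt p = π ▷ frobPt p := by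
    rw [← Category.assoc, ← ht₂, Category.assoc, ← comp_whiskerRight, ← hrπ, comp_whiskerRight,
      ← Category.assoc, ht₁, Category.id_comp]
  have hpem (w) : Fn.pull e (Fn.pull (s ≫ π ▷ frobPt p) w) = Fn.pull (π ▷ frobPt p) w := by
    rw [← AlgHom.comp_apply, ← Fn.pull_comp, hem]
  constructor
  · intro w w' h
    obtain ⟨z, rfl⟩ := (Fn.twist_bijective p _).2 w
    obtain ⟨z', rfl⟩ := (Fn.twist_bijective p _).2 w'
    have h1 := congr(Fn.pull e $h)
    rw [hpem, hpem, Fn.pull_whiskerRight_twist, Fn.pull_whiskerRight_twist] at h1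
    have h2 := (Fn.twist_bijective p _).1 h1
    have hinj : Function.Injective (Fn.pull π) := by
      rw [hπ]
      exact Subtype.val_injective.comp (Fn.specAlgEquiv C).injective
    congr 1
    exact Module.Flat.lTensor_preserves_injective_linearMap (M := FrobTwist K p)
      (Fn.pull π).toLinearMap hinj h2
  · intro z
    obtain ⟨ω, hω⟩ := (Fn.twist_bijective p _).2 (Fn.pull e z)
    have h1 : Algebra.TensorProduct.map (AlgHom.id K _) (Fn.pull r₁) ω =
        Algebra.TensorProduct.map (AlgHom.id K (FrobTwist K p)) (Fn.pull r₂) ω := by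
      refine (Fn.twist_bijective p _).1 ?_
      rw [← Fn.pull_whiskerRight_twist, ← Fn.pull_whiskerRight_twist, hω, ← AlgHom.comp_apply,
        ← AlgHom.comp_apply, ← Fn.pull_comp, ← Fn.pull_comp, he]
    obtain ⟨ω', hω'⟩ :
        ∃ ω', Algebra.TensorProduct.map (AlgHom.id K (FrobTwist K p)) C.val ω' = ω := by
      let eq := AlgHom.tensorEqualizerEquiv K (FrobTwist K p) (Fn.pull r₁) (Fn.pull r₂)
      refine ⟨eq.symm ⟨ω, h1⟩, ?_⟩
      have := AlgHom.coe_tensorEqualizer K (FrobTwist K p) (Fn.pull r₁) (Fn.pull r₂)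
        (eq.symm ⟨ω, h1⟩)
      rw [← AlgHom.tensorEqualizerEquiv_apply, AlgEquiv.apply_symm_apply] at this
      exact this.symm
    have hinj : Function.Injective (Fn.pull e) := by
      refine Function.LeftInverse.injective (g := Fn.pull s) fun a ↦ ?_
      rw [← AlgHom.comp_apply, ← Fn.pull_comp, hse, Fn.pull_id, AlgHom.id_apply]
    refine ⟨Fn.twist p _ (Algebra.TensorProduct.map (AlgHom.id K _)
      (Fn.specAlgEquiv C).symm.toAlgHom ω'), hinj ?_⟩
    rw [hpem, Fn.pull_whiskerRight_twist, ← hω, ← hω', hπ, ← AlgHom.comp_apply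
      (Algebra.TensorProduct.map _ _), ← Algebra.TensorProduct.map_comp]
    congr 3
    ext a
    simp

end TwistFunctions

/-! ### The torsor with a given cocycle -/

section TwistTorsor

variable {K : CommRingCat.{u}} (p : ℕ) [Fact p.Prime] [CharP K p]

lemma flat_surjective_specMap (hK : IsField K) (L : Type u) [CommRing L] [Nontrivial L]
    (f : K →+* L) :
    Flat (Spec.map (CommRingCat.ofHom f)) ∧ Surjective (Spec.map (CommRingCat.ofHom f)) := by
  let := hK.toField
  let := f.toAlgebra
  rw [flat_and_surjective_SpecMap_iff]
  exact (RingHom.faithfullyFlat_algebraMap_iff (R := K) (S := L)).2 inferInstance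

/-- The scheme underlying the torsor with a given cocycle `c`. The morphism `π : F × G ⟶ P` is
`(u, g) ↦ g · σ(u)`, so that it takes the same value at `(u, g)` and at `(v, g c(u, v))`; the last
condition says that `g ↦ g · σ` is an isomorphism from `G` to `P` over Frobenius. -/
lemma exists_twist (hK : IsField K) (G : Grp (Over (Spec K))) [IsAffine G.X.left]
    (c : frobPt p ⊗ frobPt p ⟶ G.X)
    (hc : ∀ {Z : Over (Spec K)} (u v w : Z ⟶ frobPt p),
      lift u v ≫ c * lift v w ≫ c = lift u w ≫ c) :
    ∃ (C : Type u) (_ : CommRing C) (_ : Algebra K C) (π : frobPt p ⊗ G.X ⟶ specAlg K C),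
      (∀ {Z : Over (Spec K)} (u v : Z ⟶ frobPt p) (g : Z ⟶ G.X),
        lift u g ≫ π = lift v (g * lift u v ≫ c) ≫ π) ∧
      IsIso (lift (lift (snd _ _) (fst _ _) ≫ π) (snd G.X (frobPt p))) := by
  have hc1 {Z : Over (Spec K)} (u : Z ⟶ frobPt p) : lift u u ≫ c = 1 :=
    mul_eq_left.1 (hc u u u)
  -- `(u, v, g) ↦ (u, g)` and `(u, v, g) ↦ (v, g c(u, v))` have the split coequalizer
  -- `(u, g), w ↦ g c(u, w)` over Frobenius
  let r₁ : frobPt p ⊗ frobPt p ⊗ G.X ⟶ frobPt p ⊗ G.X := lift (fst _ _) (snd _ _ ≫ snd _ _)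
  let r₂ : frobPt p ⊗ frobPt p ⊗ G.X ⟶ frobPt p ⊗ G.X := lift (snd _ _ ≫ fst _ _)
    ((snd _ _ ≫ snd _ _) * lift (fst _ _) (snd _ _ ≫ fst _ _) ≫ c)
  let e : (frobPt p ⊗ G.X) ⊗ frobPt p ⟶ G.X ⊗ frobPt p :=
    lift ((fst _ _ ≫ snd _ _) * lift (fst _ _ ≫ fst _ _) (snd _ _) ≫ c) (snd _ _)
  let s : G.X ⊗ frobPt p ⟶ (frobPt p ⊗ G.X) ⊗ frobPt p :=
    lift (lift (snd _ _) (fst _ _)) (snd _ _)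
  let t : (frobPt p ⊗ G.X) ⊗ frobPt p ⟶ (frobPt p ⊗ frobPt p ⊗ G.X) ⊗ frobPt p :=
    lift (lift (fst _ _ ≫ fst _ _) (lift (snd _ _) (fst _ _ ≫ snd _ _))) (snd _ _)
  obtain ⟨C, _, _, π, hπ, hiso⟩ := exists_isIso_of_isSplitCoequalizer p hK r₁ r₂ e s t
    (by ext1 <;> simp [s, e, comp_mul, comp_lift_assoc, hc1])
    (by ext1
        · ext1 <;> simp [t, r₁]
        · simp [t])
    (by ext1
        · ext1 <;> simp [t, r₂, e, s, comp_mul, comp_lift_assoc]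
        · simp [t, e, s])
    (by ext1
        · simp [r₁, r₂, e, comp_mul, comp_lift_assoc, _root_.mul_assoc, hc]
        · simp [e])
  refine ⟨C, _, _, π, fun {Z} u v g ↦ ?_, ?_⟩
  · have := congr(lift u (lift v g) ≫ $hπ)
    simpa [r₁, r₂, comp_mul, comp_lift_assoc] using this
  · convert hiso using 1
    ext1 <;> simp [s]

/-- Each cocycle of a finite group scheme over a field, for the cover given by Frobenius, comes from
a torsor. -/
lemma exists_torsor_of_cocycle (hK : IsField K) (G : Grp (Over (Spec K))) [IsFinite G.X.hom]
    (c : frobPt p ⊗ frobPt p ⟶ G.X)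
    (hc : ∀ {Z : Over (Spec K)} (u v w : Z ⟶ frobPt p),
      lift u v ≫ c * lift v w ≫ c = lift u w ≫ c) :
    ∃ (P : Torsor G) (σ : frobPt p ⟶ P.X), IsAffine P.X.left ∧ P.cocycle σ = c := by
  have hFnt : Nontrivial (FrobTwist K p) := hK.nontrivial
  obtain ⟨_, _⟩ := flat_surjective_specMap hK (FrobTwist K p) (algebraMap K _)
  have : Flat (frobPt p (K := K)).hom := ‹_›
  have : Surjective (frobPt p (K := K)).hom := ‹_›
  have : QuasiCompact (frobPt p (K := K)).hom :=
    inferInstanceAs (QuasiCompact (Spec.map _))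
  have : IsAffine G.X.left := isAffine_of_isAffineHom G.X.hom
  have hc1 {Z : Over (Spec K)} (u : Z ⟶ frobPt p) : lift u u ≫ c = 1 :=
    mul_eq_left.1 (hc u u u)
  obtain ⟨C, _, _, π, hπ, hiso⟩ := exists_twist p hK G c hc
  let m := lift (lift (snd _ _) (fst _ _) ≫ π) (snd G.X (frobPt p))
  -- the coordinate `g` of a point `π(u, g)`
  let ρ {Z : Over (Spec K)} (x : Z ⟶ specAlg K C) (u : Z ⟶ frobPt p) : Z ⟶ G.X :=
    lift x u ≫ inv m ≫ fst _ _
  have hm {Z : Over (Spec K)} (u : Z ⟶ frobPt p) (g : Z ⟶ G.X) :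
      lift g u ≫ m = lift (lift u g ≫ π) u := by
    ext1 <;> simp [m, comp_lift_assoc]
  have hρπ {Z : Over (Spec K)} (u : Z ⟶ frobPt p) (g : Z ⟶ G.X) : ρ (lift u g ≫ π) u = g := by
    simp only [ρ]
    rw [← hm, Category.assoc, IsIso.hom_inv_id_assoc, lift_fst]
  have hπρ {Z : Over (Spec K)} (x : Z ⟶ specAlg K C) (u : Z ⟶ frobPt p) :
      lift u (ρ x u) ≫ π = x := by
    have h1 : lift (ρ x u) u = lift x u ≫ inv m := by
      have h2 : (lift x u ≫ inv m) ≫ snd _ _ = u := by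
        have : inv m ≫ snd _ _ = snd _ _ := by rw [IsIso.inv_comp_eq]; simp [m]
        rw [Category.assoc, this, lift_snd]
      ext1
      · simp [ρ]
      · rw [h2, lift_snd]
    have := congr($h1 ≫ m ≫ fst _ _)
    rw [← Category.assoc, hm] at this
    simpa using this
  have hρc {Z : Over (Spec K)} (x : Z ⟶ specAlg K C) (u v : Z ⟶ frobPt p) :
      ρ x u * lift u v ≫ c = ρ x v := by
    rw [← hρπ v (ρ x u * lift u v ≫ c), ← hπ, hπρ]
  have hρcomp {Z Z' : Over (Spec K)} (z : Z' ⟶ Z) (x : Z ⟶ specAlg K C) (u : Z ⟶ frobPt p) :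
      z ≫ ρ x u = ρ (z ≫ x) (z ≫ u) := by
    simp only [ρ, ← Category.assoc, comp_lift]
  obtain ⟨act, hact⟩ := exists_comp_eq_of_forall_lift (frobPt p) (T := G.X ⊗ specAlg K C)
    (Y := specAlg K C)
    (lift (fst _ _) ((snd _ _ ≫ fst _ _) * ρ (snd _ _ ≫ snd _ _) (fst _ _)) ≫ π)
    (fun {Z} u v t ↦ by
      simp only [← Category.assoc, comp_lift, comp_mul, hρcomp, lift_fst, lift_snd]
      rw [hπ u v, _root_.mul_assoc, hρc])
  have hact' {Z : Over (Spec K)} (u : Z ⟶ frobPt p) (g : Z ⟶ G.X) (x : Z ⟶ specAlg K C) :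
      lift g x ≫ act = lift u (g * ρ x u) ≫ π := by
    rw [hact u]
    simp only [← Category.assoc, comp_lift, comp_mul, hρcomp, lift_fst, lift_snd]
  have hρact {Z : Over (Spec K)} (u : Z ⟶ frobPt p) (g : Z ⟶ G.X) (x : Z ⟶ specAlg K C) :
      ρ (lift g x ≫ act) u = g * ρ x u := by
    rw [hact' u, hρπ]
  have hρinj {Z : Over (Spec K)} (u : Z ⟶ frobPt p) {x y : Z ⟶ specAlg K C}
      (h : ρ x u = ρ y u) : x = y := by
    rw [← hπρ x u, h, hπρ]
  -- the quotient of two points of the torsor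
  obtain ⟨dv, hdv⟩ := exists_comp_eq_of_forall_lift (frobPt p) (T := specAlg K C ⊗ specAlg K C)
    (Y := G.X) (ρ (snd _ _ ≫ fst _ _) (fst _ _) * (ρ (snd _ _ ≫ snd _ _) (fst _ _))⁻¹)
    (fun {Z} u v t ↦ by
      simp only [comp_mul, GrpObj.comp_inv, hρcomp, ← Category.assoc, lift_fst, lift_snd]
      rw [← hρc _ u v, ← hρc _ u v, mul_inv_rev]
      group)
  have hdv' {Z : Over (Spec K)} (u : Z ⟶ frobPt p) (x y : Z ⟶ specAlg K C) :
      lift x y ≫ dv = ρ x u * (ρ y u)⁻¹ := by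
    rw [hdv u]
    simp only [comp_mul, GrpObj.comp_inv, hρcomp, ← Category.assoc, lift_fst, lift_snd]
  -- the section `u ↦ π(u, 1)` has cocycle `c`
  let σ : frobPt p ⟶ specAlg K C := lift (𝟙 _) 1 ≫ π
  have hnt : Nontrivial C := by
    have := RingHom.domain_nontrivial (Fn.eval σ).toRingHom
    exact (Fn.specAlgEquiv (K := K) C).injective.nontrivial
  have hft : LocallyOfFiniteType (specAlg K C).hom := by
    have h : LocallyOfFiniteType (snd (specAlg K C) (frobPt p)).left := by
      have e : snd (specAlg K C) (frobPt p) = inv m ≫ snd G.X (frobPt p) := by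
        rw [IsIso.eq_inv_comp]; simp [m]
      have : IsIso (inv m).left := inferInstanceAs (IsIso ((Over.forget _).map (inv m)))
      have : LocallyOfFiniteType G.X.hom := inferInstance
      rw [e, Over.comp_left, Over.snd_left]
      have : LocallyOfFiniteType (pullback.snd G.X.hom (frobPt p).hom) := inferInstance
      infer_instance
    exact MorphismProperty.of_pullback_snd_of_descendsAlong (P := @LocallyOfFiniteType)
      (Q := @Surjective ⊓ @Flat ⊓ @QuasiCompact) (g := (frobPt p).hom)
      ⟨⟨inferInstance, inferInstance⟩, inferInstance⟩ h
  obtain ⟨hfl, hsurj⟩ := flat_surjective_specMap hK C (algebraMap K C)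
  let P : Torsor G :=
    { X := specAlg K C
      act := act
      one_act := fun {T} x ↦ by
        refine hom_ext_of_cover (frobPt p) (hρinj (fst _ _) ?_)
        rw [← Category.assoc, comp_lift, hρact, comp_one, _root_.one_mul]
      mul_act := fun {T} g h x ↦ by
        refine hom_ext_of_cover (frobPt p) (hρinj (fst _ _) ?_)
        simp only [← Category.assoc, comp_lift, hρact, comp_mul, _root_.mul_assoc]
      isIso_shear := by
        have e₁ : snd (frobPt p) (G.X ⊗ specAlg K C) =
          lift (snd _ _ ≫ fst _ _) (snd _ _ ≫ snd _ _) := by ext1 <;> simp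
        have e₂ : snd (frobPt p) (specAlg K C ⊗ specAlg K C) =
          lift (snd _ _ ≫ fst _ _) (snd _ _ ≫ snd _ _) := by ext1 <;> simp
        refine ⟨lift dv (snd _ _), hom_ext_of_cover (frobPt p) ?_, hom_ext_of_cover (frobPt p) ?_⟩
        · ext1
          · simp only [comp_lift, comp_lift_assoc, Category.comp_id, lift_fst]
            nth_rw 1 [e₁]
            rw [hdv' (fst _ _), hρact, mul_inv_cancel_right]
          · simp
        · ext1
          · simp only [comp_lift, comp_lift_assoc, Category.comp_id, lift_fst]
            refine hρinj (fst _ _) ?_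
            nth_rw 1 [e₂]
            rw [hρact, hdv' (fst _ _), inv_mul_cancel_right]
          · simp
      flat := hfl
      surjective := hsurj
      locallyOfFinitePresentation := by
        let := hK.toField
        change LocallyOfFiniteType (Spec.map _) at hft
        change LocallyOfFinitePresentation (Spec.map _)
        rw [HasRingHomProperty.Spec_iff (P := @LocallyOfFiniteType)] at hft
        rw [HasRingHomProperty.Spec_iff (P := @LocallyOfFinitePresentation)]
        exact RingHom.FinitePresentation.of_finiteType.1 hft }
  refine ⟨P, σ, inferInstanceAs (IsAffine (specAlg K C).left), P.diff_eq ?_⟩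
  change lift c (snd _ _ ≫ σ) ≫ act = _
  have hσ {Z : Over (Spec K)} (u : Z ⟶ frobPt p) : u ≫ σ = lift u 1 ≫ π := by
    simp only [σ, ← Category.assoc, comp_lift, Category.comp_id, comp_one]
  rw [hact' (snd _ _), hσ, hσ, hρπ, _root_.mul_one, hπ (fst _ _) (snd _ _), _root_.one_mul,
    lift_fst_snd, Category.id_comp]

end TwistTorsor

/-! ### Torsors under group schemes of height one have a unique section over Frobenius -/

section Sections

variable {K : CommRingCat.{u}} (p : ℕ)

lemma charP_of_isField [CharP K p] (hK : IsField K) (R : Type u) [CommRing R] [Nontrivial R]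
    [Algebra K R] : CharP R p := by
  let := hK.toField
  exact charP_of_injective_ringHom (f := algebraMap K R) (RingHom.injective _) p

variable [Fact p.Prime]

/-- Frobenius kills the points of a group scheme of height one. -/
lemma IsHeightOne.frobenius_comp {S : Scheme.{u}} {G : Grp (Over S)} (hG : IsHeightOne p G)
    {R : Type u} [CommRing R] [CharP R p] (t : Spec (.of R) ⟶ S) (g : Over.mk t ⟶ G.X) :
    (Over.homMk (Spec.map (CommRingCat.ofHom (frobenius R p))) rfl :
      Over.mk (Spec.map (CommRingCat.ofHom (frobenius R p)) ≫ t) ⟶ Over.mk t) ≫ g = 1 := by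
  ext1
  refine (hG.frobenius_eq_zero R g.left).trans ?_
  have h : g.left ≫ G.X.hom = t := Over.w g
  exact congr(Spec.map (CommRingCat.ofHom (frobenius R p)) ≫
    $((Category.assoc _ _ _).symm.trans congr($h ≫ η[G.X].left)))

/-- The absolute Frobenius of the spectrum of a `K`-algebra, as a morphism over `Spec K`. -/
def absFrob (R : Type u) [CommRing R] [Algebra K R] [CharP R p] :
    Over.mk (Spec.map (CommRingCat.ofHom (frobenius R p)) ≫ (specAlg K R).hom) ⟶ specAlg K R :=
  Over.homMk (Spec.map (CommRingCat.ofHom (frobenius R p))) rfl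

lemma absFrob_comp {G : Grp (Over (Spec K))} (hG : IsHeightOne p G) (R : Type u) [CommRing R]
    [Algebra K R] [CharP R p] (g : specAlg K R ⟶ G.X) : absFrob p R ≫ g = 1 :=
  hG.frobenius_comp p (specAlg K R).hom g

variable [CharP K p]

/-- A group scheme of height one has no non-trivial points over Frobenius: such a point becomes
trivial after composition with the Frobenius of `K^{[1]}`, which is an epimorphism. -/
lemma eq_one_of_isHeightOne (hK : IsField K) {G : Grp (Over (Spec K))} (hG : IsHeightOne p G)
    (g : frobPt p ⟶ G.X) : g = 1 := by
  have : Nontrivial (FrobTwist K p) := hK.nontrivial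
  have : CharP (FrobTwist K p) p := charP_of_isField p hK _
  have : Nontrivial K := hK.nontrivial
  have hepi : Epi (absFrob (K := K) p (FrobTwist K p)) := by
    obtain ⟨_, _⟩ := flat_surjective_specMap (K := .of (FrobTwist K p)) hK
      (FrobTwist K p) (frobenius (FrobTwist K p) p)
    have : Epi (absFrob (K := K) p (FrobTwist K p)).left :=
      inferInstanceAs (Epi (Spec.map (CommRingCat.ofHom (frobenius (FrobTwist K p) p))))
    exact Over.epi_of_epi_left _
  rw [← cancel_epi (absFrob p (FrobTwist K p)), absFrob_comp p hG, comp_one]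

/-- A point of the torsor with values in a `K`-algebra `R`, composed with the absolute Frobenius of
`Spec R`, descends along the faithfully flat morphism `Spec R ⟶ Spec K` to a section over
Frobenius: the two points with values in `R ⊗ R` that one has to compare differ by a point of `G`,
which Frobenius kills. -/
lemma nonempty_section_of_point (hK : IsField K) {G : Grp (Over (Spec K))} (hG : IsHeightOne p G)
    (P : Torsor G) (R : Type u) [CommRing R] [Algebra K R] [Nontrivial R] (j : specAlg K R ⟶ P.X) :
    Nonempty (frobPt p ⟶ P.X) := by
  have : Nontrivial K := hK.nontrivial
  have : Nontrivial (R ⊗[K] R) := by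
    let := hK.toField
    infer_instance
  have : CharP R p := charP_of_isField p hK R
  have : CharP (R ⊗[K] R) p := charP_of_isField p hK _
  let l₁ : R →ₐ[K] R ⊗[K] R := Algebra.TensorProduct.includeLeft
  let l₂ : R →ₐ[K] R ⊗[K] R := Algebra.TensorProduct.includeRight
  -- over `R ⊗ R`, the two points of the torsor agree after composition with Frobenius
  have hj : absFrob p (R ⊗[K] R) ≫ specMap l₁ ≫ j = absFrob p (R ⊗[K] R) ≫ specMap l₂ ≫ j := by
    rw [← P.diff_smul (specMap l₁ ≫ j) (specMap l₂ ≫ j), Torsor.lift_comp_smul, absFrob_comp p hG,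
      Torsor.one_smul']
  obtain ⟨_, _⟩ := flat_surjective_specMap hK R (algebraMap K R)
  let π : Spec (.of R) ⟶ Spec (.of K) := Spec.map (CommRingCat.ofHom (algebraMap K R))
  let jl : Spec (.of R) ⟶ P.X.left := j.left
  let s : Spec (.of R) ⟶ P.X.left := Spec.map (CommRingCat.ofHom (frobenius R p)) ≫ jl
  have hl (l : R →ₐ[K] R ⊗[K] R) : Spec.map (CommRingCat.ofHom l.toRingHom) ≫ s =
      Spec.map (CommRingCat.ofHom (frobenius (R ⊗[K] R) p)) ≫
        Spec.map (CommRingCat.ofHom l.toRingHom) ≫ jl := by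
    simp only [s, ← Category.assoc, ← Spec.map_comp, ← CommRingCat.ofHom_comp]
    rw [RingHom.frobenius_comm]
  have hs : Spec.map (CommRingCat.ofHom l₁.toRingHom) ≫ s =
      Spec.map (CommRingCat.ofHom l₂.toRingHom) ≫ s :=
    (hl l₁).trans ((congr(($hj).left)).trans (hl l₂).symm)
  have hs' {Z : Scheme.{u}} (a b : Z ⟶ Spec (.of R)) (h : a ≫ π = b ≫ π) : a ≫ s = b ≫ s := by
    let m := pullback.lift a b h ≫ (pullbackSpecIso K R R).hom
    have h₁ : m ≫ Spec.map (CommRingCat.ofHom l₁.toRingHom) = a :=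
      (Category.assoc _ _ _).trans
        (congr(pullback.lift a b h ≫ $(pullbackSpecIso_hom_fst K R R)).trans
          (pullback.lift_fst a b h))
    have h₂ : m ≫ Spec.map (CommRingCat.ofHom l₂.toRingHom) = b :=
      (Category.assoc _ _ _).trans
        (congr(pullback.lift a b h ≫ $(pullbackSpecIso_hom_snd K R R)).trans
          (pullback.lift_snd a b h))
    calc a ≫ s = m ≫ Spec.map (CommRingCat.ofHom l₁.toRingHom) ≫ s :=
          congr($h₁.symm ≫ s).trans (Category.assoc _ _ _)
      _ = m ≫ Spec.map (CommRingCat.ofHom l₂.toRingHom) ≫ s := congr(m ≫ $hs)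
      _ = b ≫ s := (Category.assoc _ _ _).symm.trans congr($h₂ ≫ s)
  have : Epi π := inferInstance
  have : EffectiveEpi π := inferInstance
  let τ : Spec (.of K) ⟶ P.X.left := EffectiveEpi.desc π s hs'
  have hτ : τ ≫ P.X.hom = Spec.map (CommRingCat.ofHom (frobenius K p)) := by
    have hjl : jl ≫ P.X.hom = π := Over.w j
    rw [← cancel_epi π, EffectiveEpi.fac_assoc, Category.assoc, hjl]
    exact (Spec.map_comp _ _).symm.trans (congr(Spec.map (CommRingCat.ofHom
      $((RingHom.frobenius_comm (algebraMap K R) p).symm))).trans (Spec.map_comp _ _))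
  exact ⟨Over.homMk τ hτ⟩

lemma nonempty_section (hK : IsField K) {G : Grp (Over (Spec K))} (hG : IsHeightOne p G)
    (P : Torsor G) : Nonempty (frobPt p ⟶ P.X) := by
  have : Nontrivial K := hK.nontrivial
  obtain ⟨x, -⟩ := P.surjective.surj (Nonempty.some inferInstance)
  let R : Type u := P.X.left.residueField x
  let : CommRing R := inferInstanceAs (CommRing (P.X.left.residueField x))
  have : Nontrivial R := inferInstanceAs (Nontrivial (P.X.left.residueField x))
  let f : Spec (.of R) ⟶ P.X.left := P.X.left.fromSpecResidueField x
  let : Algebra K R := (Spec.preimage (f ≫ P.X.hom)).hom.toAlgebra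
  have hf : f ≫ P.X.hom = (specAlg K R).hom := (Spec.map_preimage (f ≫ P.X.hom)).symm
  exact nonempty_section_of_point p hK hG P R (Over.homMk f hf)

/-- Two sections over Frobenius differ by a point of the group over Frobenius, which is trivial. -/
lemma hasUniqueSections (hK : IsField K) {G : Grp (Over (Spec K))} (hG : IsHeightOne p G) :
    HasUniqueSections (frobPt p) G where
  exists_section P := by
    obtain ⟨σ⟩ := nonempty_section p hK hG P
    refine ⟨σ, fun τ ↦ ?_⟩
    rw [← P.diff_smul τ σ, eq_one_of_isHeightOne p hK hG (P.diff τ σ), Torsor.one_smul']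
  effective c hc := by
    have := hG.finite
    obtain ⟨P, σ, -, h⟩ := exists_torsor_of_cocycle p hK G c hc
    exact ⟨P, σ, h⟩

lemma frobPt_isCover (hK : IsField K) : Flat (frobPt p (K := K)).hom ∧
    Surjective (frobPt p (K := K)).hom ∧ QuasiCompact (frobPt p (K := K)).hom := by
  have : Nontrivial (FrobTwist K p) := hK.nontrivial
  obtain ⟨h₁, h₂⟩ := flat_surjective_specMap hK (FrobTwist K p) (algebraMap K _)
  exact ⟨h₁, h₂, inferInstanceAs (QuasiCompact (Spec.map _))⟩

/-- A torsor under a group scheme of height one is affine, because the torsor constructed from its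
cocycle is affine. -/
lemma isAffine_of_isHeightOne (hK : IsField K) {G : Grp (Over (Spec K))} (hG : IsHeightOne p G)
    (P : Torsor G) : IsAffine P.X.left := by
  have := hG.finite
  obtain ⟨_, _, _⟩ := frobPt_isCover p hK
  have h := hasUniqueSections p hK hG
  obtain ⟨Q, τ, hQ, hτ⟩ := exists_torsor_of_cocycle p hK G (P.cocycle (h.sec P))
    (h.cocycle_mul (H1.mk P))
  obtain ⟨e⟩ := Torsor.nonempty_iso_of_cocycle (h.sec P) τ h.eq_sec
    (fun τ' ↦ (h.eq_sec τ').trans (h.eq_sec τ).symm) hτ.symm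
  have : IsIso e.iso.hom.left := inferInstanceAs (IsIso ((Over.forget _).map e.iso.hom))
  exact IsAffine.of_isIso e.iso.hom.left

end Sections

/-! ### Derivations of purely inseparable extensions of exponent one -/

section Inseparable

variable {k F : Type*} [Field k] [Field F] [Algebra k F] (p : ℕ)

/-- In `F[ε]`, a `p`-th power has no infinitesimal part. -/
lemma pow_charP_eq_inl [CharP F p] (y : TrivSqZeroExt F F) :
    y ^ p = TrivSqZeroExt.inl (y.fst ^ p) := by
  ext
  · simp
  · simp [TrivSqZeroExt.snd_pow]

variable [Fact p.Prime] [CharP F p]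

open Polynomial in
/-- A subalgebra of `F[ε]` that meets `ε F` trivially is the graph of a derivation into `F`, defined
on a subfield of `F`. This derivation extends with an arbitrary value to an element `x` outside of
this subfield, because `X ^ p - x ^ p` is the minimal polynomial of `x` and has derivative zero. -/
lemma exists_extend_graph (hF : ∀ x : F, ∃ a : k, algebraMap k F a = x ^ p)
    (Γ : Subalgebra k (TrivSqZeroExt F F)) (hΓ : ∀ g ∈ Γ, g.fst = 0 → g = 0)
    (y : TrivSqZeroExt F F) (hy : ∀ g ∈ Γ, g.fst ≠ y.fst) :
    ∃ N : Subalgebra k (TrivSqZeroExt F F), Γ ≤ N ∧ y ∈ N ∧ ∀ g ∈ N, g.fst = 0 → g = 0 := by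
  refine ⟨(Algebra.adjoin Γ {y}).restrictScalars k,
    fun g hg ↦ (Subalgebra.mem_restrictScalars k).2 ((Algebra.adjoin Γ {y}).algebraMap_mem ⟨g, hg⟩),
    (Subalgebra.mem_restrictScalars k).2 (Algebra.subset_adjoin (Set.mem_singleton y)),
    fun z hz hz0 ↦ ?_⟩
  rw [Subalgebra.mem_restrictScalars] at hz
  let fstΓ : Γ →ₐ[k] F := (TrivSqZeroExt.fstHom k F F).comp Γ.val
  have halg : Algebra.IsIntegral k F := ⟨fun x ↦ by
    obtain ⟨a, ha⟩ := hF x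
    refine .of_pow (Fact.out (p := p.Prime)).pos ?_
    rw [← ha]
    exact isIntegral_algebraMap⟩
  let E : Subalgebra k F := fstΓ.range
  have : IsField E := Subalgebra.isField_of_algebraic E
  let := this.toField
  let φ : Γ →+* E := fstΓ.rangeRestrict.toRingHom
  have hφ : Function.Injective φ := by
    rw [injective_iff_map_eq_zero]
    intro g h
    exact Subtype.ext (hΓ g g.2 congr(($h : F)))
  obtain ⟨a, ha⟩ := hF y.fst
  have hyp : y ^ p = algebraMap k _ a := by
    rw [pow_charP_eq_inl, ← ha]
    rfl
  -- the minimal polynomial of `x = fst y` over `E`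
  have hmin : minpoly E y.fst = X ^ p - C (algebraMap k E a) := by
    refine (minpoly.eq_of_irreducible_of_monic ?_ ?_ (monic_X_pow_sub_C _
      (Fact.out (p := p.Prime)).ne_zero)).symm
    · refine X_pow_sub_C_irreducible_of_prime Fact.out fun b hb ↦ ?_
      obtain ⟨g, hg⟩ := b.2
      refine hy g g.2 (frobenius_inj F p ?_)
      have := congr(($hb : F))
      change (b : F) ^ p = algebraMap k F a at this
      rw [← hg, ha] at this
      exact this
    · have : algebraMap E F (algebraMap k E a) = y.fst ^ p := ha
      simp [this]
  obtain ⟨q, rfl⟩ := (Algebra.adjoin_singleton_eq_range_aeval Γ y).le hz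
  let f : Γ[X] := X ^ p - C (algebraMap k Γ a)
  have hf : f.Monic := monic_X_pow_sub_C _ (Fact.out (p := p.Prime)).ne_zero
  have hfy : aeval y f = 0 := by
    have : algebraMap Γ (TrivSqZeroExt F F) (algebraMap k Γ a) = y ^ p := hyp.symm
    simp [f, this]
  have hr (r : Γ[X]) : aeval y.fst (r.map φ) = (aeval y r).fst := by
    rw [aeval_def, eval₂_map, aeval_def]
    exact (hom_eval₂ r _ (TrivSqZeroExt.fstHom k F F).toRingHom y).symm
  have hq : aeval y q = aeval y (q %ₘ f) := (aeval_modByMonic_eq_self_of_root hfy).symm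
  have hfφ : f.map φ = minpoly E y.fst := by
    rw [hmin]
    simp only [f, Polynomial.map_sub, Polynomial.map_pow, map_X, map_C]
    rfl
  -- this remainder has smaller degree than the minimal polynomial, and `x` is a root of it
  have h0 : (q %ₘ f).map φ = 0 := by
    by_contra hne
    refine (minpoly.degree_le_of_ne_zero E y.fst hne ?_).not_gt ?_
    · rw [hr, ← hq]
      exact hz0
    · rw [map_modByMonic _ hf, hfφ]
      exact degree_modByMonic_lt _ (hfφ ▸ hf.map φ)
  change aeval y q = 0
  rw [hq, (Polynomial.map_injective φ hφ) (h0.trans (Polynomial.map_zero φ).symm), map_zero]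

/-- Let `F` be a purely inseparable extension of exponent one of `k`. A derivation into `F` that is
defined on a subfield of `F` containing `k` and vanishes on `k`, given by its graph `Γ ⊆ F[ε]`,
extends to `F`. -/
lemma exists_section_trivSqZeroExt (hF : ∀ x : F, ∃ a : k, algebraMap k F a = x ^ p)
    (Γ : Subalgebra k (TrivSqZeroExt F F)) (hΓ : ∀ g ∈ Γ, g.fst = 0 → g = 0) :
    ∃ s : F →ₐ[k] TrivSqZeroExt F F, (∀ x, (s x).fst = x) ∧ ∀ g ∈ Γ, s g.fst = g := by
  obtain ⟨M, hΓM, hM⟩ := zorn_le_nonempty₀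
    {Δ : Subalgebra k (TrivSqZeroExt F F) | ∀ g ∈ Δ, g.fst = 0 → g = 0}
    (fun c hc hchain Δ hΔ ↦ ⟨sSup c, fun g hg ↦ by
        have : Nonempty c := ⟨⟨Δ, hΔ⟩⟩
        rw [← SetLike.mem_coe, sSup_eq_iSup',
          Subalgebra.coe_iSup_of_directed hchain.directedOn.directed_val] at hg
        obtain ⟨E, hgE⟩ := Set.mem_iUnion.1 hg
        exact hc E.2 g hgE, fun E hE ↦ le_sSup hE⟩) Γ hΓ
  have hsurj (x : F) : ∃ g ∈ M, g.fst = x := by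
    by_contra! hx
    obtain ⟨N, hMN, hxN, hN⟩ := exists_extend_graph p hF M hM.prop (TrivSqZeroExt.inl x) hx
    exact hx _ (hM.le_of_ge (y := N) hN hMN hxN) (TrivSqZeroExt.fst_inl F x)
  let e : M ≃ₐ[k] F := AlgEquiv.ofBijective ((TrivSqZeroExt.fstHom k F F).comp M.val)
    ⟨(injective_iff_map_eq_zero _).2 fun g h ↦ Subtype.ext (hM.prop g g.2 h),
      fun x ↦ (hsurj x).elim fun g hg ↦ ⟨⟨g, hg.1⟩, hg.2⟩⟩
  exact ⟨M.val.comp e.symm.toAlgHom, e.apply_symm_apply,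
    fun g hg ↦ congr(($(e.symm_apply_apply ⟨g, hΓM hg⟩) : TrivSqZeroExt F F))⟩

lemma exists_derivation_eq_one (hF : ∀ x : F, ∃ a : k, algebraMap k F a = x ^ p) (x : F)
    (hx : x ∉ (algebraMap k F).range) : ∃ d : Derivation k F F, d x = 1 := by
  obtain ⟨y, hy₁, hy₂⟩ : ∃ y : TrivSqZeroExt F F, y.fst = x ∧ y.snd = 1 := ⟨(x, 1), rfl, rfl⟩
  -- the graph of the zero derivation of `k`, to be extended with the value `1` at `x`
  let Δ : Subalgebra k (TrivSqZeroExt F F) := ⊥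
  have hΔ (g : TrivSqZeroExt F F) (hg : g ∈ Δ) :
      ∃ b : k, TrivSqZeroExt.inl (algebraMap k F b) = g := hg
  obtain ⟨Γ, -, hyΓ, hΓ⟩ := exists_extend_graph p hF Δ (fun g hg h0 ↦ by
      obtain ⟨b, rfl⟩ := hΔ g hg
      rw [TrivSqZeroExt.fst_inl] at h0
      rw [h0, TrivSqZeroExt.inl_zero]) y (fun g hg h0 ↦ by
      obtain ⟨b, rfl⟩ := hΔ g hg
      rw [TrivSqZeroExt.fst_inl, hy₁] at h0
      exact hx ⟨b, h0⟩)
  obtain ⟨s, hs, hsy⟩ := exists_section_trivSqZeroExt p hF Γ hΓ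
  let d : Derivation k F F :=
    { toFun := fun z ↦ (s z).snd
      map_add' := by simp
      map_smul' := by simp
      map_one_eq_zero' := by simp
      leibniz' := fun a b ↦ by simp [hs, _root_.mul_comm] }
  refine ⟨d, ?_⟩
  change (s x).snd = 1
  rw [← hy₁, hsy y hyΓ, hy₂]

/-- In a purely inseparable extension of exponent one, the elements with zero differential are those
of the base field. -/
lemma mem_range_of_kaehlerDifferential_eq_zero
    (hF : ∀ x : F, ∃ a : k, algebraMap k F a = x ^ p) (x : F)
    (hx : KaehlerDifferential.D k F x = 0) : x ∈ (algebraMap k F).range := by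
  by_contra h
  obtain ⟨d, hd⟩ := exists_derivation_eq_one p hF x h
  have h2 : d.liftKaehlerDifferential (KaehlerDifferential.D k F x) = d x :=
    d.liftKaehlerDifferential_comp_D x
  rw [hx, map_zero, hd] at h2
  exact zero_ne_one h2

/-- Rings such as `FrobTwist K p` come with a ring structure and a proof of `IsField`. Eliminating
this equality turns the given ring structure into that of a field. -/
lemma exists_field_toCommRing_eq {R : Type*} [hR : CommRing R] (h : IsField R) :
    ∃ f : Field R, f.toCommRing = hR :=
  ⟨h.toField, rfl⟩

lemma algebraMap_injective_of_isField {R : Type*} [CommRing R] (h : IsField R) (S : Type*)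
    [CommRing S] [Nontrivial S] [Algebra R S] : Function.Injective (algebraMap R S) := by
  obtain ⟨_, rfl⟩ := exists_field_toCommRing_eq h
  exact (algebraMap R S).injective

lemma mem_range_of_kaehlerDifferential_eq_zero_of_isField {k F : Type*} [hk : CommRing k]
    [hF : CommRing F] [Algebra k F] (hk' : IsField k) (hF' : IsField F) [CharP F p]
    (h : ∀ x : F, ∃ a : k, algebraMap k F a = x ^ p) (x : F)
    (hx : KaehlerDifferential.D k F x = 0) : x ∈ (algebraMap k F).range := by
  obtain ⟨_, rfl⟩ := exists_field_toCommRing_eq hk'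
  obtain ⟨_, rfl⟩ := exists_field_toCommRing_eq hF'
  exact mem_range_of_kaehlerDifferential_eq_zero p h x hx

end Inseparable

/-! ### Tangent vectors at the neutral section -/

section DiffAt

variable {K A : Type u} [CommRing K] [CommRing A] [Algebra K A] (ε : A →ₐ[K] K)

lemma DiffAt.d_mul (f g : A) :
    DiffAt.d ε (f * g) = ε f • DiffAt.d ε g + ε g • DiffAt.d ε f := by
  let := ε.toRingHom.toAlgebra
  change (1 : K) ⊗ₜ[A] KaehlerDifferential.D K A (f * g) =
    ε f • ((1 : K) ⊗ₜ[A] KaehlerDifferential.D K A g) +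
      ε g • ((1 : K) ⊗ₜ[A] KaehlerDifferential.D K A f)
  have h (a : A) (w : Ω[A⁄K]) : (1 : K) ⊗ₜ[A] (a • w) = ε a • ((1 : K) ⊗ₜ[A] w) := by
    rw [← TensorProduct.smul_tmul, TensorProduct.smul_tmul']
    rfl
  rw [Derivation.leibniz, TensorProduct.tmul_add, h, h]

lemma DiffAt.d_one : DiffAt.d ε 1 = 0 := by
  simpa using DiffAt.d_mul ε 1 1

lemma DiffAt.span_range_d : Submodule.span K (Set.range (DiffAt.d ε)) = ⊤ := by
  let := ε.toRingHom.toAlgebra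
  have h (a : A) (w : Ω[A⁄K]) (k : K) : k ⊗ₜ[A] (a • w) = (ε a * k) • ((1 : K) ⊗ₜ[A] w) := by
    rw [← TensorProduct.smul_tmul, TensorProduct.smul_tmul', smul_eq_mul, _root_.mul_one]
    rfl
  rw [eq_top_iff]
  rintro (z : K ⊗[A] Ω[A⁄K]) -
  induction z with
  | zero => exact Submodule.zero_mem _
  | add x y hx hy => exact Submodule.add_mem _ hx hy
  | tmul k w =>
    have hw : w ∈ Submodule.span A (Set.range (KaehlerDifferential.D K A)) := by
      rw [KaehlerDifferential.span_range_derivation]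
      trivial
    induction hw using Submodule.span_induction generalizing k with
    | mem w hw =>
      obtain ⟨f, rfl⟩ := hw
      have := h 1 (KaehlerDifferential.D K A f) k
      rw [one_smul] at this
      rw [this]
      exact Submodule.smul_mem _ _ (Submodule.subset_span ⟨f, rfl⟩)
    | zero => rw [TensorProduct.tmul_zero]; exact Submodule.zero_mem _
    | add x y _ _ hx hy => rw [TensorProduct.tmul_add]; exact Submodule.add_mem _ (hx k) (hy k)
    | smul a x _ hx =>
      rw [h]
      exact Submodule.smul_mem _ _ (hx 1)

variable {M : Type*} [AddCommGroup M] [Module K M]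

lemma DiffAt.hom_ext {φ ψ : DiffAt ε →ₗ[K] M} (h : ∀ f, φ (DiffAt.d ε f) = ψ (DiffAt.d ε f)) :
    φ = ψ :=
  LinearMap.ext_on (DiffAt.span_range_d ε) (by rintro _ ⟨f, rfl⟩; exact h f)

/-- The existence part of the universal property of `ε^* Ω_{A/K}`: it represents the derivations
into `K`-modules, on which `A` acts through `ε`. -/
lemma DiffAt.exists_lift (D : A →ₗ[K] M) (hD : ∀ f g, D (f * g) = ε f • D g + ε g • D f) :
    ∃ φ : DiffAt ε →ₗ[K] M, ∀ f, φ (DiffAt.d ε f) = D f := by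
  let := ε.toRingHom.toAlgebra
  let : Module A M := Module.compHom M ε.toRingHom
  have : IsScalarTower A K M := ⟨fun a k m ↦ mul_smul (ε a) k m⟩
  have : IsScalarTower K A M := ⟨fun k a m ↦ by
    change ε (k • a) • m = k • ε a • m
    rw [map_smul, smul_assoc]⟩
  let D' : Derivation K A M :=
    { toLinearMap := D
      map_one_eq_zero' := by
        have := hD 1 1
        simpa using this
      leibniz' := hD }
  refine ⟨LinearMap.liftBaseChange K D'.liftKaehlerDifferential, fun f ↦ ?_⟩
  refine (LinearMap.liftBaseChange_tmul _ _ _ _).trans ?_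
  exact (one_smul K _).trans (D'.liftKaehlerDifferential_comp_D f)

end DiffAt

section Tangent

variable {K : CommRingCat.{u}} {G G' : Grp (Over (Spec K))}
variable {R M N : Type u} [CommRing R] [Algebra K R]
  [AddCommGroup M] [Module K M] [Module R M] [Module Rᵐᵒᵖ M] [IsCentralScalar R M]
  [IsScalarTower K R M]
  [AddCommGroup N] [Module K N] [Module R N] [Module Rᵐᵒᵖ N] [IsCentralScalar R N]
  [IsScalarTower K R N]

instance : IsScalarTower K Rᵐᵒᵖ M :=
  ⟨fun k r m ↦ by rw [← MulOpposite.op_unop r]; simp⟩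

lemma Fn.eval_one (f : Fn G.X) : Fn.eval (1 : specAlg K R ⟶ G.X) f =
    algebraMap K R (Fn.counit G f) := by
  have h : (1 : specAlg K R ⟶ G.X) = specMap (Algebra.ofId K R) ≫ 1 := (comp_one _).symm
  rw [h, Fn.eval_specMap]
  rfl

/-- The points of a group scheme `G` with values in `R ⊕ M`, where `M` has square zero, that reduce
to the neutral section modulo `M`, correspond to the linear maps from `ω_G` to `M`. The relation
says that the point `x` corresponds to the linear map `δ`. -/
def IsTangent (x : specAlg K (TrivSqZeroExt R M) ⟶ G.X) (δ : CoLie G →ₗ[K] M) : Prop :=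
  ∀ f, Fn.eval x f = TrivSqZeroExt.inl (algebraMap K R (Fn.counit G f)) +
    TrivSqZeroExt.inr (δ (DiffAt.d _ f))

lemma IsTangent.right_unique {x : specAlg K (TrivSqZeroExt R M) ⟶ G.X} {δ δ' : CoLie G →ₗ[K] M}
    (h : IsTangent x δ) (h' : IsTangent x δ') : δ = δ' :=
  DiffAt.hom_ext _ fun f ↦ by simpa using congr(($((h f).symm.trans (h' f))).snd)

lemma IsTangent.left_unique [IsAffine G.X.left] {x x' : specAlg K (TrivSqZeroExt R M) ⟶ G.X}
    {δ : CoLie G →ₗ[K] M} (h : IsTangent x δ) (h' : IsTangent x' δ) : x = x' :=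
  Fn.eval_injective (AlgHom.ext fun f ↦ (h f).trans (h' f).symm)

lemma IsTangent.comp {x : specAlg K (TrivSqZeroExt R M) ⟶ G.X} {δ : CoLie G →ₗ[K] M}
    (h : IsTangent x δ) (a : G ⟶ G') : IsTangent (x ≫ a.hom.hom) (δ ∘ₗ CoLie.pull a) := fun f ↦ by
  rw [← Fn.eval_comp, AlgHom.comp_apply, h, ← DFunLike.congr_fun (Fn.counit_comp a) f]
  simp only [LinearMap.comp_apply, CoLie.pull, DiffAt.map_d, AlgHom.comp_apply]

lemma IsTangent.specMap_map {x : specAlg K (TrivSqZeroExt R M) ⟶ G.X} {δ : CoLie G →ₗ[K] M}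
    (h : IsTangent x δ) (l : M →ₗ[R] N) :
    IsTangent (specMap ((TrivSqZeroExt.map l).restrictScalars K) ≫ x) (l.restrictScalars K ∘ₗ δ) :=
  fun f ↦ by
    rw [Fn.eval_specMap, AlgHom.comp_apply, h]
    simp

lemma isTangent_one : IsTangent (1 : specAlg K (TrivSqZeroExt R M) ⟶ G.X) 0 := fun f ↦ by
  rw [Fn.eval_one]
  simp [TrivSqZeroExt.algebraMap_eq_inl']

lemma exists_isTangent [IsAffine G.X.left] (δ : CoLie G →ₗ[K] M) :
    ∃ x : specAlg K (TrivSqZeroExt R M) ⟶ G.X, IsTangent x δ := by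
  obtain ⟨x, hx⟩ := Fn.eval_surjective (X := G.X) (L := TrivSqZeroExt R M)
    { toFun := fun f ↦ TrivSqZeroExt.inl (algebraMap K R (Fn.counit G f)) +
        TrivSqZeroExt.inr (δ (DiffAt.d _ f))
      map_one' := by
        simp [DiffAt.d_one]
      map_mul' := fun f g ↦ by
        ext <;> simp [DiffAt.d_mul]
      map_zero' := by simp
      map_add' := fun f g ↦ by ext <;> simp
      commutes' := fun k ↦ by
        simp [Algebra.algebraMap_eq_smul_one, DiffAt.d_one] }
  exact ⟨x, fun f ↦ DFunLike.congr_fun hx f⟩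

lemma exists_isTangent_of_specMap_fstHom (x : specAlg K (TrivSqZeroExt R M) ⟶ G.X)
    (hx : specMap (TrivSqZeroExt.fstHom K R M) ≫ x = 1) :
    ∃ δ : CoLie G →ₗ[K] M, IsTangent x δ := by
  have hfst (f) : (Fn.eval x f).fst = algebraMap K R (Fn.counit G f) := by
    rw [← Fn.eval_one, ← hx, Fn.eval_specMap]
    rfl
  obtain ⟨δ, hδ⟩ := DiffAt.exists_lift (Fn.counit G) (M := M)
    { toFun := fun f ↦ (Fn.eval x f).snd
      map_add' := by simp
      map_smul' := by simp }
    (fun f g ↦ by simp [hfst])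
  refine ⟨δ, fun f ↦ ?_⟩
  rw [hδ]
  ext
  · simp [hfst]
  · simp

lemma IsTangent.specMap_fstHom [IsAffine G.X.left] {x : specAlg K (TrivSqZeroExt R M) ⟶ G.X}
    {δ : CoLie G →ₗ[K] M} (h : IsTangent x δ) : specMap (TrivSqZeroExt.fstHom K R M) ≫ x = 1 :=
  Fn.eval_injective (AlgHom.ext fun f ↦ by
    rw [Fn.eval_specMap, Fn.eval_one, AlgHom.comp_apply, h]
    simp)

/-- The product of tangent vectors is their sum. Both are tangent vectors with values in `M × M`
that have the given projections. -/
lemma IsTangent.mul [IsAffine G.X.left] {x y : specAlg K (TrivSqZeroExt R M) ⟶ G.X}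
    {δ δ' : CoLie G →ₗ[K] M} (hx : IsTangent x δ) (hy : IsTangent y δ') :
    IsTangent (x * y) (δ + δ') := by
  have hx' := hx.specMap_map (LinearMap.inl R M M)
  have hy' := hy.specMap_map (LinearMap.inr R M M)
  obtain ⟨ρ, hρ⟩ := exists_isTangent_of_specMap_fstHom
    (specMap ((TrivSqZeroExt.map (LinearMap.inl R M M)).restrictScalars K) ≫ x *
      specMap ((TrivSqZeroExt.map (LinearMap.inr R M M)).restrictScalars K) ≫ y)
    (by rw [comp_mul, hx'.specMap_fstHom, hy'.specMap_fstHom, _root_.mul_one])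
  -- `l` is applied to the tangent vector `ρ` for the two projections and for the sum
  have key (l : M × M →ₗ[R] M) {x' y' : specAlg K (TrivSqZeroExt R M) ⟶ G.X}
      {δ₁ δ₂ : CoLie G →ₗ[K] M} (h₁ : IsTangent x' δ₁) (h₂ : IsTangent y' δ₂)
      (e₁ : l.restrictScalars K ∘ₗ (LinearMap.inl R M M).restrictScalars K ∘ₗ δ = δ₁)
      (e₂ : l.restrictScalars K ∘ₗ (LinearMap.inr R M M).restrictScalars K ∘ₗ δ' = δ₂) :
      IsTangent (x' * y') (l.restrictScalars K ∘ₗ ρ) := by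
    have := hρ.specMap_map l
    rw [comp_mul] at this
    have h₁' := hx'.specMap_map l
    have h₂' := hy'.specMap_map l
    rw [e₁] at h₁'
    rw [e₂] at h₂'
    rwa [h₁'.left_unique h₁, h₂'.left_unique h₂] at this
  have h₁ : (LinearMap.fst R M M).restrictScalars K ∘ₗ ρ = δ := by
    have := key (LinearMap.fst R M M) hx isTangent_one rfl (by ext; simp)
    rw [_root_.mul_one] at this
    exact this.right_unique hx
  have h₂ : (LinearMap.snd R M M).restrictScalars K ∘ₗ ρ = δ' := by
    have := key (LinearMap.snd R M M) isTangent_one hy (by ext; simp) rfl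
    rw [_root_.one_mul] at this
    exact this.right_unique hy
  convert key (LinearMap.fst R M M + LinearMap.snd R M M) hx hy (by ext; simp) (by ext; simp)
  rw [← h₁, ← h₂]
  rfl

end Tangent

/-! ### The map `Φ` -/

section PhiMap

variable {K : CommRingCat.{u}} (p : ℕ) [Fact p.Prime] [CharP K p]

/-- The right action of `K^{[1]}` on `Ω_{F_K}` that is equal to the left action. -/
instance : Module (FrobTwist K p)ᵐᵒᵖ Ω[FrobTwist K p⁄K] :=
  Module.compHom _ ((RingHom.id (FrobTwist K p)).fromOpposite fun _ _ ↦ _root_.mul_comm _ _)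

instance : IsCentralScalar (FrobTwist K p) Ω[FrobTwist K p⁄K] := ⟨fun _ _ ↦ rfl⟩

/-- The ring of functions `K^{[1]} ⊕ Ω_{F_K}` on the first infinitesimal neighbourhood of the
diagonal of `F_K`. -/
abbrev FirstOrder (K : CommRingCat.{u}) (p : ℕ) [Fact p.Prime] [CharP K p] : Type u :=
  TrivSqZeroExt (FrobTwist K p) Ω[FrobTwist K p⁄K]

/-- The first projection of the first infinitesimal neighbourhood of the diagonal,
`x ↦ x + dx` on functions. -/
def taylorHom (K : CommRingCat.{u}) (p : ℕ) [Fact p.Prime] [CharP K p] :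
    FrobTwist K p →ₐ[K] FirstOrder K p where
  toFun x := TrivSqZeroExt.inl x + TrivSqZeroExt.inr (KaehlerDifferential.D K (FrobTwist K p) x)
  map_one' := by simp
  map_mul' x y := by ext <;> simp
  map_zero' := by simp
  map_add' x y := by ext <;> simp
  commutes' k := by simp [TrivSqZeroExt.algebraMap_eq_inl']

@[simp]
lemma taylorHom_apply (x : FrobTwist K p) : taylorHom K p x =
    TrivSqZeroExt.inl x + TrivSqZeroExt.inr (KaehlerDifferential.D K (FrobTwist K p) x) := rfl

/-- The second projection of the first infinitesimal neighbourhood of the diagonal. -/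
abbrev constHom (K : CommRingCat.{u}) (p : ℕ) [Fact p.Prime] [CharP K p] :
    FrobTwist K p →ₐ[K] FirstOrder K p :=
  TrivSqZeroExt.inlAlgHom K _ _

variable {G G' : Grp (Over (Spec K))}

/-- The restriction of a cocycle to the first infinitesimal neighbourhood of the diagonal. -/
def firstOrderPoint (h : HasUniqueSections (frobPt (K := K) p) G) (c : H1 G) :
    specAlg K (FirstOrder K p) ⟶ G.X :=
  lift (specMap (taylorHom K p)) (specMap (constHom K p)) ≫ h.cocycle c

/-- A cocycle is trivial on the diagonal. -/
lemma specMap_fstHom_firstOrderPoint (h : HasUniqueSections (frobPt (K := K) p) G) (c : H1 G) :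
    specMap (TrivSqZeroExt.fstHom K _ _) ≫ firstOrderPoint p h c = 1 := by
  have h₁ : specMap (TrivSqZeroExt.fstHom K _ _) ≫ specMap (taylorHom K p) = 𝟙 _ := by
    rw [← specMap_comp, ← specMap_id]
    congr 1
    ext x
    simp
  have h₂ : specMap (TrivSqZeroExt.fstHom K _ _) ≫ specMap (constHom K p) = 𝟙 _ := by
    rw [← specMap_comp, ← specMap_id]
    congr 1
  rw [firstOrderPoint, comp_lift_assoc, h₁, h₂]
  exact mul_eq_left.1 (h.cocycle_mul c (𝟙 _) (𝟙 _) (𝟙 _))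

lemma exists_isTangent_firstOrderPoint (h : HasUniqueSections (frobPt (K := K) p) G) (c : H1 G) :
    ∃ δ : CoLie G →ₗ[K] Ω[FrobTwist K p⁄K], IsTangent (firstOrderPoint p h c) δ :=
  exists_isTangent_of_specMap_fstHom _ (specMap_fstHom_firstOrderPoint p h c)

/-- The tangent vector given by the cocycle of a class. -/
def tangentOf (h : HasUniqueSections (frobPt (K := K) p) G) (c : H1 G) :
    CoLie G →ₗ[K] Ω[FrobTwist K p⁄K] :=
  (exists_isTangent_firstOrderPoint p h c).choose

lemma isTangent_tangentOf (h : HasUniqueSections (frobPt (K := K) p) G) (c : H1 G) :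
    IsTangent (firstOrderPoint p h c) (tangentOf p h c) :=
  (exists_isTangent_firstOrderPoint p h c).choose_spec

/-- The map `Φ`: the `K^{[1]}`-linear extension to `F_K^* ω_G` of the tangent vector given by the
cocycle. -/
def phi (h : HasUniqueSections (frobPt (K := K) p) G) (c : H1 G) : FrobHom p G :=
  LinearMap.liftBaseChange (FrobTwist K p) (tangentOf p h c)

lemma phi_tmul (h : HasUniqueSections (frobPt (K := K) p) G) (c : H1 G) (x : FrobTwist K p)
    (w : CoLie G) : phi p h c (x ⊗ₜ w) = x • tangentOf p h c w :=
  LinearMap.liftBaseChange_tmul _ _ _ _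

lemma firstOrderPoint_smul (h : HasUniqueSections (frobPt (K := K) p) G) (P : Torsor G)
    (σ : frobPt p ⟶ P.X) :
    P.smul (firstOrderPoint p h (H1.mk P)) (specMap (constHom K p) ≫ σ) =
      specMap (taylorHom K p) ≫ σ := by
  rw [h.eq_sec σ, firstOrderPoint, h.cocycle_mk, Torsor.lift_cocycle, Torsor.diff_smul]

lemma Fn.eval_twist {X : Over (Spec K)} {L : Type u} [CommRing L] [Algebra K L]
    (x : specAlg K L ⟶ X) (l : FrobTwist K p →ₐ[K] L) (c : FrobTwist K p) (f : Fn X) :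
    Fn.eval (lift x (specMap l)) (Fn.twist p X (c ⊗ₜ f)) = l c * Fn.eval x f := by
  rw [Fn.twist, Algebra.TensorProduct.lift_tmul, map_mul]
  congr 1
  · rw [AlgHom.comp_apply, ← AlgHom.comp_apply, Fn.eval_comp, lift_snd, Fn.eval_specMap_self]
    simp
  · rw [← AlgHom.comp_apply, Fn.eval_comp, lift_fst]

/-- The linear map `Φ(P)` is computed by means of any point `σ` of the torsor `P` above Frobenius:
on the first infinitesimal neighbourhood of the diagonal of `F_K`, the two pull-backs of `σ` differ
by the tangent vector that defines `Φ(P)`. -/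
lemma phi_twist (h : HasUniqueSections (frobPt (K := K) p) G) (P : Torsor G)
    (σ : frobPt p ⟶ P.X) (f : Fn P.X) (z : FrobTwist K p ⊗[K] Fn G.X)
    (hz : Fn.twist p G.X z = Fn.pull (P.orbit p σ) f) :
    phi p h (H1.mk P) ((DiffAt.d (Fn.counit G)).baseChange (FrobTwist K p) z) =
      KaehlerDifferential.D K (FrobTwist K p) (Fn.eval σ f) := by
  let y := firstOrderPoint p h (H1.mk P)
  have hy : IsTangent y (tangentOf p h (H1.mk P)) := isTangent_tangentOf p h _
  have h₁ : Fn.eval (lift y (specMap (constHom K p))) (Fn.pull (P.orbit p σ) f) =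
      taylorHom K p (Fn.eval σ f) := by
    rw [← AlgHom.comp_apply, Fn.eval_comp, Torsor.orbit, Torsor.lift_comp_smul, lift_fst,
      lift_snd_assoc, firstOrderPoint_smul, Fn.eval_specMap, AlgHom.comp_apply]
  have h₂ (z) : (Fn.eval (lift y (specMap (constHom K p))) (Fn.twist p G.X z)).snd =
      phi p h (H1.mk P) ((DiffAt.d (Fn.counit G)).baseChange (FrobTwist K p) z) := by
    induction z with
    | zero => simp
    | add x y hx hy => simp [hx, hy]
    | tmul c g =>
      rw [Fn.eval_twist, hy]
      simp [phi_tmul]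
  rw [← h₂, hz, h₁]
  simp

/-- The module `F_K^* ω_G` is generated by differentials of functions on `F_K^* G`. -/
lemma FrobHom.ext_twist {φ ψ : FrobHom p G}
    (h : ∀ z, φ ((DiffAt.d (Fn.counit G)).baseChange (FrobTwist K p) z) =
      ψ ((DiffAt.d (Fn.counit G)).baseChange (FrobTwist K p) z)) : φ = ψ := by
  refine TensorProduct.AlgebraTensorModule.curry_injective (LinearMap.ext_ring ?_)
  refine DiffAt.hom_ext _ fun f ↦ ?_
  simpa using h (1 ⊗ₜ f)

/-- As `F_K^* G ≅ F_K^* P` by the orbit map of `σ`, the functions on `F_K^* G` are linear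
combinations of functions induced from `P`. -/
lemma twist_mem_span_orbit [IsAffine G.X.left] (P : Torsor G) [IsAffine P.X.left]
    (σ : frobPt p ⟶ P.X) (z : FrobTwist K p ⊗[K] Fn G.X) :
    z ∈ Submodule.span (FrobTwist K p)
      {w | ∃ f : Fn P.X, Fn.twist p G.X w = Fn.pull (P.orbit p σ) f} := by
  have := P.isIso_shear
  let e : G.X ⊗ frobPt p ⟶ P.X ⊗ frobPt p := lift (P.orbit p σ) (snd _ _)
  let e' : P.X ⊗ frobPt p ⟶ G.X ⊗ frobPt p :=
    lift (P.diff (fst _ _) (snd _ _ ≫ σ)) (snd _ _)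
  have he : e ≫ e' = 𝟙 _ := by
    ext1
    · simp only [e, e', Category.assoc, lift_fst, Category.id_comp, Torsor.comp_diff,
        lift_snd_assoc]
      exact P.diff_eq rfl
    · simp [e, e']
  obtain ⟨w, hw⟩ := (Fn.twist_bijective p P.X).2 (Fn.pull e' (Fn.twist p G.X z))
  obtain ⟨t, ht⟩ : ∃ t : FrobTwist K p ⊗[K] Fn P.X →ₗ[FrobTwist K p] FrobTwist K p ⊗[K] Fn G.X,
      ∀ w, Fn.twist p G.X (t w) = Fn.pull e (Fn.twist p P.X w) := by
    let E := AlgEquiv.ofBijective _ (Fn.twist_bijective p G.X)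
    have hE (w) : Fn.twist p G.X (E.symm (Fn.pull e (Fn.twist p P.X w))) =
      Fn.pull e (Fn.twist p P.X w) := E.apply_symm_apply _
    have hc (c : FrobTwist K p) : E.symm (Fn.pull e (Fn.twist p P.X (c ⊗ₜ 1))) = c ⊗ₜ 1 := by
      rw [E.symm_apply_eq]
      change _ = Fn.twist p G.X (c ⊗ₜ 1)
      rw [Fn.twist_tmul_one, Fn.twist_tmul_one, ← AlgHom.comp_apply, ← Fn.pull_comp, lift_snd]
    refine ⟨{ toFun := fun w ↦ E.symm (Fn.pull e (Fn.twist p P.X w))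
              map_add' := by simp
              map_smul' := fun c w ↦ ?_ }, hE⟩
    rw [RingHom.id_apply, Algebra.smul_def, Algebra.smul_def, map_mul, map_mul, map_mul]
    exact congr($(hc c) * _)
  have hz : z = t w := (Fn.twist_bijective p G.X).1 (by
    rw [ht, hw, ← AlgHom.comp_apply, ← Fn.pull_comp, he, Fn.pull_id, AlgHom.id_apply])
  rw [hz]
  clear hw hz
  induction w with
  | zero => rw [map_zero]; exact Submodule.zero_mem _
  | add x y hx hy => rw [map_add]; exact Submodule.add_mem _ hx hy
  | tmul c f =>
    have hcf : c ⊗ₜ[K] f = c • ((1 : FrobTwist K p) ⊗ₜ[K] f) := by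
      rw [TensorProduct.smul_tmul', smul_eq_mul, _root_.mul_one]
    rw [hcf, map_smul]
    refine Submodule.smul_mem _ _ (Submodule.subset_span ⟨f, ?_⟩)
    rw [ht, Fn.twist_one_tmul, ← AlgHom.comp_apply, ← Fn.pull_comp, lift_fst]

/-- The map `phi` satisfies the definition of `Φ`, which determines it. -/
lemma isPhi_phi [IsAffine G.X.left] (hP : ∀ P : Torsor G, IsAffine P.X.left)
    (h : HasUniqueSections (frobPt (K := K) p) G) : H1.IsPhi p (phi p h) := by
  refine fun P φ ↦ ⟨?_, fun ⟨σ, hσ⟩ ↦ ?_⟩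
  · rintro rfl
    exact ⟨h.sec P, fun f z hz ↦ phi_twist p h P _ f z hz⟩
  · have := hP P
    refine FrobHom.ext_twist p fun z ↦ ?_
    induction twist_mem_span_orbit p P σ z using Submodule.span_induction with
    | mem w hw =>
      obtain ⟨f, hf⟩ := hw
      rw [phi_twist p h P σ f w hf, hσ f w hf]
    | zero => simp
    | add x y _ _ hx hy => simp only [map_add, hx, hy]
    | smul c x _ hx => simp only [map_smul, hx]

section

variable [Flat (frobPt (K := K) p).hom] [Surjective (frobPt (K := K) p).hom]
  [QuasiCompact (frobPt (K := K) p).hom]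

lemma phi_add [IsAffine G.X.left] [IsCommMonObj G.X]
    (h : HasUniqueSections (frobPt (K := K) p) G) (c d : H1 G) :
    phi p h (h.addCommGroup.add c d) = phi p h c + phi p h d := by
  have h₁ : firstOrderPoint p h (h.addCommGroup.add c d) =
      firstOrderPoint p h c * firstOrderPoint p h d := by
    simp only [firstOrderPoint, h.cocycle_add, comp_mul]
  have h₂ := (isTangent_tangentOf p h c).mul (isTangent_tangentOf p h d)
  rw [← h₁] at h₂
  rw [phi, (isTangent_tangentOf p h _).right_unique h₂]
  exact TensorProduct.AlgebraTensorModule.curry_injective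
    (LinearMap.ext_ring (by ext; simp [phi_tmul]))

/-- The map `Φ`, as a homomorphism of groups. -/
def phiHom [IsAffine G.X.left] [IsCommMonObj G.X] (h : HasUniqueSections (frobPt (K := K) p) G) :
    letI := h.addCommGroup
    H1 G →+ FrobHom p G :=
  letI := h.addCommGroup
  AddMonoidHom.mk' (phi p h) (phi_add p h)

lemma phi_map (h : HasUniqueSections (frobPt (K := K) p) G)
    (h' : HasUniqueSections (frobPt (K := K) p) G') [IsCommMonObj G.X] [IsCommMonObj G'.X]
    (a : G ⟶ G') (c : H1 G) : letI := h.addCommGroup; letI := h'.addCommGroup;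
    phi p h' (h.map h' a c) = FrobHom.push p a (phi p h c) := by
  have h₂ := (isTangent_tangentOf p h c).comp a
  have h₁ : firstOrderPoint p h c ≫ a.hom.hom = firstOrderPoint p h' (h.map h' a c) := by
    simp only [firstOrderPoint, h.cocycle_map, Category.assoc]
  rw [h₁] at h₂
  rw [phi, (isTangent_tangentOf p h' _).right_unique h₂]
  refine TensorProduct.AlgebraTensorModule.curry_injective (LinearMap.ext_ring ?_)
  ext w
  simp [FrobHom.push, phi_tmul]

end

/-- The extension `K^{[1]}` of `K` has exponent one. -/
lemma exists_pow_eq (x : FrobTwist K p) : ∃ a : K, algebraMap K (FrobTwist K p) a = x ^ p :=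
  ⟨x, rfl⟩

/-- `Φ` is injective: if `Φ(P) = 0`, the values at `σ` of the functions on `P` have zero
differential, so that they lie in `K`. Hence `σ` comes from a point of `P` over `K`. -/
lemma cocycle_eq_one_of_phi_eq_zero (hK : IsField K) [IsAffine G.X.left]
    (hP : ∀ P : Torsor G, IsAffine P.X.left)
    (h : HasUniqueSections (frobPt (K := K) p) G) (c : H1 G) (hc : phi p h c = 0) :
    h.cocycle c = 1 := by
  obtain ⟨P, rfl⟩ : ∃ P, H1.mk P = c := Quotient.exists_rep c
  have := hP P
  let σ := h.sec P
  have h0 : tangentOf p h (H1.mk P) = 0 := by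
    ext w
    have := phi_tmul p h (H1.mk P) 1 w
    simpa [hc] using this.symm
  have h1 : firstOrderPoint p h (H1.mk P) = 1 := by
    have := isTangent_tangentOf p h (H1.mk P)
    rw [h0] at this
    exact this.left_unique isTangent_one
  have hD (f : Fn P.X) : KaehlerDifferential.D K (FrobTwist K p) (Fn.eval σ f) = 0 := by
    have h2 := firstOrderPoint_smul p h P σ
    rw [h1, Torsor.one_smul'] at h2
    have h3 := DFunLike.congr_fun (congrArg Fn.eval h2) f
    rw [Fn.eval_specMap, Fn.eval_specMap] at h3
    simpa using congr(($h3.symm).snd)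
  have : CharP (FrobTwist K p) p := inferInstanceAs (CharP K p)
  have hK' : IsField (FrobTwist K p) := hK
  have hrange (f : Fn P.X) : ∃ k, algebraMap K (FrobTwist K p) k = Fn.eval σ f :=
    mem_range_of_kaehlerDifferential_eq_zero_of_isField p hK hK' (exists_pow_eq p) _ (hD f)
  have : Nontrivial (FrobTwist K p) := hK.nontrivial
  have hinj := algebraMap_injective_of_isField hK (FrobTwist K p)
  obtain ⟨s, hs⟩ : ∃ s : specAlg K K ⟶ P.X, specMap (Algebra.ofId K _) ≫ s = σ := by
    let e : K ≃ₐ[K] (Algebra.ofId K (FrobTwist K p)).range :=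
      AlgEquiv.ofInjective (Algebra.ofId K (FrobTwist K p)) hinj
    obtain ⟨s, hs⟩ := Fn.eval_surjective (X := P.X) (L := K)
      (e.symm.toAlgHom.comp ((Fn.eval σ).codRestrict (Algebra.ofId K (FrobTwist K p)).range hrange))
    refine ⟨s, Fn.eval_injective (AlgHom.ext fun f ↦ ?_)⟩
    rw [Fn.eval_specMap, hs]
    exact congr(($(e.apply_symm_apply ⟨Fn.eval σ f, hrange f⟩) : FrobTwist K p))
  have hmono : Mono (specAlg K K).hom := inferInstanceAs (Mono (Spec.map (𝟙 K)))
  rw [h.cocycle_mk, Torsor.cocycle]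
  refine P.diff_eq ?_
  -- the section comes from the base, so that its two pull-backs agree
  have h4 : fst (frobPt p) (frobPt p) ≫ σ = snd (frobPt p) (frobPt p) ≫ σ := by
    rw [← hs, ← Category.assoc, ← Category.assoc]
    congr 1
    ext1
    rw [← cancel_mono (specAlg K K).hom, Over.w, Over.w]
  exact (P.one_smul' _).trans h4.symm

lemma phi_injective [Flat (frobPt (K := K) p).hom] [Surjective (frobPt (K := K) p).hom]
    [QuasiCompact (frobPt (K := K) p).hom] (hK : IsField K) [IsAffine G.X.left] [IsCommMonObj G.X]
    (hP : ∀ P : Torsor G, IsAffine P.X.left) (h : HasUniqueSections (frobPt (K := K) p) G) :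
    Function.Injective (phi p h) := by
  let := h.addCommGroup
  refine (injective_iff_map_eq_zero (phiHom p h)).2 fun c hc ↦ h.cocycle_injective ?_
  exact (cocycle_eq_one_of_phi_eq_zero p hK hP h c hc).trans h.cocycle_zero.symm

end PhiMap

/-! ### Exactness of the sequence of tangent spaces of the kernels -/

section LeftExact

variable {K : CommRingCat.{u}} (p : ℕ) [Fact p.Prime] [CharP K p]
variable {G H J : Grp (Over (Spec K))} (f : G ⟶ H) (h : H ⟶ J)

lemma frobHom_push_apply_tmul {G G' : Grp (Over (Spec K))} (a : G ⟶ G') (φ : FrobHom p G)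
    (c : FrobTwist K p) (w : CoLie G') :
    FrobHom.push p a φ (c ⊗ₜ w) = φ (c ⊗ₜ CoLie.pull a w) := rfl

/-- A linear map `F_K^* ω_G → Ω_{F_K}` as a linear map on `ω_G`. -/
def FrobHom.restrict {G : Grp (Over (Spec K))} (φ : FrobHom p G) :
    CoLie G →ₗ[K] Ω[FrobTwist K p⁄K] :=
  (LinearMap.liftBaseChangeEquiv (FrobTwist K p)).symm φ

lemma FrobHom.restrict_injective {G : Grp (Over (Spec K))} :
    Function.Injective (FrobHom.restrict p (G := G)) :=
  (LinearMap.liftBaseChangeEquiv (FrobTwist K p)).symm.injective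

lemma FrobHom.restrict_apply {G : Grp (Over (Spec K))} (φ : FrobHom p G) (w : CoLie G) :
    φ.restrict p w = φ (1 ⊗ₜ w) := by
  simp [FrobHom.restrict]

lemma FrobHom.restrict_push {G G' : Grp (Over (Spec K))} (a : G ⟶ G') (φ : FrobHom p G) :
    (FrobHom.push p a φ).restrict p = φ.restrict p ∘ₗ CoLie.pull a := by
  ext w
  simp [FrobHom.restrict_apply, frobHom_push_apply_tmul]

variable {p} in
lemma exists_isTangent_restrict {G : Grp (Over (Spec K))} [IsAffine G.X.left] (φ : FrobHom p G) :
    ∃ x : specAlg K (FirstOrder K p) ⟶ G.X, IsTangent x (φ.restrict p) :=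
  exists_isTangent _

/-- Linear maps `ω_G → Ω_{F_K}` are points of `G` with values in `K^{[1]} ⊕ Ω_{F_K}`, and the
monomorphism `kerIncl f h` is injective on points. -/
lemma frobHom_push_kerIncl_injective [IsAffine (kernel f).X.left]
    [IsAffine (kernel (f ≫ h)).X.left] :
    Function.Injective (FrobHom.push p (kerIncl f h)) := by
  have := mono_kerIncl f h
  intro φ ψ hφψ
  obtain ⟨x, hx⟩ := exists_isTangent_restrict φ
  obtain ⟨y, hy⟩ := exists_isTangent_restrict ψ
  have hx' := hx.comp (kerIncl f h)
  have hy' := hy.comp (kerIncl f h)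
  rw [← FrobHom.restrict_push] at hx' hy'
  rw [← hφψ] at hy'
  obtain rfl : x = y := (cancel_mono _).1 (hx'.left_unique hy')
  exact FrobHom.restrict_injective p (hx.right_unique hy)

/-- A point of `ker (h ∘ f)` with values in `K^{[1]} ⊕ Ω_{F_K}` that is killed by `f` is a point of
`ker f`. -/
lemma exact_frobHom_push [IsAffine (kernel f).X.left]
    [IsAffine (kernel (f ≫ h)).X.left] [IsAffine (kernel h).X.left] :
    Function.Exact (FrobHom.push p (kerIncl f h)) (FrobHom.push p (kerMap f h)) := by
  have := mono_kerIncl f h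
  intro φ
  obtain ⟨x, hx⟩ := exists_isTangent_restrict φ
  have hx' := hx.comp (kerMap f h)
  rw [← FrobHom.restrict_push] at hx'
  constructor
  · intro h0
    rw [h0] at hx'
    have h1 : x ≫ (kerMap f h).hom.hom = 1 := hx'.left_unique isTangent_one
    obtain ⟨y, rfl⟩ := exists_comp_kerIncl f h x h1
    obtain ⟨δ, hδ⟩ := exists_isTangent_of_specMap_fstHom y (by
      rw [← cancel_mono (kerIncl f h).hom.hom, Category.assoc, hx.specMap_fstHom, one_comp])
    refine ⟨LinearMap.liftBaseChange (FrobTwist K p) δ, FrobHom.restrict_injective p ?_⟩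
    rw [hx.right_unique (hδ.comp _), FrobHom.restrict_push]
    congr 1
    ext w
    simp [FrobHom.restrict_apply]
  · rintro ⟨ψ, rfl⟩
    obtain ⟨y, hy⟩ := exists_isTangent_restrict ψ
    have hy' := hy.comp (kerIncl f h)
    rw [← FrobHom.restrict_push] at hy'
    obtain rfl := hx.left_unique hy'
    rw [kerIncl_comp_kerMap] at hx'
    exact FrobHom.restrict_injective p (hx'.right_unique isTangent_one)

end LeftExact

/-! ### Lifting tangent vectors along isogenies of height one -/

section Lifting

/-- Faithfully flat descent of elements, over a field. -/
lemma mem_range_of_tmul_one_eq {k F : Type*} [Field k] [CommRing F] [Algebra k F] (y : F)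
    (hy : y ⊗ₜ[k] (1 : F) = 1 ⊗ₜ[k] y) : y ∈ (algebraMap k F).range := by
  by_contra h
  have h' : y ∉ Submodule.span k {(1 : F)} := fun hm ↦ h (by
    obtain ⟨a, rfl⟩ := Submodule.mem_span_singleton.1 hm
    exact ⟨a, Algebra.algebraMap_eq_smul_one a⟩)
  obtain ⟨l, hly, hl⟩ := Submodule.exists_dual_map_eq_bot_of_notMem h' inferInstance
  have h1 : l 1 = 0 := by
    have : l 1 ∈ (Submodule.span k {(1 : F)}).map l :=
      Submodule.mem_map_of_mem (Submodule.mem_span_singleton_self _)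
    rwa [hl, Submodule.mem_bot] at this
  have h2 := congr(LinearMap.lTensor F l $hy)
  rw [LinearMap.lTensor_tmul, LinearMap.lTensor_tmul, h1, TensorProduct.tmul_zero] at h2
  have h3 := congr(TensorProduct.rid k F $h2)
  rw [map_zero, TensorProduct.rid_tmul] at h3
  have : Nontrivial F := ⟨y, 0, fun h0 ↦ hly (by rw [h0, map_zero])⟩
  exact (smul_ne_zero hly (one_ne_zero (α := F))) h3.symm

variable {K : CommRingCat.{u}} (p : ℕ) [Fact p.Prime]
variable {A B J : Grp (Over (Spec K))}

lemma specMap_injective {L L' : Type u} [CommRing L] [Algebra K L] [CommRing L'] [Algebra K L'] :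
    Function.Injective (specMap : (L →ₐ[K] L') → (specAlg K L' ⟶ specAlg K L)) := by
  intro l l' h
  have h' : Spec.map (CommRingCat.ofHom l.toRingHom) = Spec.map (CommRingCat.ofHom l'.toRingHom) :=
    congr(($h).left)
  ext x
  exact congr(($(Spec.map_injective h')).hom x)

/-- Let `f : A → B` be a homomorphism whose kernel has height one. If a point `z` of `A` with values
in `F` that is a monomorphism lies over a point of `B` with values in the field `k`, then
`F ^ p ⊆ k`: the two points of `A` with values in `F ⊗ F` that are given by `z` differ by a point of
the kernel, which Frobenius kills. -/
lemma exists_algebraMap_eq_pow_of_isHeightOne (f : A ⟶ B) (hf : IsHeightOne p (kernel f))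
    {F k : Type u} [CommRing F] [Field k] [Algebra K F] [Algebra K k] [Algebra k F]
    [IsScalarTower K k F] [CharP F p] [Nontrivial F] (z : specAlg K F ⟶ A.X) [Mono z]
    (z₁ : specAlg K k ⟶ B.X)
    (hz : z ≫ f.hom.hom = specMap (IsScalarTower.toAlgHom K k F) ≫ z₁) (x : F) :
    ∃ a : k, algebraMap k F a = x ^ p := by
  have : CharP k p := (algebraMap k F).charP (algebraMap k F).injective p
  have : CharP (F ⊗[k] F) p :=
    charP_of_injective_ringHom (f := algebraMap k (F ⊗[k] F)) (RingHom.injective _) p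
  let l₁ : F →ₐ[K] F ⊗[k] F := Algebra.TensorProduct.includeLeft
  let l₂ : F →ₐ[K] F ⊗[k] F :=
    (Algebra.TensorProduct.includeRight : F →ₐ[k] F ⊗[k] F).restrictScalars K
  have hl : l₁.comp (IsScalarTower.toAlgHom K k F) = l₂.comp (IsScalarTower.toAlgHom K k F) := by
    ext a
    exact Algebra.TensorProduct.tmul_one_eq_one_tmul a
  obtain ⟨g, hg⟩ := exists_comp_kernel_ι f ((specMap l₁ ≫ z) * (specMap l₂ ≫ z)⁻¹) (by
    rw [mul_comp, GrpObj.inv_comp, Category.assoc, Category.assoc, hz, ← Category.assoc,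
      ← Category.assoc, ← specMap_comp, ← specMap_comp, hl, mul_inv_cancel])
  have h₁ := absFrob_comp p hf _ g
  have h₂ : absFrob p (F ⊗[k] F) ≫ specMap l₁ ≫ z = absFrob p (F ⊗[k] F) ≫ specMap l₂ ≫ z := by
    have h₃ : absFrob p (F ⊗[k] F) ≫ g ≫ (kernel.ι f).hom.hom = 1 := by
      rw [← Category.assoc, h₁, one_comp]
    rwa [hg, comp_mul, GrpObj.comp_inv, mul_inv_eq_one] at h₃
  rw [← Category.assoc, ← Category.assoc, cancel_mono] at h₂
  have h₄ : Spec.map (CommRingCat.ofHom (frobenius (F ⊗[k] F) p)) ≫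
      Spec.map (CommRingCat.ofHom l₁.toRingHom) = Spec.map (CommRingCat.ofHom
        (frobenius (F ⊗[k] F) p)) ≫ Spec.map (CommRingCat.ofHom l₂.toRingHom) := congr(($h₂).left)
  rw [← Spec.map_comp, ← Spec.map_comp] at h₄
  have h₅ : (x ⊗ₜ[k] (1 : F)) ^ p = (1 ⊗ₜ[k] x) ^ p := congr(($(Spec.map_injective h₄)).hom x)
  rw [Algebra.TensorProduct.tmul_pow, Algebra.TensorProduct.tmul_pow, one_pow] at h₅
  exact mem_range_of_tmul_one_eq _ h₅

/-- Lifting of tangent vectors. Let `z`, `z'`, `z₁` be compatible points of `A`, `B`, `J` with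
values in the fields `k ⊆ E ⊆ F`, such as the generic points of varieties. A tangent vector `d` of
the kernel of `h : B → J` with values in `F` translates `z` to a point of `B` with values in `F[ε]`,
that is, to a derivation of `E` over `k` into `F`. It extends to `F` because `F ^ p ⊆ k`, and
gives a point of `A` with values in `F[ε]`. Its quotient by `z` is a tangent vector that lifts
`d`. -/
lemma exists_lift_tangent (f : A ⟶ B) (h : B ⟶ J) (hfh : IsHeightOne p (kernel (f ≫ h)))
    {F E k : Type u} [Field F] [Field E] [Field k] [Algebra K F] [Algebra K E] [Algebra K k]
    [CharP F p] (φ : E →ₐ[K] F) (χ : k →ₐ[K] E)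
    (z : specAlg K F ⟶ A.X) [Mono z] (z' : specAlg K E ⟶ B.X) [Mono z'] (z₁ : specAlg K k ⟶ J.X)
    [Mono z₁]
    (hz' : z ≫ f.hom.hom = specMap φ ≫ z') (hz₁ : z' ≫ h.hom.hom = specMap χ ≫ z₁)
    (hB : ∀ y : specAlg K (TrivSqZeroExt F F) ⟶ B.X,
      specMap (TrivSqZeroExt.fstHom K F F) ≫ y = specMap φ ≫ z' →
        ∃ l : E →ₐ[K] TrivSqZeroExt F F, specMap l ≫ z' = y)
    (d : specAlg K (TrivSqZeroExt F F) ⟶ B.X) (hd : d ≫ h.hom.hom = 1)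
    (hd1 : specMap (TrivSqZeroExt.fstHom K F F) ≫ d = 1) :
    ∃ a : specAlg K (TrivSqZeroExt F F) ⟶ A.X, a ≫ f.hom.hom = d ∧
      specMap (TrivSqZeroExt.fstHom K F F) ≫ a = 1 := by
  let : Algebra k F := (φ.comp χ).toRingHom.toAlgebra
  have hkF (c : k) : algebraMap k F c = φ (χ c) := rfl
  have : IsScalarTower K k F := .of_algebraMap_eq fun r ↦ by simp [hkF]
  have hφχ : IsScalarTower.toAlgHom K k F = φ.comp χ := rfl
  have hpow := exists_algebraMap_eq_pow_of_isHeightOne p (f ≫ h) hfh z z₁ (by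
    rw [hφχ, specMap_comp, Category.assoc, ← hz₁, ← Category.assoc (specMap φ), ← hz',
      Category.assoc]
    rfl)
  let π := TrivSqZeroExt.fstHom K F F
  let i := TrivSqZeroExt.inlAlgHom K F F
  have hπi : specMap π ≫ specMap i = 𝟙 _ := by
    rw [← specMap_comp, ← specMap_id]
    congr 1
  -- the translate of the point `z'` by the tangent vector
  obtain ⟨l, hl⟩ := hB ((specMap i ≫ z ≫ f.hom.hom) * d) (by
    rw [comp_mul, hd1, _root_.mul_one, ← Category.assoc, hπi, Category.id_comp, hz'])
  -- `l` is `k`-linear, as `d` is killed by `h`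
  have hlχ (c : k) : l (χ c) = TrivSqZeroExt.inl (φ (χ c)) := by
    have h₁ : specMap (l.comp χ) = specMap (i.comp (φ.comp χ)) := by
      rw [← cancel_mono z₁, specMap_comp, specMap_comp, specMap_comp, Category.assoc, ← hz₁,
        ← Category.assoc, hl, mul_comp, hd, _root_.mul_one, Category.assoc, Category.assoc,
        Category.assoc, Category.assoc, ← hz₁, ← Category.assoc (specMap φ), ← hz', Category.assoc]
    exact DFunLike.congr_fun (specMap_injective h₁) c
  have hlφ (e : E) : (l e).fst = φ e := by
    have h₁ : specMap (π.comp l) = specMap φ := by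
      rw [← cancel_mono z', specMap_comp, Category.assoc, hl, comp_mul, hd1, _root_.mul_one,
        ← Category.assoc, hπi, Category.id_comp, hz']
    exact DFunLike.congr_fun (specMap_injective h₁) e
  let : Algebra k E := χ.toRingHom.toAlgebra
  let l' : E →ₐ[k] TrivSqZeroExt F F := { l with commutes' := hlχ }
  -- the range of `l` is the graph of a derivation
  obtain ⟨s, hs, hsl⟩ := exists_section_trivSqZeroExt p hpow l'.range (by
    rintro _ ⟨e, rfl⟩ h0
    have h1 : φ e = 0 := (hlφ e).symm.trans h0
    rw [(map_eq_zero φ).1 h1]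
    exact map_zero l')
  have : IsScalarTower K k (TrivSqZeroExt F F) := .of_algebraMap_eq fun r ↦
    congrArg TrivSqZeroExt.inl (IsScalarTower.algebraMap_apply K k F r)
  let s' : F →ₐ[K] TrivSqZeroExt F F := s.restrictScalars K
  have hsφ : s'.comp φ = l := by
    ext1 e
    have := hsl (l e) ⟨e, rfl⟩
    rwa [hlφ] at this
  have hπs : specMap π ≫ specMap s' = 𝟙 _ := by
    rw [← specMap_comp, ← specMap_id]
    congr 1
    ext x
    exact hs x
  refine ⟨(specMap i ≫ z)⁻¹ * (specMap s' ≫ z), ?_, ?_⟩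
  · rw [mul_comp, GrpObj.inv_comp, Category.assoc, Category.assoc, hz', ← Category.assoc,
      ← Category.assoc, ← specMap_comp, ← specMap_comp, hsφ, hl, specMap_comp, Category.assoc,
      ← hz', inv_mul_cancel_left]
  · rw [comp_mul, GrpObj.comp_inv, ← Category.assoc, ← Category.assoc, hπi, hπs, inv_mul_cancel]

end Lifting

/-! ### Injectivity of the pull-back of differential forms on kernels -/

section PushSurjective

variable {K : CommRingCat.{u}} (p : ℕ) [Fact p.Prime] [CharP K p]

lemma exists_comp_eq_of_injective {R M N P : Type*} [hR : CommRing R] (h : IsField R)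
    [AddCommGroup M] [Module R M] [AddCommGroup N] [Module R N] [AddCommGroup P] [Module R P]
    (f : M →ₗ[R] N) (hf : Function.Injective f) (g : M →ₗ[R] P) :
    ∃ g' : N →ₗ[R] P, g' ∘ₗ f = g := by
  obtain ⟨_, rfl⟩ := exists_field_toCommRing_eq h
  obtain ⟨r, hr⟩ := f.exists_leftInverse_of_injective (LinearMap.ker_eq_bot.2 hf)
  exact ⟨g ∘ₗ r, by rw [LinearMap.comp_assoc, hr, LinearMap.comp_id]⟩

lemma frobHom_push_surjective (hK : IsField K) {G G' : Grp (Over (Spec K))} (a : G ⟶ G')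
    (ha : Function.Injective (CoLie.pull a)) : Function.Surjective (FrobHom.push p a) := by
  have := Module.Flat.of_isField hK (FrobTwist K p)
  have hinj : Function.Injective ((CoLie.pull a).baseChange (FrobTwist K p)) :=
    Module.Flat.lTensor_preserves_injective_linearMap (CoLie.pull a) ha
  have hK' : IsField (FrobTwist K p) := hK
  exact fun φ ↦ exists_comp_eq_of_injective hK' _ hinj φ

lemma exists_functional_ne_zero {R M : Type*} [hR : CommRing R] (h : IsField R)
    [AddCommGroup M] [Module R M] (w : M) (hw : w ≠ 0) : ∃ l : M →ₗ[R] R, l w ≠ 0 := by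
  obtain ⟨_, rfl⟩ := exists_field_toCommRing_eq h
  exact Module.Projective.exists_dual_ne_zero R hw

/-- If all tangent vectors of `G'` with values in a non-zero `K`-algebra lift to `G`, then the
pull-back of differential forms is injective. -/
lemma coLie_pull_injective (hK : IsField K) {G G' : Grp (Over (Spec K))} (a : G ⟶ G')
    [IsAffine G'.X.left] (F : Type u) [CommRing F] [Nontrivial F] [Algebra K F]
    (ha : ∀ x : specAlg K (TrivSqZeroExt F F) ⟶ G'.X,
      specMap (TrivSqZeroExt.fstHom K F F) ≫ x = 1 →
        ∃ y : specAlg K (TrivSqZeroExt F F) ⟶ G.X,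
          specMap (TrivSqZeroExt.fstHom K F F) ≫ y = 1 ∧ y ≫ a.hom.hom = x) :
    Function.Injective (CoLie.pull a) := by
  rw [injective_iff_map_eq_zero]
  intro w hw
  by_contra hne
  obtain ⟨l, hl⟩ := exists_functional_ne_zero hK w hne
  let δ : CoLie G' →ₗ[K] F := Algebra.linearMap K F ∘ₗ l
  obtain ⟨x, hx⟩ := exists_isTangent (R := F) δ
  obtain ⟨y, hy, rfl⟩ := ha x hx.specMap_fstHom
  obtain ⟨δ', hδ'⟩ := exists_isTangent_of_specMap_fstHom y hy
  have h1 : δ w = 0 := by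
    rw [hx.right_unique (hδ'.comp a), LinearMap.comp_apply, hw, map_zero]
  exact hl (algebraMap_injective_of_isField hK F (h1.trans (map_zero _).symm))

/-- The tangent vectors lift by `exists_lift_tangent`. -/
lemma coLie_pull_kerMap_injective_of_points (hK : IsField K) {A B J : Grp (Over (Spec K))}
    (f : A ⟶ B) (h : B ⟶ J) (hfh : IsHeightOne p (kernel (f ≫ h))) [IsAffine (kernel h).X.left]
    {F E k : Type u} [CommRing F] [CommRing E] [CommRing k] [Algebra K F] [Algebra K E]
    [Algebra K k] (hF : IsField F) (hE : IsField E) (hk : IsField k)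
    (φ : E →ₐ[K] F) (χ : k →ₐ[K] E)
    (z : specAlg K F ⟶ A.X) [Mono z] (z' : specAlg K E ⟶ B.X) [Mono z'] (z₁ : specAlg K k ⟶ J.X)
    [Mono z₁] (hz' : z ≫ f.hom.hom = specMap φ ≫ z') (hz₁ : z' ≫ h.hom.hom = specMap χ ≫ z₁)
    (hB : ∀ y : specAlg K (TrivSqZeroExt F F) ⟶ B.X,
      specMap (TrivSqZeroExt.fstHom K F F) ≫ y = specMap φ ≫ z' →
        ∃ l : E →ₐ[K] TrivSqZeroExt F F, specMap l ≫ z' = y) :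
    Function.Injective (CoLie.pull (kerMap f h)) := by
  obtain ⟨_, rfl⟩ := exists_field_toCommRing_eq hF
  obtain ⟨_, rfl⟩ := exists_field_toCommRing_eq hE
  obtain ⟨_, rfl⟩ := exists_field_toCommRing_eq hk
  have : CharP F p := charP_of_isField p hK F
  have := mono_kernel_ι h
  have := mono_kernel_ι (f ≫ h)
  refine coLie_pull_injective hK _ F fun x hx ↦ ?_
  obtain ⟨a, ha, ha1⟩ := exists_lift_tangent p f h hfh φ χ z z' z₁ hz' hz₁ hB
    (x ≫ (kernel.ι h).hom.hom) (kernel_ι_comp h x) (by rw [← Category.assoc, hx, one_comp])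
  obtain ⟨y, rfl⟩ := exists_comp_kernel_ι (f ≫ h) a (by
    change a ≫ f.hom.hom ≫ h.hom.hom = 1
    rw [← Category.assoc, ha, kernel_ι_comp])
  refine ⟨y, ?_, ?_⟩
  · rw [← cancel_mono (kernel.ι (f ≫ h)).hom.hom, Category.assoc, ha1, one_comp]
  · rw [← cancel_mono (kernel.ι h).hom.hom, Category.assoc, kerMap_comp, ← ha, Category.assoc]

end PushSurjective

/-! ### Local rings and generic points of schemes over an affine base -/

section Stalks

variable {K : CommRingCat.{u}}

/-- The local ring of a `K`-scheme at a point. -/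
def StalkAlg (X : Over (Spec K)) (x : X.left) : Type u := X.left.presheaf.stalk x

variable (X Y : Over (Spec K))

instance (x : X.left) : CommRing (StalkAlg X x) :=
  inferInstanceAs (CommRing (X.left.presheaf.stalk x))

instance (x : X.left) : IsLocalRing (StalkAlg X x) :=
  inferInstanceAs (IsLocalRing (X.left.presheaf.stalk x))

instance (x : X.left) : Algebra K (StalkAlg X x) :=
  (Spec.preimage (X.left.fromSpecStalk x ≫ X.hom)).hom.toAlgebra

/-- The canonical morphism from the spectrum of a local ring of a `K`-scheme. -/
def stalkPoint (x : X.left) : specAlg K (StalkAlg X x) ⟶ X :=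
  Over.homMk (U := specAlg K (StalkAlg X x)) (X.left.fromSpecStalk x)
    (Spec.map_preimage (X.left.fromSpecStalk x ≫ X.hom)).symm

instance (x : X.left) : Mono (stalkPoint X x) := by
  have : Mono (stalkPoint X x).left := inferInstanceAs (Mono (X.left.fromSpecStalk x))
  exact Over.mono_of_mono_left _

variable {X Y}

lemma exists_algHom_of_specMap {L L' : Type u} [CommRing L] [Algebra K L] [CommRing L']
    [Algebra K L'] (g : specAlg K L' ⟶ specAlg K L) : ∃ l : L →ₐ[K] L', specMap l = g := by
  obtain ⟨l, hl⟩ := Spec.map_surjective (R := .of L) (S := .of L') g.left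
  have h1 : Spec.map l ≫ Spec.map (CommRingCat.ofHom (algebraMap K L)) =
      Spec.map (CommRingCat.ofHom (algebraMap K L')) := by
    rw [hl]
    exact Over.w g
  rw [← Spec.map_comp] at h1
  have h2 := Spec.map_injective h1
  exact ⟨{ l.hom with commutes' := fun r ↦ congr(($h2).hom r) }, Over.OverMorphism.ext hl⟩

lemma exists_specMap_fromSpecStalk_eq {X : Scheme.{u}} {R : CommRingCat.{u}} [IsLocalRing R]
    (y : Spec R ⟶ X) (x : X) (hx : y (IsLocalRing.closedPoint R) = x) :
    ∃ l : X.presheaf.stalk x ⟶ R, Spec.map l ≫ X.fromSpecStalk x = y := by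
  subst hx
  exact ⟨_, Scheme.Spec_stalkClosedPointTo_fromSpecStalk y⟩

/-- The image of the closed point under a point with values in a local ring. -/
def supportPt {R : Type u} [CommRing R] [IsLocalRing R] [Algebra K R] (y : specAlg K R ⟶ X) :
    X.left :=
  y.left (IsLocalRing.closedPoint R)

lemma supportPt_comp {R : Type u} [CommRing R] [IsLocalRing R] [Algebra K R] (y : specAlg K R ⟶ X)
    (f : X ⟶ Y) : supportPt (y ≫ f) = f.left (supportPt y) :=
  rfl

lemma supportPt_specMap_comp {R R' : Type u} [CommRing R] [IsLocalRing R] [Algebra K R]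
    [CommRing R'] [IsLocalRing R'] [Algebra K R'] (l : R →ₐ[K] R') [IsLocalHom l.toRingHom]
    (y : specAlg K R ⟶ X) : supportPt (specMap l ≫ y) = supportPt y :=
  congrArg y.left (IsLocalRing.comap_closedPoint l.toRingHom)

/-- A morphism from the spectrum of a local `K`-algebra factors through the spectrum of the local
ring at the image of the closed point. -/
lemma exists_specMap_stalkPoint_eq {R : Type u} [CommRing R] [IsLocalRing R] [Algebra K R]
    (y : specAlg K R ⟶ X) (x : X.left) (hx : supportPt y = x) :
    ∃ l : StalkAlg X x →ₐ[K] R, specMap l ≫ stalkPoint X x = y := by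
  obtain ⟨l, hl⟩ := exists_specMap_fromSpecStalk_eq (R := .of R) y.left x hx
  have hl' : Spec.map l ≫ (specAlg K (StalkAlg X x)).hom = (specAlg K R).hom := by
    have h1 : (stalkPoint X x).left ≫ X.hom = (specAlg K (StalkAlg X x)).hom :=
      Over.w (stalkPoint X x)
    rw [← h1, ← Over.w y, ← hl]
    exact (Category.assoc _ _ _).symm
  obtain ⟨l', h'⟩ := exists_algHom_of_specMap
    (Over.homMk (U := specAlg K R) (V := specAlg K (StalkAlg X x)) (Spec.map l) hl')
  exact ⟨l', by rw [h']; ext1; exact hl⟩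

lemma supportPt_stalkPoint (x : X.left) : supportPt (stalkPoint X x) = x :=
  Scheme.fromSpecStalk_closedPoint

lemma exists_stalk_algHom (f : X ⟶ Y) (x : X.left) (y : Y.left) (hy : f.left x = y) :
    ∃ φ : StalkAlg Y y →ₐ[K] StalkAlg X x, stalkPoint X x ≫ f = specMap φ ≫ stalkPoint Y y := by
  obtain ⟨φ, h⟩ := exists_specMap_stalkPoint_eq (stalkPoint X x ≫ f) y (by
    rw [supportPt_comp, supportPt_stalkPoint, hy])
  exact ⟨φ, h.symm⟩

lemma isField_stalkAlg [IsIntegral X.left] : IsField (StalkAlg X (genericPoint X.left)) :=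
  Field.toIsField X.left.functionField

lemma map_genericPoint (f : X ⟶ Y) [IsIntegral X.left] [IsIntegral Y.left] [Surjective f.left] :
    f.left (genericPoint X.left) = genericPoint Y.left := by
  have h := (genericPoint_spec X.left).image f.left.continuous
  rw [Set.image_univ, f.left.surjective.range_eq, closure_univ] at h
  exact h.eq (genericPoint_spec Y.left)

end Stalks

section GenericPoints

variable {K : CommRingCat.{u}} (p : ℕ) [Fact p.Prime] [CharP K p]

/-- The pull-back of differential forms from `ker h` to `ker (h ∘ f)` is injective for surjective
homomorphisms `f : A → B` and `h : B → J` of integral group schemes such that `h ∘ f` has a kernel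
of height one: tangent vectors lift by means of the generic points of `A`, `B` and `J`. -/
lemma coLie_pull_kerMap_injective (hK : IsField K) {A B J : Grp (Over (Spec K))}
    (f : A ⟶ B) (h : B ⟶ J) (hfh : IsHeightOne p (kernel (f ≫ h))) [IsAffine (kernel h).X.left]
    [IsIntegral A.X.left] [IsIntegral B.X.left] [IsIntegral J.X.left]
    [Surjective f.hom.hom.left] [Surjective h.hom.hom.left] :
    Function.Injective (CoLie.pull (kerMap f h)) := by
  obtain ⟨φ, hφ⟩ := exists_stalk_algHom f.hom.hom _ _ (map_genericPoint f.hom.hom)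
  obtain ⟨χ, hχ⟩ := exists_stalk_algHom h.hom.hom _ _ (map_genericPoint h.hom.hom)
  -- `F[ε]` is a local ring, and a point that reduces to the generic point factors through the
  -- local ring there
  have hB (y : specAlg K (TrivSqZeroExt (StalkAlg A.X (genericPoint A.X.left))
      (StalkAlg A.X (genericPoint A.X.left))) ⟶ B.X)
      (hy : specMap (TrivSqZeroExt.fstHom K _ _) ≫ y = specMap φ ≫ stalkPoint B.X _) :
      ∃ l, specMap l ≫ stalkPoint B.X (genericPoint B.X.left) = y := by
    have hlocal : IsLocalHom (TrivSqZeroExt.fstHom K (StalkAlg A.X (genericPoint A.X.left))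
        (StalkAlg A.X (genericPoint A.X.left))).toRingHom :=
      ⟨fun a ha ↦ TrivSqZeroExt.isUnit_iff_isUnit_fst.2 ha⟩
    have : IsLocalRing (TrivSqZeroExt (StalkAlg A.X (genericPoint A.X.left))
      (StalkAlg A.X (genericPoint A.X.left))) :=
      RingHom.domain_isLocalRing
        (TrivSqZeroExt.fstHom K _ _ : _ →ₐ[K] StalkAlg A.X (genericPoint A.X.left)).toRingHom
    refine exists_specMap_stalkPoint_eq y _ ?_
    rw [← supportPt_specMap_comp (TrivSqZeroExt.fstHom K _ _) y, hy, ← hφ, supportPt_comp,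
      supportPt_stalkPoint, map_genericPoint]
  exact coLie_pull_kerMap_injective_of_points p hK f h hfh isField_stalkAlg isField_stalkAlg
    isField_stalkAlg φ χ _ _ _ hφ hχ hB

end GenericPoints

/-! ### Base change of isogenies of height one -/

section BaseChange

variable {S S' : Scheme.{u}} (q : S' ⟶ S)

/-- The base change of group schemes along `q`. -/
abbrev baseChange : Grp (Over S) ⥤ Grp (Over S') := (Over.pullback q).mapGrp

/-- The `T`-valued points of the base change of `G` are the points of `G` with values in `T`,
considered as a scheme over the original base. -/
def pointEquiv (T : Over S') (G : Grp (Over S)) :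
    ((Over.map q).obj T ⟶ G.X) ≃ (T ⟶ ((baseChange q).obj G).X) :=
  (Over.mapPullbackAdj q).homEquiv T G.X

lemma pointEquiv_one (T : Over S') (G : Grp (Over S)) :
    pointEquiv q T G 1 = (1 : T ⟶ ((baseChange q).obj G).X) := by
  have h1 : (1 : (Over.map q).obj T ⟶ G.X) = toUnit _ ≫ η[G.X] := rfl
  have h2 : (1 : T ⟶ ((baseChange q).obj G).X) =
      toUnit T ≫ Functor.LaxMonoidal.ε (Over.pullback q) ≫ (Over.pullback q).map η[G.X] := rfl
  rw [h2, h1]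
  refine ((Over.mapPullbackAdj q).homEquiv_unit _ _ _).trans ?_
  rw [Functor.map_comp, ← Category.assoc,
    ← Category.assoc]
  congr 1
  rw [← cancel_mono (Functor.OplaxMonoidal.η (Over.pullback q))]
  exact toUnit_unique _ _

lemma pointEquiv_comp {T : Over S'} {G H : Grp (Over S)} (f : G ⟶ H)
    (x : (Over.map q).obj T ⟶ G.X) :
    pointEquiv q T H (x ≫ f.hom.hom) = pointEquiv q T G x ≫ ((baseChange q).map f).hom.hom :=
  (Over.mapPullbackAdj q).homEquiv_naturality_right x f.hom.hom

lemma pointEquiv_precomp {T T' : Over S'} (t : T' ⟶ T) (G : Grp (Over S))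
    (x : (Over.map q).obj T ⟶ G.X) :
    pointEquiv q T' G ((Over.map q).map t ≫ x) = t ≫ pointEquiv q T G x :=
  (Over.mapPullbackAdj q).homEquiv_naturality_left t x

/-- The kernel of the base change is the base change of the kernel, on points. -/
lemma exists_pointEquiv_comp_eq {G H : Grp (Over S)} (f : G ⟶ H) {T : Over S'}
    (x : T ⟶ (kernel ((baseChange q).map f)).X) :
    ∃ y : (Over.map q).obj T ⟶ (kernel f).X,
      pointEquiv q T G (y ≫ (kernel.ι f).hom.hom) =
        x ≫ (kernel.ι ((baseChange q).map f)).hom.hom := by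
  obtain ⟨x', hx'⟩ := (pointEquiv q T G).surjective
    (x ≫ (kernel.ι ((baseChange q).map f)).hom.hom)
  obtain ⟨y, rfl⟩ := exists_comp_kernel_ι f x' (by
    apply (pointEquiv q T H).injective
    rw [pointEquiv_comp, hx', kernel_ι_comp, pointEquiv_one])
  exact ⟨y, hx'⟩

lemma exists_comp_eq_pointEquiv {G H : Grp (Over S)} (f : G ⟶ H) {T : Over S'}
    (y : (Over.map q).obj T ⟶ (kernel f).X) :
    ∃ x : T ⟶ (kernel ((baseChange q).map f)).X,
      x ≫ (kernel.ι ((baseChange q).map f)).hom.hom =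
        pointEquiv q T G (y ≫ (kernel.ι f).hom.hom) :=
  exists_comp_kernel_ι _ _ (by rw [← pointEquiv_comp, kernel_ι_comp, pointEquiv_one])

lemma nonempty_kernel_baseChange_iso {G H : Grp (Over S)} (f : G ⟶ H) :
    Nonempty ((kernel ((baseChange q).map f)).X ≅ ((baseChange q).obj (kernel f)).X) := by
  have := mono_kernel_ι f
  have := mono_kernel_ι ((baseChange q).map f)
  obtain ⟨u', hu⟩ := exists_pointEquiv_comp_eq q f (𝟙 (kernel ((baseChange q).map f)).X)
  let u := pointEquiv q _ _ u'
  obtain ⟨v, hv⟩ := exists_comp_eq_pointEquiv q f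
    ((pointEquiv q _ (kernel f)).symm (𝟙 ((baseChange q).obj (kernel f)).X))
  rw [pointEquiv_comp, Equiv.apply_symm_apply, Category.id_comp] at hv
  rw [pointEquiv_comp, Category.id_comp] at hu
  have : Mono ((baseChange q).map (kernel.ι f)).hom.hom :=
    inferInstanceAs (Mono ((Over.pullback q).map (kernel.ι f).hom.hom))
  refine ⟨u, v, ?_, ?_⟩
  · rw [← cancel_mono (kernel.ι ((baseChange q).map f)).hom.hom, Category.assoc, hv,
      Category.id_comp]
    exact hu
  · rw [← cancel_mono ((baseChange q).map (kernel.ι f)).hom.hom, Category.assoc, hu, hv]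
    exact (Category.id_comp _).symm

variable (p : ℕ) [Fact p.Prime]

lemma isHeightOne_kernel_baseChange {G H : Grp (Over S)} (f : G ⟶ H)
    (hf : IsHeightOne p (kernel f)) : IsHeightOne p (kernel ((baseChange q).map f)) := by
  obtain ⟨e⟩ := nonempty_kernel_baseChange_iso q f
  let w : (kernel ((baseChange q).map f)).X.left ⟶ pullback (kernel f).X.hom q := e.hom.left
  have he : (kernel ((baseChange q).map f)).X.hom = w ≫ pullback.snd _ _ := (Over.w e.hom).symm
  have : IsIso w := inferInstanceAs (IsIso ((Over.forget _).map e.hom))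
  have := hf.finite
  have := hf.flat
  refine ⟨?_, ?_, fun R _ _ g ↦ ?_⟩
  · rw [he]; infer_instance
  · rw [he]; infer_instance
  · let t := g ≫ (kernel ((baseChange q).map f)).X.hom
    let x : Over.mk t ⟶ (kernel ((baseChange q).map f)).X := Over.homMk g rfl
    let φ : Over.mk (Spec.map (CommRingCat.ofHom (frobenius R p)) ≫ t) ⟶ Over.mk t :=
      Over.homMk (Spec.map (CommRingCat.ofHom (frobenius R p))) rfl
    obtain ⟨y, hy⟩ := exists_pointEquiv_comp_eq q f x
    have h1 : (Over.map q).map φ ≫ y = 1 := hf.frobenius_comp p (t ≫ q) y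
    have h2 : φ ≫ x = 1 := by
      have := mono_kernel_ι ((baseChange q).map f)
      rw [← cancel_mono (kernel.ι ((baseChange q).map f)).hom.hom, Category.assoc, ← hy,
        ← pointEquiv_precomp, ← Category.assoc ((Over.map q).map φ), h1, one_comp, one_comp,
        pointEquiv_one]
    exact congr(($h2).left).trans (Category.assoc _ _ _)

lemma isCommMonObj_baseChange (G : Grp (Over S)) [IsCommMonObj G.X] :
    IsCommMonObj ((baseChange q).obj G).X :=
  ((Over.pullback q).mapCommMon.obj ⟨G.X⟩).comm

lemma surjective_baseChange_map {G H : Grp (Over S)} (f : G ⟶ H) (hf : Surjective f.hom.hom.left) :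
    Surjective ((baseChange q).map f).hom.hom.left :=
  MorphismProperty.overPullbackMap (P := @Surjective) q f.hom.hom hf

lemma isIntegral_of_geometricallyIntegral {K : CommRingCat.{u}} (hK : IsField K)
    (X : Over (Spec K)) [GeometricallyIntegral X.hom] : IsIntegral X.left := by
  have : Subsingleton (Spec K) := by
    let := hK.toField
    exact inferInstanceAs (Subsingleton (PrimeSpectrum K))
  have : IsIntegral (Spec K) := by
    have := hK.isDomain
    infer_instance
  exact GeometricallyIntegral.isIntegral_of_subsingleton X.hom

end BaseChange

end HeightOneSelmer

end

theorem mainTheorem7 {k₀ : Type u} [Field k₀] [PerfectField k₀] (p : ℕ) [Fact p.Prime] [CharP k₀ p]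
    (V : Scheme.{u}) [IsIntegral V] (s : V ⟶ Spec (.of k₀)) [Smooth s] [IsSeparated s]
    [QuasiCompact s] (𝒜 ℬ ℬ₁ : Grp (Over V))
    (h𝒜 : IsGenericallyAbelian 𝒜) (hℬ : IsGenericallyAbelian ℬ)
    (hℬ₁ : IsGenericallyAbelian ℬ₁) (ι : 𝒜 ⟶ ℬ) (β : ℬ ⟶ ℬ₁)
    (hι : IsHeightOneIsogeny p ι) (hβ : IsHeightOneIsogeny p β)
    (hβι : IsHeightOneIsogeny p (ι ≫ β)) :
    haveI := charP_functionField p s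
    let ιK := (genericFibre V).map ι
    let βK := (genericFibre V).map β
    let a := kerIncl ιK βK
    let b := kerMap ιK βK
    ∃ (_ : AddCommGroup (H1 (kernel ιK)))
      (_ : AddCommGroup (H1 (kernel (ιK ≫ βK))))
      (_ : AddCommGroup (H1 (kernel βK)))
      -- the maps induced on `H¹` by `a` and `b`
      (aH : H1 (kernel ιK) →+ H1 (kernel (ιK ≫ βK)))
      (bH : H1 (kernel (ιK ≫ βK)) →+ H1 (kernel βK))
      -- the Selmer groups and the maps between them
      (Sι : AddSubgroup (H1 (kernel ιK)))
      (Sβι : AddSubgroup (H1 (kernel (ιK ≫ βK))))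
      (Sβ : AddSubgroup (H1 (kernel βK)))
      (aS : Sι →+ Sβι) (bS : Sβι →+ Sβ)
      -- the maps `Φ`
      (Φι : H1 (kernel ιK) →+ FrobHom p (kernel ιK))
      (Φβι : H1 (kernel (ιK ≫ βK)) →+
        FrobHom p (kernel (ιK ≫ βK)))
      (Φβ : H1 (kernel βK) →+ FrobHom p (kernel βK)),
      -- identification of all these objects
      H1.IsStandardGroup (kernel ιK) ∧
      H1.IsStandardGroup (kernel (ιK ≫ βK)) ∧
      H1.IsStandardGroup (kernel βK) ∧
      H1.IsInducedBy a aH ∧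
      H1.IsInducedBy b bH ∧
      (Sι : Set (H1 (kernel ιK))) = selmerSet V ιK ∧
      (Sβι : Set (H1 (kernel (ιK ≫ βK)))) =
        selmerSet V (ιK ≫ βK) ∧
      (Sβ : Set (H1 (kernel βK))) = selmerSet V βK ∧
      (∀ c : Sι, (aS c : H1 (kernel (ιK ≫ βK))) = aH c) ∧
      (∀ c : Sβι, (bS c : H1 (kernel βK)) = bH c) ∧
      H1.IsPhi p Φι ∧
      H1.IsPhi p Φβι ∧
      H1.IsPhi p Φβ ∧
      -- the first row is exact
      Function.Injective aS ∧ Function.Exact aS bS ∧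
      -- the second row is exact
      Function.Injective (FrobHom.push p a) ∧
      Function.Exact (FrobHom.push p a) (FrobHom.push p b) ∧
      Function.Surjective (FrobHom.push p b) ∧
      -- the columns are exact
      Function.Injective (fun c : Sι ↦ Φι c) ∧
      Function.Injective (fun c : Sβι ↦ Φβι c) ∧
      Function.Injective (fun c : Sβ ↦ Φβ c) ∧
      -- the two squares commute
      (∀ c : Sι, Φβι (aS c) = FrobHom.push p a (Φι c)) ∧
      (∀ c : Sβι, Φβ (bS c) = FrobHom.push p b (Φβι c)) := by
  intro ιK βK a b
  have := charP_functionField p s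
  have hK : IsField V.functionField := Field.toIsField _
  let q := V.fromSpecStalk (genericPoint V)
  -- the kernels on the generic fibre
  have h₁ : IsHeightOne p (kernel ιK) := isHeightOne_kernel_baseChange q p ι hι.kernel_isHeightOne
  have h₃ : IsHeightOne p (kernel βK) := isHeightOne_kernel_baseChange q p β hβ.kernel_isHeightOne
  have h₂ : IsHeightOne p (kernel (ιK ≫ βK)) := by
    have h := isHeightOne_kernel_baseChange q p (ι ≫ β) hβι.kernel_isHeightOne
    rwa [Functor.map_comp] at h
  have := h₁.finite
  have := h₂.finite
  have := h₃.finite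
  have : IsAffine (kernel ιK).X.left := isAffine_of_isAffineHom (kernel ιK).X.hom
  have : IsAffine (kernel (ιK ≫ βK)).X.left := isAffine_of_isAffineHom (kernel (ιK ≫ βK)).X.hom
  have : IsAffine (kernel βK).X.left := isAffine_of_isAffineHom (kernel βK).X.hom
  have := h𝒜.comm
  have := hℬ.comm
  have : IsCommMonObj ((genericFibre V).obj 𝒜).X := isCommMonObj_baseChange q 𝒜
  have : IsCommMonObj ((genericFibre V).obj ℬ).X := isCommMonObj_baseChange q ℬ
  have := isCommMonObj_kernel ιK
  have := isCommMonObj_kernel (ιK ≫ βK)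
  have := isCommMonObj_kernel βK
  -- the generic fibres are integral, and the isogenies remain surjective
  have := h𝒜.generic_geometricallyIntegral
  have := hℬ.generic_geometricallyIntegral
  have := hℬ₁.generic_geometricallyIntegral
  have := isIntegral_of_geometricallyIntegral hK ((genericFibre V).obj 𝒜).X
  have := isIntegral_of_geometricallyIntegral hK ((genericFibre V).obj ℬ).X
  have := isIntegral_of_geometricallyIntegral hK ((genericFibre V).obj ℬ₁).X
  have : Surjective ιK.hom.hom.left := surjective_baseChange_map q ι hι.surjective
  have : Surjective βK.hom.hom.left := surjective_baseChange_map q β hβ.surjective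
  -- torsors under the kernels
  obtain ⟨_, _, _⟩ := frobPt_isCover p hK
  have u₁ := hasUniqueSections p hK h₁
  have u₂ := hasUniqueSections p hK h₂
  have u₃ := hasUniqueSections p hK h₃
  let := u₁.addCommGroup
  let := u₂.addCommGroup
  let := u₃.addCommGroup
  have := mono_kerIncl ιK βK
  have haff {G : Grp (Over (Spec V.functionField))} (hG : IsHeightOne p G) (P : Torsor G) :=
    isAffine_of_isHeightOne p hK hG P
  let aH := u₁.map u₂ a
  let bH := u₂.map u₃ b
  have haH : Function.Injective aH := u₁.map_injective u₂ a
  have hexact : Function.Exact aH bH := exact_map_kerIncl_map_kerMap u₁ u₂ u₃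
  let aS : selmerGroup V u₁ →+ selmerGroup V u₂ := (aH.comp (selmerGroup V u₁).subtype).codRestrict
    _ fun c ↦ (map_kerIncl_mem_selmerSet_iff V u₁ u₂ c.1).2 c.2
  let bS : selmerGroup V u₂ →+ selmerGroup V u₃ := (bH.comp (selmerGroup V u₂).subtype).codRestrict
    _ fun c ↦ map_kerMap_mem_selmerSet V u₂ u₃ c.2
  refine ⟨u₁.addCommGroup, u₂.addCommGroup, u₃.addCommGroup, aH, bH, selmerGroup V u₁,
    selmerGroup V u₂, selmerGroup V u₃, aS, bS, phiHom p u₁, phiHom p u₂, phiHom p u₃,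
    u₁.isStandardGroup, u₂.isStandardGroup, u₃.isStandardGroup, u₁.isInducedBy_map u₂ a,
    u₂.isInducedBy_map u₃ b, rfl, rfl, rfl, fun _ ↦ rfl, fun _ ↦ rfl, isPhi_phi p (haff h₁) u₁,
    isPhi_phi p (haff h₂) u₂, isPhi_phi p (haff h₃) u₃, ?_, ?_,
    frobHom_push_kerIncl_injective p ιK βK, exact_frobHom_push p ιK βK,
    frobHom_push_surjective p hK _ (coLie_pull_kerMap_injective p hK ιK βK h₂),
    (phi_injective p hK (haff h₁) u₁).comp Subtype.val_injective,
    (phi_injective p hK (haff h₂) u₂).comp Subtype.val_injective,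
    (phi_injective p hK (haff h₃) u₃).comp Subtype.val_injective,
    fun c ↦ phi_map p u₁ u₂ a c, fun c ↦ phi_map p u₂ u₃ b c⟩
  · exact fun c d h ↦ Subtype.ext (haH congr(($h : H1 (kernel (ιK ≫ βK)))))
  · intro c
    refine ⟨fun h ↦ ?_, ?_⟩
    · obtain ⟨d, hd⟩ := (hexact c).1 congr(($h : H1 (kernel βK)))
      have hdS : aH d ∈ selmerSet V (ιK ≫ βK) := hd ▸ c.2
      exact ⟨⟨d, (map_kerIncl_mem_selmerSet_iff V u₁ u₂ d).1 hdS⟩, Subtype.ext hd⟩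
    · rintro ⟨d, rfl⟩
      exact Subtype.ext ((hexact _).2 ⟨d, rfl⟩)
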